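/- Let $K$ be a field of characteristic zero, let $q\in K$ be nonzero, and let $n$ be a positive integer. Let $A_1^q(K)=K\langle x,y\mid yx-qxy=1\rangle$ be the quantum Weyl algebra, and let the symmetric group $S_n$ act on the $K$-algebra $A_1^q(K)^{\otimes_K n}$ by permuting the tensor factors. Then $A_1^q(K)^{\otimes_K n}$ is an Ore domain; extending the action of $S_n$ to its skew field of fractions $\operatorname{Frac}\big(A_1^q(K)^{\otimes_K n}\big)$, there is an isomorphism of $K$-algebras $$\Big(\operatorname{Frac}\big(A_1^q(K)^{\otimes_K n}\big)\Big)^{S_n}\;\cong\;\operatorname{Frac}\big(A_1^q(K)^{\otimes_K n}\big).$$ -/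

import Mathlib

open scoped TensorProduct nonZeroDivisors

/-! ### Ore domains and their skew fields of fractions -/

/-- A (left and right) Ore domain: a domain in which any two elements, the second one being nonzero,
have a common left multiple and a common right multiple of the appropriate form. -/
class IsOreDomain (A : Type*) [Ring A] : Prop extends IsDomain A where
  left_ore : ∀ a s : A, s ≠ 0 → ∃ a' s' : A, s' ≠ 0 ∧ s' * a = a' * s
  right_ore : ∀ a s : A, s ≠ 0 → ∃ a' s' : A, s' ≠ 0 ∧ a * s' = s * a'

/-- In an Ore domain, the nonzero elements form an Ore set (in the sense of Mathlib, on the left).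
The resulting localization does not depend on the choice made here, up to unique isomorphism. -/
noncomputable instance IsOreDomain.oreSet (A : Type*) [Ring A] [IsOreDomain A] :
    OreLocalization.OreSet (nonZeroDivisors A) :=
  Classical.choice <| OreLocalization.nonempty_oreSet_iff_of_noZeroDivisors.2 fun r s => by
    obtain ⟨r', s', hs', h⟩ := IsOreDomain.left_ore r (s : A) (nonZeroDivisors.coe_ne_zero s)
    exact ⟨r', ⟨s', mem_nonZeroDivisors_of_ne_zero hs'⟩, h⟩

/-- The skew field of fractions `Frac A` of an Ore domain `A`: the Ore localization of `A` at
its nonzero elements. Mathlib provides its structure of a division ring and, if `A` is an algebra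
over a field `K`, that of a `K`-algebra. -/
abbrev SkewFrac (A : Type*) [Ring A] [IsOreDomain A] : Type _ :=
  OreLocalization (nonZeroDivisors A) A

namespace SkewFrac

variable {K A : Type*} [Field K] [Ring A] [Algebra K A] [IsOreDomain A]

/-- The canonical embedding `A → Frac A`. -/
noncomputable def coeHom (A : Type*) [Ring A] [IsOreDomain A] : A →+* SkewFrac A :=
  OreLocalization.numeratorRingHom

theorem coeHom_injective : Function.Injective (coeHom A) :=
  OreLocalization.numeratorHom_inj inf_le_left

theorem map_ne_zero (φ : A ≃ₐ[K] A) (s : nonZeroDivisors A) : coeHom A (φ s) ≠ 0 := by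
  rw [Ne, map_eq_zero_iff _ coeHom_injective, EmbeddingLike.map_eq_zero_iff]
  exact nonZeroDivisors.coe_ne_zero s

/-- The units of `Frac A` given by the images under an automorphism of nonzero elements of `A`. -/
noncomputable def mapUnits (φ : A ≃ₐ[K] A) : nonZeroDivisors A →* (SkewFrac A)ˣ where
  toFun s := Units.mk0 (coeHom A (φ s)) (map_ne_zero φ s)
  map_one' := by ext; simp
  map_mul' s t := by ext; simp

/-- The unique extension to `Frac A` of an automorphism `φ` of the `K`-algebra `A`,
`s⁻¹ a ↦ φ(s)⁻¹ φ(a)`. -/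
noncomputable def map (φ : A ≃ₐ[K] A) : SkewFrac A →ₐ[K] SkewFrac A where
  __ := OreLocalization.universalHom ((coeHom A).comp (φ : A →+* A)) (mapUnits φ) fun _ => rfl
  commutes' r :=
    (OreLocalization.universalHom_commutes _ (mapUnits φ) fun _ => rfl).trans
      (congrArg (coeHom A) (φ.commutes r))

theorem map_coeHom (φ : A ≃ₐ[K] A) (a : A) : map φ (coeHom A a) = coeHom A (φ a) :=
  OreLocalization.universalHom_commutes _ (mapUnits φ) fun _ => rfl

/-- The algebra `(Frac A)^G` of invariants, where the group `G` acts on `A` through `ρ` by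
`K`-algebra automorphisms and on `Frac A` by the extensions of these. -/
def invariants {G : Type*} [Group G] (ρ : G →* (A ≃ₐ[K] A)) : Subalgebra K (SkewFrac A) where
  carrier := {a | ∀ g : G, map (ρ g) a = a}
  mul_mem' ha hb g := by rw [map_mul, ha g, hb g]
  add_mem' ha hb g := by rw [map_add, ha g, hb g]
  algebraMap_mem' r g := (map (ρ g)).commutes r

end SkewFrac

/-! ### The quantum Weyl algebra and its tensor powers -/

/-- The two generators of the quantum Weyl algebra. -/
inductive QuantumWeylGen
  | x
  | y

/-- The defining relation `y x - q x y = 1`. -/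
inductive QuantumWeylRel (K : Type*) [Field K] (q : K) :
    FreeAlgebra K QuantumWeylGen → FreeAlgebra K QuantumWeylGen → Prop
  | yx : QuantumWeylRel K q
      (FreeAlgebra.ι K QuantumWeylGen.y * FreeAlgebra.ι K QuantumWeylGen.x -
        q • (FreeAlgebra.ι K QuantumWeylGen.x * FreeAlgebra.ι K QuantumWeylGen.y)) 1

/-- The quantum Weyl algebra `A_1^q(K) = K⟨x, y | y x - q x y = 1⟩`. -/
abbrev QuantumWeyl (K : Type*) [Field K] (q : K) : Type _ :=
  RingQuot (QuantumWeylRel K q)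

/-- The tensor power `A_1^q(K)^{⊗ n}` over `K`. -/
abbrev QuantumWeylPower (K : Type*) [Field K] (q : K) (n : ℕ) : Type _ :=
  ⨂[K] _ : Fin n, QuantumWeyl K q

/-- The permutation action of the symmetric group `S_n` on the `n`-th tensor power of a
`K`-algebra `A`: the `i`-th factor is moved to position `σ i`. -/
noncomputable def permTensorPower (K : Type*) [Field K] (A : Type*) [Ring A] [Algebra K A]
    (n : ℕ) : Equiv.Perm (Fin n) →* ((⨂[K] _ : Fin n, A) ≃ₐ[K] (⨂[K] _ : Fin n, A)) where
  toFun σ := AlgEquiv.ofLinearEquiv (PiTensorProduct.reindex K (fun _ => A) σ)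
    (by
      rw [PiTensorProduct.one_def]
      exact PiTensorProduct.reindex_tprod σ _)
    (by
      intro a b
      have h : (LinearMap.mul K (⨂[K] _ : Fin n, A)).compr₂
            (PiTensorProduct.reindex K (fun _ => A) σ).toLinearMap =
          (LinearMap.mul K (⨂[K] _ : Fin n, A)).compl₁₂
            (PiTensorProduct.reindex K (fun _ => A) σ).toLinearMap
            (PiTensorProduct.reindex K (fun _ => A) σ).toLinearMap := by
        ext u v
        simp [PiTensorProduct.tprod_mul_tprod, PiTensorProduct.reindex_tprod, Pi.mul_def]
      exact LinearMap.congr_fun₂ h a b)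
  map_one' := by
    ext a
    exact LinearEquiv.congr_fun (PiTensorProduct.reindex_refl (R := K) (s := fun _ : Fin n => A)) a
  map_mul' σ τ := by
    ext a
    exact (PiTensorProduct.reindex_reindex (R := K) (s := fun _ : Fin n => A) τ σ a).symm

theorem permTensorPower_tprod (K : Type*) [Field K] (A : Type*) [Ring A] [Algebra K A]
    (n : ℕ) (σ : Equiv.Perm (Fin n)) (a : Fin n → A) :
    permTensorPower K A n σ (PiTensorProduct.tprod K a) =
      PiTensorProduct.tprod K fun i => a (σ.symm i) :=
  PiTensorProduct.reindex_tprod (R := K) (s := fun _ : Fin n => A) σ a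

/-!
Let `D` be the skew field of fractions of the tensor power. It is generated by the elements
`h i = x i * y i` and `u i = y i`, which commute for distinct indices and satisfy
`u i * h i = (q h i + 1) u i`. The permutations act by permuting the indices, so the problem is to
find a second such family, of the same size, that generates the invariants.

The idea is to read the `h i`, `u i` as the separated variables of an open `q`-Toda chain. Let
`A = ∏ i, (z - h i)` and let `B` be the interpolation polynomial with left value `u i` at `h i`. The
coefficients of both are invariant, and `A`, `B` satisfy the exchange relations of two entries of a
monodromy matrix (`IsShiftSystem.isTodaPair`). A monodromy matrix is a product of one factor for
each site, and a site can be split off: from a pair `(A, B)` of degree `n` one obtains `p` and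
`Y ≠ 0` with `Y p = (q p + 1) Y` and a pair of degree `n - 1` whose coefficients commute with both
(`IsTodaPair.exists_next`). Iterating gives invariant elements `p i`, `Y i` that satisfy the
relations of the `h i`, `u i` (`IsTodaPair.exists_weylFamily`), and `x i ↦ p i * (Y i)⁻¹`,
`y i ↦ Y i` maps the tensor power to the invariants (`IsWeylFamily.quantumWeylHom`).

The map is injective for a reason of growth. The coefficients of `A` and `B` are `2 n` elements
whose ordered monomials are linearly independent (`linearIndependent_esymm_mul_coeff`), and they are
fractions of the `p i`, `Y i` whose denominators are normal elements (`exists_isNormalIn`). If the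
map had a kernel, the image would have too few elements of each degree to contain them
(`IsWeylFamily.quantumWeylHom_injective`). So the map extends to a homomorphism from `D`.

Its image `E` is the whole of the invariants. It contains the elementary symmetric polynomials in
the `h i`, over which the `h i` are integral, and the coefficients `B_k`, with
`u i = ∑ k, (h i) ^ k B_k`; hence the polynomials in the `h i` span `D` as a right vector space over
`E` (`exists_span_eq_top`). An invariant element is the average of its translates, and the average
of a polynomial in the `h i` is symmetric, so it lies in `E` (`mem_range_of_forall_eq`). This uses
that the characteristic is zero.

The Ore condition holds because the tensor power is a domain with a basis of monomials, and so has
polynomial growth (`isOreDomain_of_isMonomialBasis`).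
-/

open Polynomial

/-! ### Polynomials over a noncommutative algebra, evaluated at scalars -/

section Eval

variable {K D : Type*} [Field K] [Ring D] [Algebra K D]

/-- Evaluation of a polynomial with coefficients in a `K`-algebra `D` at a scalar `z : K`.
Scalars being central, this is a ring homomorphism. -/
noncomputable def evalScalar (D : Type*) [Ring D] [Algebra K D] (z : K) : D[X] →+* D :=
  eval₂RingHom' (RingHom.id D) (algebraMap K D z) fun a => (Algebra.commutes z a).symm

@[simp] theorem evalScalar_C (z : K) (r : D) : evalScalar D z (C r) = r :=
  eval₂_C (RingHom.id D) _

@[simp] theorem evalScalar_X (z : K) : evalScalar D z (X : D[X]) = algebraMap K D z :=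
  eval₂_X (RingHom.id D) _

theorem evalScalar_eq_sum (z : K) (f : D[X]) (N : ℕ) (hN : f.natDegree < N) :
    evalScalar D z f = ∑ k ∈ Finset.range N, z ^ k • f.coeff k := by
  have : evalScalar D z f = f.eval₂ (RingHom.id D) (algebraMap K D z) := rfl
  rw [this, eval₂_eq_sum_range' _ hN]
  refine Finset.sum_congr rfl fun k _ => ?_
  rw [Algebra.smul_def, map_pow, RingHom.id_apply]
  exact (Commute.pow_left (Algebra.commutes z _) k).symm

@[simp] theorem evalScalar_smul (z a : K) (f : D[X]) :
    evalScalar D z (a • f) = a • evalScalar D z f := by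
  have : a • f = C (algebraMap K D a) * f := by
    ext k; simp [Algebra.smul_def]
  rw [this, map_mul, evalScalar_C, Algebra.smul_def]

/-- A polynomial over a `K`-algebra is determined by its values at all but finitely many scalars. -/
theorem eq_of_evalScalar_of_eval_ne_zero [Infinite K] {f f' : D[X]} {c : K[X]} (hc : c ≠ 0)
    (h : ∀ z : K, c.eval z ≠ 0 → evalScalar D z f = evalScalar D z f') : f = f' := by
  rw [← sub_eq_zero]
  ext k
  rw [coeff_zero]
  refine (Module.forall_dual_apply_eq_zero_iff K _).1 fun l => ?_
  set r := f - f' with hr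
  let p : K[X] := ∑ j ∈ Finset.range (r.natDegree + 1), Polynomial.C (l (r.coeff j)) * X ^ j
  have hp : c * p = 0 := by
    refine Polynomial.funext fun z => ?_
    rw [eval_mul, eval_zero]
    by_cases hz : c.eval z = 0
    · rw [hz, zero_mul]
    have h0 : evalScalar D z r = 0 := by rw [hr, map_sub, h z hz, sub_self]
    rw [evalScalar_eq_sum z r _ (Nat.lt_succ_self _)] at h0
    have := congrArg l h0
    simp only [map_sum, map_smul, smul_eq_mul, map_zero] at this
    simp only [p, eval_finsetSum, eval_mul, eval_C, eval_pow, eval_X]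
    rw [show (∑ j ∈ Finset.range (r.natDegree + 1), l (r.coeff j) * z ^ j) = 0 by
      rw [← this]; exact Finset.sum_congr rfl fun _ _ => mul_comm _ _, mul_zero]
  have hp0 : p = 0 := (mul_eq_zero.1 hp).resolve_left hc
  by_cases hk : k ≤ r.natDegree
  · have := congrArg (fun f => Polynomial.coeff f k) hp0
    simpa [p, finsetSum_coeff, coeff_C_mul, coeff_X_pow, Finset.sum_ite_eq, Nat.lt_succ_iff, hk]
      using this
  · rw [coeff_eq_zero_of_natDegree_lt (not_le.1 hk), map_zero]

theorem eq_of_evalScalar [Infinite K] {f f' : D[X]}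
    (h : ∀ z : K, evalScalar D z f = evalScalar D z f') : f = f' :=
  eq_of_evalScalar_of_eval_ne_zero (c := 1) one_ne_zero fun z _ => h z

theorem commute_coeff_of_evalScalar [Infinite K] {f : D[X]} {r : D}
    (h : ∀ z : K, Commute r (evalScalar D z f)) (k : ℕ) : Commute r (f.coeff k) := by
  have : C r * f = f * C r := eq_of_evalScalar (K := K) fun z => by
    simpa using (h z).eq
  have := congrArg (fun f => Polynomial.coeff f k) this
  rwa [coeff_C_mul, coeff_mul_C] at this

theorem commute_evalScalar {f : D[X]} {r : D}
    (h : ∀ k, Commute r (f.coeff k)) (z : K) : Commute r (evalScalar D z f) := by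
  rw [evalScalar_eq_sum z f _ (Nat.lt_succ_self _)]
  exact Commute.sum_right _ _ _ fun k _ => (h k).smul_right _

theorem commute_coeff_coeff [Infinite K] {f f' : D[X]}
    (h : ∀ z w : K, Commute (evalScalar D z f) (evalScalar D w f')) (j k : ℕ) :
    Commute (f.coeff j) (f'.coeff k) :=
  commute_coeff_of_evalScalar (K := K) (fun w => (commute_coeff_of_evalScalar (K := K)
    (fun z => (h z w).symm) j).symm) k

end Eval

/-! ### Homogenized evaluation -/

section HomEval

variable {K D : Type*} [Field K] [Ring D] [Algebra K D] (q : K)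

/-- The value of a polynomial of degree less than `n`, homogenized to degree `n - 1`, at the
fixed point `(1 : 1 - q)` of the map `z ↦ q z + 1` of the projective line. For `q = 1` this point
is at infinity, and the value is the coefficient of degree `n - 1`. Coefficients of
degree `≥ n` are ignored. -/
noncomputable def homEval (n : ℕ) : D[X] →+ D where
  toFun f := ∑ j ∈ Finset.range n, (1 - q) ^ (n - 1 - j) • f.coeff j
  map_zero' := by simp
  map_add' f g := by simp [Finset.sum_add_distrib]

theorem homEval_apply (n : ℕ) (f : D[X]) :
    homEval q n f = ∑ j ∈ Finset.range n, (1 - q) ^ (n - 1 - j) • f.coeff j := rfl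

theorem homEval_smul (n : ℕ) (a : K) (f : D[X]) : homEval q n (a • f) = a • homEval q n f := by
  simp only [homEval_apply, coeff_smul, Finset.smul_sum, smul_smul, mul_comm]

theorem homEval_C_mul (n : ℕ) (r : D) (f : D[X]) : homEval q n (C r * f) = r * homEval q n f := by
  simp [homEval_apply, Finset.mul_sum]

theorem homEval_mul_C (n : ℕ) (r : D) (f : D[X]) : homEval q n (f * C r) = homEval q n f * r := by
  simp [homEval_apply, Finset.sum_mul]

theorem homEval_X_mul (n : ℕ) (f : D[X]) : homEval q (n + 1) (X * f) = homEval q n f := by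
  rw [homEval_apply, Finset.sum_range_succ', homEval_apply]
  simp only [coeff_X_mul, coeff_X_mul_zero, smul_zero, add_zero]
  refine Finset.sum_congr rfl fun j _ => ?_
  congr 2
  omega

theorem homEval_succ (n : ℕ) (f : D[X]) :
    homEval q (n + 1) f = (1 - q) • homEval q n f + f.coeff n := by
  rw [homEval_apply, Finset.sum_range_succ, homEval_apply, Finset.smul_sum]
  simp only [add_tsub_cancel_right, tsub_self, pow_zero, one_smul, add_left_inj]
  refine Finset.sum_congr rfl fun j hj => ?_
  rw [smul_smul, ← pow_succ']
  congr 2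
  have := Finset.mem_range.1 hj
  omega

theorem homEval_succ_of_degree_lt {n : ℕ} {f : D[X]} (hf : f.degree < n) :
    homEval q (n + 1) f = (1 - q) • homEval q n f := by
  rw [homEval_succ, coeff_eq_zero_of_degree_lt hf, add_zero]

theorem homEval_X_pow (n : ℕ) : homEval q (n + 1) (X ^ n : D[X]) = 1 := by
  rw [homEval_succ, homEval_apply, Finset.sum_eq_zero, smul_zero, zero_add, coeff_X_pow_self]
  intro j hj
  rw [coeff_X_pow, if_neg (Finset.mem_range.1 hj).ne, smul_zero]

theorem commute_homEval {r : D} {f : D[X]} (h : ∀ k, Commute r (f.coeff k)) (n : ℕ) :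
    Commute r (homEval q n f) := by
  rw [homEval_apply]
  exact Commute.sum_right _ _ _ fun k _ => (h k).smul_right _

/-- The central polynomial `z - (q z + 1)`, whose root is the fixed point of `z ↦ q z + 1`. -/
noncomputable def fixPoly : K[X] := (1 - q) • X - 1

theorem fixPoly_ne_zero : fixPoly q ≠ 0 := fun h => by
  simpa [fixPoly] using congrArg (Polynomial.eval 0) h

theorem eval_fixPoly (z : K) : (fixPoly q).eval z = (1 - q) * z - 1 := by
  simp [fixPoly]

@[simp] theorem evalScalar_map_fixPoly (z : K) :
    evalScalar D z ((fixPoly q).map (algebraMap K D)) = algebraMap K D ((1 - q) * z - 1) := by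
  simp [fixPoly, Polynomial.smul_eq_C_mul]

/-- A polynomial of degree at most `n` is divisible by `z - (q z + 1)` up to a multiple of `X ^ n`,
which is its homogenized value at the fixed point of `z ↦ q z + 1`. -/
theorem exists_eq_fixPoly_mul_add (n : ℕ) (f : D[X]) (hf : f.natDegree ≤ n) :
    ∃ f' : D[X], f'.degree < n ∧
      f = (fixPoly q).map (algebraMap K D) * f' + C (homEval q (n + 1) f) * X ^ n := by
  induction n generalizing f with
  | zero =>
    refine ⟨0, by simp, ?_⟩
    rw [eq_C_of_natDegree_le_zero hf]
    simp [homEval_apply]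
  | succ n ih =>
    -- Write `f = X * f.divX + C (f.coeff 0)` and `y = (1 - q) X`, so that `fixPoly q` becomes
    -- `y - 1`. The constant term is handled by the geometric sum
    -- `(y - 1) * ∑ y ^ i = y ^ (n + 1) - 1`.
    obtain ⟨f₁, hf₁, h₁⟩ := ih f.divX (by rw [natDegree_divX_eq_natDegree_tsub_one]; omega)
    set y : D[X] := ((1 - q) • X : K[X]).map (algebraMap K D) with hy
    have hyX : y = C (algebraMap K D (1 - q)) * X := by
      simp [hy, Polynomial.smul_eq_C_mul]
    have hypow : ∀ k, y ^ k = C (algebraMap K D ((1 - q) ^ k)) * X ^ k := fun k => by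
      rw [hyX, (commute_X _).symm.mul_pow, ← C_pow, ← map_pow]
    have hc : (fixPoly q).map (algebraMap K D) = y - 1 := by simp [fixPoly, hy]
    have hgeom := mul_geom_sum y (n + 1)
    have hcomm : ∀ r : D, C r * (y - 1) = (y - 1) * C r := fun r => by
      rw [mul_sub, sub_mul, mul_one, one_mul, hyX, ← mul_assoc, ← C_mul, ← Algebra.commutes,
        C_mul, mul_assoc, mul_assoc, ← X_mul_C]
    refine ⟨X * f₁ - C (f.coeff 0) * ∑ i ∈ Finset.range (n + 1), y ^ i, ?_, ?_⟩
    · refine (degree_sub_le _ _).trans_lt (max_lt ?_ ?_)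
      · rcases eq_or_ne f₁ 0 with rfl | h0
        · simp
        · refine (degree_mul_le _ _).trans_lt ?_
          rw [degree_eq_natDegree h0] at hf₁ ⊢
          have : f₁.natDegree < n := by exact_mod_cast hf₁
          refine (add_le_add_left degree_X_le _).trans_lt ?_
          exact_mod_cast (by omega : 1 + f₁.natDegree < n + 1)
      · rw [Finset.mul_sum]
        refine (degree_sum_le _ _).trans_lt ?_
        rw [Finset.sup_lt_iff (WithBot.bot_lt_coe _)]
        intro k hk
        rw [hypow, ← mul_assoc, ← C_mul]
        refine (degree_C_mul_X_pow_le _ _).trans_lt ?_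
        exact_mod_cast Finset.mem_range.1 hk
    · have hH : homEval q (n + 1 + 1) f =
          f.coeff 0 * algebraMap K D ((1 - q) ^ (n + 1)) + homEval q (n + 1) f.divX := by
        rw [homEval_apply, Finset.sum_range_succ', homEval_apply, add_comm]
        congr 1
        · rw [← Algebra.commutes, Algebra.smul_def]; simp
        · refine Finset.sum_congr rfl fun j _ => ?_
          rw [coeff_divX]
          congr 2
          omega
      rw [hc] at h₁ ⊢
      calc f = X * f.divX + C (f.coeff 0) := (X_mul_divX_add f).symm
        _ = X * ((y - 1) * f₁ + C (homEval q (n + 1) f.divX) * X ^ n) + C (f.coeff 0) := by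
          rw [← h₁]
        _ = _ := by
          rw [hH, mul_sub (y - 1), ← mul_assoc (y - 1) (C _), ← hcomm,
            mul_assoc (C _) (y - 1), hgeom, hypow, C_add, C_mul]
          have e1 : X * ((y - 1) * f₁) = (y - 1) * (X * f₁) := by
            rw [← mul_assoc, ← mul_assoc, X_mul]
          have e2 : ∀ r : D, X * (C r * X ^ n) = C r * X ^ (n + 1) := fun r => by
            rw [← mul_assoc, X_mul, mul_assoc, pow_succ']
          rw [mul_add, e1, e2]
          noncomm_ring

end HomEval

/-! ### Toda pairs -/

section Toda

variable {K D : Type*} [Field K] [DivisionRing D] [Algebra K D]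

/-- Polynomials `A`, monic of degree `n`, and `B`, of degree less than `n`, whose values at scalars
satisfy the `q`-deformed exchange relation between two entries in a column of the monodromy matrix
of an open Toda chain. The coefficients do not commute; the indeterminate is central. -/
structure IsExchangePair (q : K) (n : ℕ) (A B : D[X]) : Prop where
  monic : A.Monic
  natDegree_eq : A.natDegree = n
  degree_lt : B.degree < n
  exchange : ∀ z w : K,
    (z - w) • (evalScalar D w B * evalScalar D z A) =
      (z - (q * w + 1)) • (evalScalar D z A * evalScalar D w B) -
        (z - (q * z + 1)) • (evalScalar D w A * evalScalar D z B)

/-- An exchange pair in which the values of `A` commute among themselves, as do those of `B`, and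
which is nondegenerate: `A` and `B` are left coprime, and the homogenization of `A` does not vanish
at the fixed point of `z ↦ q z + 1`. -/
structure IsTodaPair (q : K) (n : ℕ) (A B : D[X]) : Prop extends IsExchangePair q n A B where
  commute_left : ∀ z w : K, Commute (evalScalar D z A) (evalScalar D w A)
  commute_right : ∀ z w : K, Commute (evalScalar D z B) (evalScalar D w B)
  bezout : ∃ U V : D[X], U * A + V * B = 1
  homEval_ne_zero : homEval q (n + 1) A ≠ 0

variable {q : K} {n : ℕ} {A B : D[X]}

/-- The factor `z - (q z + 1)` can be cancelled in an identity between values of polynomials,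
because it vanishes for at most one scalar `z`. -/
theorem eq_zero_of_fixPoly_smul [CharZero K] {f : D[X]}
    (h : ∀ z : K, ((1 - q) * z - 1) • evalScalar D z f = 0) :
    f = 0 :=
  eq_of_evalScalar_of_eval_ne_zero (fixPoly_ne_zero q) fun z hz => by
    rw [map_zero]
    exact (smul_eq_zero.1 (h z)).resolve_left (by rwa [eval_fixPoly] at hz)

namespace IsExchangePair

/-- With `p = -homEval q n A`, the value of `A` at the fixed point of `z ↦ q z + 1` is
`1 + (q - 1) p`. -/
theorem homEval_eq (h : IsExchangePair q n A B) :
    homEval q (n + 1) A = 1 + (q - 1) • -homEval q n A := by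
  rw [homEval_succ, ← h.natDegree_eq, coeff_natDegree, h.monic.leadingCoeff]
  module

variable [CharZero K]

/-- The exchange relation as an identity of polynomials in the argument of `A`. -/
theorem exchange_X_left (h : IsExchangePair q n A B) (w : K) :
    X * (C (evalScalar D w B) * A) - w • (C (evalScalar D w B) * A) =
      X * (A * C (evalScalar D w B)) - (q * w + 1) • (A * C (evalScalar D w B)) -
        ((1 - q) • (X * (C (evalScalar D w A) * B)) - C (evalScalar D w A) * B) :=
  eq_of_evalScalar (K := K) fun z => by
    simp only [map_sub, map_mul, evalScalar_X, evalScalar_C, evalScalar_smul, ← Algebra.smul_def]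
    linear_combination (norm := module) h.exchange z w

/-- The exchange relation as an identity of polynomials in the argument of `B`. -/
theorem exchange_X_right (h : IsExchangePair q n A B) (z : K) :
    z • (B * C (evalScalar D z A)) - X * (B * C (evalScalar D z A)) =
      (z - 1) • (C (evalScalar D z A) * B) - q • (X * (C (evalScalar D z A) * B)) -
        (z - (q * z + 1)) • (A * C (evalScalar D z B)) :=
  eq_of_evalScalar (K := K) fun w => by
    simp only [map_sub, map_mul, evalScalar_X, evalScalar_C, evalScalar_smul, ← Algebra.smul_def]
    linear_combination (norm := module) h.exchange z w

/-- Evaluating the exchange relation at the fixed point of `z ↦ q z + 1` shows that the values of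
`B` shift `p = -homEval q n A` to `q p + 1`. -/
theorem mul_homEval (h : IsExchangePair q n A B) (w : K) :
    evalScalar D w B * -homEval q n A =
      q • (-homEval q n A * evalScalar D w B) + evalScalar D w B := by
  have key : B * C (-homEval q n A) = q • (C (-homEval q n A) * B) + B := by
    rw [← sub_eq_zero]
    refine eq_zero_of_fixPoly_smul (q := q) fun w => ?_
    have := congrArg (homEval q (n + 1)) (h.exchange_X_left w)
    simp only [map_sub, homEval_X_mul, homEval_C_mul, homEval_mul_C, homEval_smul, h.homEval_eq,
      homEval_succ_of_degree_lt q h.degree_lt] at this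
    simp only [map_sub, map_add, map_mul, evalScalar_smul, evalScalar_C]
    generalize homEval q n A = p at *
    generalize homEval q n B = b at *
    generalize evalScalar D w B = Bw at *
    generalize evalScalar D w A = Aw at *
    simp only [mul_add, add_mul, mul_neg, neg_mul, mul_smul_comm, smul_mul_assoc, mul_one, one_mul,
      smul_neg] at this ⊢
    linear_combination (norm := module) this
  have := congrArg (evalScalar D w) key
  simpa only [map_add, map_mul, evalScalar_smul, evalScalar_C] using this

theorem coeff_mul_homEval (h : IsExchangePair q n A B) (k : ℕ) :
    B.coeff k * -homEval q n A = q • (-homEval q n A * B.coeff k) + B.coeff k := by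
  have : B * C (-homEval q n A) = q • (C (-homEval q n A) * B) + B :=
    eq_of_evalScalar (K := K) fun w => by
      simpa only [map_add, map_mul, evalScalar_smul, evalScalar_C] using h.mul_homEval w
  have := congrArg (fun f => Polynomial.coeff f k) this
  simpa only [coeff_mul_C, coeff_add, coeff_smul, coeff_C_mul] using this

end IsExchangePair

namespace IsTodaPair

theorem right_ne_zero (h : IsTodaPair q (n + 1) A B) : B ≠ 0 := by
  rintro rfl
  obtain ⟨U, V, hUV⟩ := h.bezout
  rw [mul_zero, add_zero] at hUV
  have hU : U ≠ 0 := by rintro rfl; simp at hUV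
  have := congrArg Polynomial.natDegree hUV
  rw [natDegree_mul hU h.monic.ne_zero, h.natDegree_eq] at this
  simp at this

variable [CharZero K]

theorem commute_coeff (h : IsTodaPair q n A B) (j k : ℕ) : Commute (A.coeff j) (A.coeff k) :=
  commute_coeff_coeff h.commute_left j k

theorem commute_coeff_right (h : IsTodaPair q n A B) (j k : ℕ) :
    Commute (B.coeff j) (B.coeff k) :=
  commute_coeff_coeff h.commute_right j k

/-- The leading coefficient in `w` of the exchange relation: commuting the top coefficient of `B`
past `A` yields `B` itself. -/
theorem coeff_mul_eval (h : IsTodaPair q (n + 1) A B) (z : K) :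
    B.coeff n * evalScalar D z A =
      q • (evalScalar D z A * B.coeff n) + ((1 - q) * z - 1) • evalScalar D z B := by
  have := congrArg (fun f => Polynomial.coeff f (n + 1)) (h.exchange_X_right z)
  simp only [coeff_sub, coeff_smul, coeff_X_mul, coeff_mul_C, coeff_C_mul,
    coeff_eq_zero_of_degree_lt h.degree_lt] at this
  have hA : A.coeff (n + 1) = 1 := by
    rw [← h.natDegree_eq, coeff_natDegree, h.monic.leadingCoeff]
  rw [hA] at this
  simp only [zero_mul, mul_zero, smul_zero, one_mul] at this
  linear_combination (norm := module) -this

theorem coeff_ne_zero (h : IsTodaPair q (n + 1) A B) : B.coeff n ≠ 0 := fun h0 =>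
  h.right_ne_zero <| eq_zero_of_fixPoly_smul (q := q) fun z => by
    simpa [h0, eq_comm] using h.coeff_mul_eval z

end IsTodaPair

end Toda

/-! ### Consequences of the exchange relation -/

section Exchange

variable {K D : Type*} [Field K] [DivisionRing D] [Algebra K D] {q : K}

/-- If `A`, `B` are exchanged and `B = P Y`, then `P` and `N = A - (z - p) P` satisfy an exchange
relation that no longer involves `Y`. The functions stand for the values of polynomials at
scalars. -/
theorem exchange_quotient {A P N : K → D} {p Y : D} (hY : Y ≠ 0)
    (hA : ∀ z, A z = N z + z • P z - p * P z) (hPP : ∀ z w, Commute (P z) (P w))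
    (hpP : ∀ z, Commute p (P z))
    (hYA : ∀ z, Y * A z = q • (A z * Y) + ((1 - q) * z - 1) • (P z * Y))
    (hex : ∀ z w, (z - w) • (P w * Y * A z) = (z - (q * w + 1)) • (A z * (P w * Y)) -
      (z - (q * z + 1)) • (A w * (P z * Y))) (z w : K) :
    (q * (z - w)) • (P w * N z) =
      (z - (q * w + 1)) • (N z * P w) - (z - (q * z + 1)) • (N w * P z) := by
  have h1 : (z - w) • (P w * (q • A z + ((1 - q) * z - 1) • P z)) =
      (z - (q * w + 1)) • (A z * P w) - (z - (q * z + 1)) • (A w * P z) := by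
    refine mul_right_cancel₀ hY ?_
    have := hex z w
    rw [mul_assoc, hYA] at this
    simp only [mul_add, add_mul, sub_mul, mul_smul_comm, smul_mul_assoc, mul_assoc] at this ⊢
    exact this
  rw [hA z, hA w] at h1
  have e1 : P w * (p * P z) = p * (P w * P z) := by
    rw [← mul_assoc, ← (hpP w).eq, mul_assoc]
  have e2 : P z * P w = P w * P z := hPP z w
  simp only [mul_add, add_mul, sub_mul, mul_sub, mul_smul_comm, smul_mul_assoc, mul_assoc, e1, e2,
    smul_add, smul_sub] at h1 ⊢
  linear_combination (norm := module) h1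

/-- The exchange relation solved for the product in the opposite order: the combination of the
relations for `(z, w)` and `(w, z)` in which a common factor `q (z - w)` can be cancelled. -/
theorem exchange_swap {P N : K → D} (hq : q ≠ 0)
    (hex : ∀ z w, (q * (z - w)) • (P w * N z) =
      (z - (q * w + 1)) • (N z * P w) - (z - (q * z + 1)) • (N w * P z)) (z w : K) :
    (z - w) • (N w * P z) = (z - (q * w + 1)) • (P z * N w) - (w - (q * w + 1)) • (P w * N z) := by
  rcases eq_or_ne z w with rfl | hzw
  · simp
  have h0 : q * (z - w) ≠ 0 := mul_ne_zero hq (sub_ne_zero.2 hzw)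
  refine smul_right_injective D h0 ?_
  have h1 := hex z w
  have h2 := hex w z
  simp only
  linear_combination (norm := module) (w - (q * w + 1)) • h1 + (z - (q * w + 1)) • h2

theorem exchange_sub_sub {P N : K → D} (hq : q ≠ 0)
    (hex : ∀ z w, (q * (z - w)) • (P w * N z) =
      (z - (q * w + 1)) • (N z * P w) - (z - (q * z + 1)) • (N w * P z)) (z w : K) :
    N z * P w - N w * P z = q • (P w * N z - P z * N w) := by
  rcases eq_or_ne z w with rfl | hzw
  · simp
  refine smul_right_injective D (sub_ne_zero.2 hzw) ?_
  have h1 := exchange_swap hq hex z w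
  have h2 := exchange_swap hq hex w z
  simp only
  linear_combination (norm := module) -h1 - h2

/-- The commutator of two values of `N = A - (z - p) P`, deduced from the commutativity of the
values of `A`. -/
theorem exchange_commutator {P N : K → D} (hq : q ≠ 0)
    (hex : ∀ z w, (q * (z - w)) • (P w * N z) =
      (z - (q * w + 1)) • (N z * P w) - (z - (q * z + 1)) • (N w * P z))
    {A : K → D} {p : D} (hA : ∀ z, A z = N z + z • P z - p * P z)
    (hPP : ∀ z w, Commute (P z) (P w)) (hpP : ∀ z, Commute p (P z)) (hpN : ∀ z, Commute p (N z))
    (hAA : ∀ z w, Commute (A z) (A w)) (z w : K) :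
    N z * N w - N w * N z = (1 + (q - 1) • p) * (P w * N z - P z * N w) := by
  rcases eq_or_ne z w with rfl | hzw
  · simp
  refine smul_right_injective D (sub_ne_zero.2 hzw) ?_
  have h1 := exchange_swap hq hex z w
  have h2 := exchange_swap hq hex w z
  have h3 := exchange_sub_sub hq hex z w
  have h4 := (hAA z w).eq
  rw [hA z, hA w] at h4
  have e1 : ∀ a, P z * (p * a) = p * (P z * a) := fun a => by
    rw [← mul_assoc, ← (hpP z).eq, mul_assoc]
  have e2 : ∀ a, P w * (p * a) = p * (P w * a) := fun a => by
    rw [← mul_assoc, ← (hpP w).eq, mul_assoc]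
  have e3 : ∀ a, N z * (p * a) = p * (N z * a) := fun a => by
    rw [← mul_assoc, ← (hpN z).eq, mul_assoc]
  have e4 : ∀ a, N w * (p * a) = p * (N w * a) := fun a => by
    rw [← mul_assoc, ← (hpN w).eq, mul_assoc]
  have e5 : P z * P w = P w * P z := hPP z w
  have h5 : p * (N z * P w) - p * (N w * P z) = q • (p * (P w * N z) - p * (P z * N w)) := by
    rw [← mul_sub, h3, mul_smul_comm, mul_sub]
  simp only [mul_add, add_mul, sub_mul, mul_sub, mul_smul_comm, smul_mul_assoc, mul_assoc, e1, e2,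
    e3, e4, e5, smul_add, smul_sub, one_mul] at h3 h4 h5 ⊢
  linear_combination (norm := module) (z - w) • h4 + (z - w) • h5 + z • h1 + w • h2

/-- Subtracting the multiple `s P` from `T`, with `s` chosen so that the difference vanishes at the
fixed point of `z ↦ q z + 1`, makes the values commute. -/
theorem commute_of_exchange {P T V : K → D} {p s : D} (hq : q ≠ 0)
    (hex : ∀ z w, (q * (z - w)) • (P w * T z) =
      (z - (q * w + 1)) • (T z * P w) - (z - (q * z + 1)) • (T w * P z))
    (hTT : ∀ z w, T z * T w - T w * T z = P w * T z - P z * T w)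
    (hPP : ∀ z w, Commute (P z) (P w)) (hpP : ∀ z, Commute p (P z))
    (hp : 1 + (q - 1) • p ≠ 0) (hs : s = p * (1 + (q - 1) • p)⁻¹)
    (hV : ∀ z, V z = T z - s * P z) (hVp : ∀ z, V z * p = q • (p * V z) + V z) (z w : K) :
    Commute (V z) (V w) := by
  set g := 1 + (q - 1) • p with hg
  have hgP : ∀ z, Commute g⁻¹ (P z) := fun z =>
    ((Commute.one_left _).add_left ((hpP z).smul_left _)).inv_left₀
  have hpg : Commute p g⁻¹ :=
    ((Commute.one_right _).add_right ((Commute.refl p).smul_right _)).inv_right₀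
  have hsP : ∀ z, Commute s (P z) := fun z => hs ▸ (hpP z).mul_left (hgP z)
  -- Conjugation by `g`, for which `g⁻¹ = 1 - (q - 1) s`, scales `V z`, while `V z * s - s * V z` is
  -- a multiple of `g⁻¹ * V z`. After `T = V + s P` is substituted, both hypotheses are rewritten
  -- with `s` and `g⁻¹` on the left, and the commutator of `V z` and `V w` is a combination of the
  -- two.
  have hVg : ∀ z, V z * g⁻¹ = q⁻¹ • (g⁻¹ * V z) := fun z => by
    have : V z * g = q • (g * V z) := by
      rw [hg, mul_add, mul_one, mul_smul_comm, hVp, add_mul, one_mul, smul_mul_assoc]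
      module
    have h2 : g⁻¹ * V z = q • (V z * g⁻¹) := by
      calc g⁻¹ * V z = g⁻¹ * (V z * g) * g⁻¹ := by
            rw [mul_assoc, mul_assoc, mul_inv_cancel₀ hp, mul_one]
        _ = _ := by
            rw [this, mul_smul_comm, ← mul_assoc, inv_mul_cancel₀ hp, one_mul, smul_mul_assoc]
    rw [h2, smul_smul, inv_mul_cancel₀ hq, one_smul]
  have hVs : ∀ z, V z * s = s * V z + q⁻¹ • (g⁻¹ * V z) := fun z => by
    rw [hs, ← mul_assoc, hVp, add_mul, smul_mul_assoc, mul_assoc, hVg, mul_smul_comm, smul_smul,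
      mul_inv_cancel₀ hq, one_smul, mul_assoc]
  have hgs : g⁻¹ = 1 - (q - 1) • s := by
    have : g⁻¹ = (g - (q - 1) • p) * g⁻¹ := by rw [hg]; simp
    rw [this, sub_mul, mul_inv_cancel₀ hp, hs, smul_mul_assoc]
  have hT : ∀ z, T z = V z + s * P z := fun z => by rw [hV, sub_add_cancel]
  have e1 := hTT z w
  have e2 := exchange_sub_sub hq hex z w
  rw [hT z, hT w] at e1 e2
  have f1 : ∀ z a, V z * (s * a) = s * (V z * a) + q⁻¹ • (g⁻¹ * (V z * a)) := fun z a => by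
    rw [← mul_assoc, hVs, add_mul, smul_mul_assoc, mul_assoc, mul_assoc]
  have f2 : ∀ z a, P z * (s * a) = s * (P z * a) := fun z a => by
    rw [← mul_assoc, ← (hsP z).eq, mul_assoc]
  have f3 : P z * P w = P w * P z := hPP z w
  simp only [mul_add, add_mul, mul_assoc, f2, f3] at e2
  have e3 : V z * P w - V w * P z = q • (P w * V z - P z * V w) := by
    linear_combination (norm := module) e2
  have e4 : q⁻¹ • (g⁻¹ * (V z * P w)) - q⁻¹ • (g⁻¹ * (V w * P z)) =
      g⁻¹ * (P w * V z) - g⁻¹ * (P z * V w) := by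
    rw [← smul_sub, ← mul_sub, e3, mul_smul_comm, smul_smul, inv_mul_cancel₀ hq, one_smul, mul_sub]
  have e5 : s * (V z * P w) - s * (V w * P z) = q • (s * (P w * V z) - s * (P z * V w)) := by
    rw [← mul_sub, e3, mul_smul_comm, mul_sub]
  simp only [mul_add, add_mul, mul_assoc, f1, f2, f3] at e1
  rw [hgs] at e1 e4
  simp only [sub_mul, one_mul, smul_mul_assoc] at e1 e4
  rw [Commute, SemiconjBy]
  linear_combination (norm := module) e1 - e4 - e5

end Exchange

/-! ### The recursion on Toda pairs -/

section Step

variable {K D : Type*} [Field K]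

theorem coeff_mem_of_fixPoly_mul_mem [Ring D] [Algebra K D] {q : K} (S : Submodule K D) {f : D[X]}
    (h : ∀ k, ((fixPoly q).map (algebraMap K D) * f).coeff k ∈ S) (k : ℕ) : f.coeff k ∈ S := by
  have hc : (fixPoly q).map (algebraMap K D) * f = (1 - q) • (X * f) - f := by
    simp only [fixPoly, Polynomial.map_sub, Polynomial.map_one, sub_mul, one_mul,
      Polynomial.smul_eq_C_mul, Polynomial.map_mul, map_C, map_X, mul_assoc]
    congr 1
    ext k
    rw [coeff_C_mul, coeff_smul, Algebra.smul_def]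
  rw [hc] at h
  induction k with
  | zero => simpa using h 0
  | succ k ih =>
    have := S.sub_mem (S.smul_mem (1 - q) ih) (h (k + 1))
    simpa using this

theorem C_mul_eq_mul_C [Ring D] {r : D} {f : D[X]} (h : ∀ k, Commute r (f.coeff k)) :
    C r * f = f * C r := by
  ext k
  rw [coeff_C_mul, coeff_mul_C, (h k).eq]

variable [DivisionRing D] [Algebra K D] [CharZero K] {q : K} {n : ℕ} {A B : D[X]}

namespace IsTodaPair

/-- One step down the chain. The pair `(A, B)` splits off the elements `p`, `Y` with
`Y p = (q p + 1) Y`, leaving a Toda pair `(A', B')` of smaller degree whose coefficients commute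
with `p` and `Y`. The element `s` is the value of `A' - X ^ n`, up to normalization, at the fixed
point of `z ↦ q z + 1`. -/
structure Next (q : K) (n : ℕ) (A B : D[X]) (p Y s : D) (A' B' : D[X]) : Prop where
  eq_p : p = -homEval q (n + 1) A
  eq_s : s = -homEval q n A' * (homEval q (n + 1) A')⁻¹
  pair : IsTodaPair q n A' B'
  ne_zero : Y ≠ 0
  mul_eq : Y * p = q • (p * Y) + Y
  left_eq : A = (X - C p) * A' +
    ((fixPoly q).map (algebraMap K D) * B' + C s * A') * C (1 + (q - 1) • p)
  right_eq : B = A' * C Y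
  commute_p_left : ∀ k, Commute p (A'.coeff k)
  commute_p_right : ∀ k, Commute p (B'.coeff k)
  commute_Y_left : ∀ k, Commute Y (A'.coeff k)
  commute_Y_right : ∀ k, Commute Y (B'.coeff k)

/-- The step exists: `Y` is the top coefficient of `B`, `A' = B Y⁻¹`, and `B'` is the quotient by
`z - (q z + 1)` of `V = (A - (z - p) A') g⁻¹ - s A'`, where `g = 1 + (q - 1) p`. -/
theorem exists_next (hq : q ≠ 0) (h : IsTodaPair q (n + 1) A B) :
    ∃ (p Y s : D) (A' B' : D[X]), Next q n A B p Y s A' B' := by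
  set c : D[X] := (fixPoly q).map (algebraMap K D) with hc
  set p := -homEval q (n + 1) A with hp
  set Y := B.coeff n with hYdef
  have hY : Y ≠ 0 := h.coeff_ne_zero
  set P := B * C Y⁻¹ with hP
  have hPk : ∀ k, P.coeff k = B.coeff k * Y⁻¹ := fun k => by rw [hP, coeff_mul_C]
  have hB : B = P * C Y := by
    rw [hP, mul_assoc, ← C_mul, inv_mul_cancel₀ hY, C_1, mul_one]
  have hYp : Y * p = q • (p * Y) + Y := h.coeff_mul_homEval n
  have hYB : ∀ k, Commute Y (B.coeff k) := fun k => h.commute_coeff_right n k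
  have hYP : ∀ k, Commute Y (P.coeff k) := fun k => by
    rw [hPk]; exact (hYB k).mul_right (Commute.refl Y).inv_right₀
  have hBle : B.natDegree ≤ n := Nat.lt_succ_iff.1 <|
    (natDegree_lt_iff_degree_lt h.right_ne_zero).2 h.degree_lt
  have hPle : P.natDegree ≤ n := (natDegree_mul_C_le _ _).trans hBle
  have hP1 : P.coeff n = 1 := by rw [hPk, mul_inv_cancel₀ hY]
  have hPmonic : P.Monic := monic_of_natDegree_le_of_coeff_eq_one n hPle hP1
  have hPdeg : P.natDegree = n :=
    le_antisymm hPle (le_natDegree_of_ne_zero (by rw [hP1]; exact one_ne_zero))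
  have hPP : ∀ j k, Commute (P.coeff j) (P.coeff k) := fun j k => by
    rw [hPk, hPk]
    exact ((h.commute_coeff_right j k).mul_right (hYB j).symm.inv_right₀).mul_left
      ((hYB k).inv_left₀.mul_right (Commute.refl _))
  have hpA : ∀ k, Commute p (A.coeff k) := fun k =>
    ((commute_homEval q (fun j => h.commute_coeff k j) _).symm).neg_left
  have hpP : ∀ k, Commute p (P.coeff k) := fun k => by
    have h1 := h.coeff_mul_homEval k
    rw [← hp] at h1
    have h2 : p = q • (Y⁻¹ * p * Y) + 1 := by
      have := congrArg (Y⁻¹ * ·) hYp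
      simpa [mul_add, mul_smul_comm, ← mul_assoc, inv_mul_cancel₀ hY] using this
    have h3 : p * Y⁻¹ = q • (Y⁻¹ * p) + Y⁻¹ := by
      have := congrArg (· * Y⁻¹) h2
      simpa [add_mul, smul_mul_assoc, mul_assoc, mul_inv_cancel₀ hY] using this
    rw [hPk, Commute, SemiconjBy]
    refine smul_right_injective D hq ?_
    have h4 : B.coeff k * (p * Y⁻¹) = q • (B.coeff k * (Y⁻¹ * p)) + B.coeff k * Y⁻¹ := by
      rw [h3, mul_add, mul_smul_comm]
    rw [← mul_assoc, h1, add_mul, smul_mul_assoc] at h4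
    simp only [← mul_assoc] at h4 ⊢
    linear_combination (norm := module) h4
  set g := 1 + (q - 1) • p with hg
  have hg0 : g ≠ 0 := by
    have := h.homEval_ne_zero
    rwa [h.homEval_eq, ← hp] at this
  have hgp : ∀ a, Commute p a → Commute g a := fun a ha =>
    (Commute.one_left a).add_left (ha.smul_left _)
  have hYg : Y * g = q • (g * Y) := by
    rw [hg, mul_add, mul_one, mul_smul_comm, hYp, add_mul, one_mul, smul_mul_assoc]
    module
  have hgY : Y * g⁻¹ = q⁻¹ • (g⁻¹ * Y) := by
    have h2 : g⁻¹ * Y = q • (Y * g⁻¹) := by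
      calc g⁻¹ * Y = g⁻¹ * (Y * g) * g⁻¹ := by
            rw [mul_assoc, mul_assoc, mul_inv_cancel₀ hg0, mul_one]
        _ = _ := by
            rw [hYg, mul_smul_comm, ← mul_assoc, inv_mul_cancel₀ hg0, one_mul, smul_mul_assoc]
    rw [h2, smul_smul, inv_mul_cancel₀ hq, one_smul]
  set p' := -homEval q n P with hp'
  have hg'eq : homEval q (n + 1) P = 1 + (q - 1) • p' := by
    rw [homEval_succ, hP1]
    module
  set g' := 1 + (q - 1) • p' with hg'
  -- If `g'` were zero, `B` would vanish at the fixed point, and the exchange relation evaluated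
  -- there would read `g B = 0`.
  have hg'0 : g' ≠ 0 := fun h0 => by
    have hβ : homEval q (n + 1) B = 0 := by rw [hB, homEval_mul_C, hg'eq, h0, zero_mul]
    have hCB : C g * B = 0 := eq_zero_of_fixPoly_smul (q := q) fun z => by
      have := congrArg (homEval q (n + 1 + 1)) (h.exchange_X_right z)
      simp only [map_sub, homEval_X_mul, homEval_C_mul, homEval_mul_C, homEval_smul,
        homEval_succ_of_degree_lt q h.degree_lt, hβ, h.homEval_eq, ← hp, ← hg, zero_mul, mul_zero,
        smul_zero, sub_zero, zero_sub] at this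
      rw [map_mul, evalScalar_C]
      linear_combination (norm := module) this
    rw [mul_eq_zero, C_eq_zero] at hCB
    exact hCB.elim hg0 h.right_ne_zero
  have hp'c : ∀ a, (∀ k, Commute a (P.coeff k)) → Commute a p' := fun a ha =>
    (commute_homEval q ha _).neg_right
  have hg'c : ∀ a, (∀ k, Commute a (P.coeff k)) → Commute a g' := fun a ha =>
    (Commute.one_right a).add_right ((hp'c a ha).smul_right _)
  set s := p' * g'⁻¹ with hs
  have hsc : ∀ a, (∀ k, Commute a (P.coeff k)) → Commute a s := fun a ha =>
    (hp'c a ha).mul_right (hg'c a ha).inv_right₀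
  set N := A - X * P + C p * P with hN
  set V := N * C g⁻¹ - C s * P with hV
  -- In terms of values at scalars, `A = N + (z - p) P`, `B = P Y` and `V = N g⁻¹ - s P`; the
  -- exchange relations for `P` and `N g⁻¹` follow.
  have hAN : ∀ z : K, evalScalar D z A =
      evalScalar D z N + z • evalScalar D z P - p * evalScalar D z P := fun z => by
    simp only [hN, map_sub, map_add, map_mul, evalScalar_X, evalScalar_C, ← Algebra.smul_def]
    module
  have hVz : ∀ z : K,
      evalScalar D z V = evalScalar D z N * g⁻¹ - s * evalScalar D z P := fun z => by
    simp only [hV, map_sub, map_mul, evalScalar_C]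
  have hBz : ∀ z : K, evalScalar D z B = evalScalar D z P * Y := fun z => by
    rw [hB, map_mul, evalScalar_C]
  have hPPz : ∀ z w : K, Commute (evalScalar D z P) (evalScalar D w P) := fun z w =>
    commute_evalScalar (fun k => (commute_evalScalar (fun j => hPP k j) z).symm) w
  have hpPz := commute_evalScalar (K := K) hpP
  have hpNk : ∀ k, Commute p (N.coeff k) := fun k => by
    rw [hN, coeff_add, coeff_sub, coeff_C_mul]
    refine ((hpA k).sub_right ?_).add_right ((Commute.refl p).mul_right (hpP k))
    cases k with
    | zero => simp
    | succ k => simpa using hpP k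
  have hpNz := commute_evalScalar (K := K) hpNk
  have hexN := exchange_quotient (q := q) hY hAN hPPz hpPz
    (fun z => by rw [h.coeff_mul_eval, hBz]) (fun z w => by rw [← hBz, ← hBz, h.exchange])
  have hexT : ∀ z w : K,
      (q * (z - w)) • (evalScalar D w P * (evalScalar D z N * g⁻¹)) =
        (z - (q * w + 1)) • (evalScalar D z N * g⁻¹ * evalScalar D w P) -
          (z - (q * z + 1)) • (evalScalar D w N * g⁻¹ * evalScalar D z P) := fun z w => by
    have := congrArg (· * g⁻¹) (hexN z w)
    simp only [sub_mul, smul_mul_assoc, mul_assoc] at this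
    rw [← ((hgp _ (hpPz w)).inv_left₀).eq, ← ((hgp _ (hpPz z)).inv_left₀).eq] at this
    simpa only [mul_assoc] using this
  have hTT : ∀ z w : K, evalScalar D z N * g⁻¹ * (evalScalar D w N * g⁻¹) -
      evalScalar D w N * g⁻¹ * (evalScalar D z N * g⁻¹) =
        evalScalar D w P * (evalScalar D z N * g⁻¹) -
          evalScalar D z P * (evalScalar D w N * g⁻¹) := fun z w => by
    have := exchange_commutator hq hexN hAN hPPz hpPz hpNz h.commute_left z w
    rw [← hg] at this
    have hgN := fun z => (hgp _ (hpNz z)).inv_left₀.eq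
    have hgP := fun z => (hgp _ (hpPz z)).inv_left₀.eq
    calc _ = g⁻¹ * (evalScalar D z N * evalScalar D w N -
            evalScalar D w N * evalScalar D z N) * g⁻¹ := by
          have := fun z w : K => show evalScalar D z N * g⁻¹ * (evalScalar D w N * g⁻¹) =
            g⁻¹ * (evalScalar D z N * evalScalar D w N) * g⁻¹ by
              rw [← hgN z]; simp only [mul_assoc]
          rw [this, this, mul_sub, sub_mul]
      _ = _ := by
          rw [this, ← mul_assoc, inv_mul_cancel₀ hg0, one_mul]; noncomm_ring
  -- `V` has degree at most `n` and vanishes at the fixed point, hence is divisible by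
  -- `z - (q z + 1)` with a quotient of degree less than `n`.
  have hVdeg : V.natDegree ≤ n := by
    refine natDegree_le_iff_coeff_eq_zero.2 fun k hk => ?_
    obtain ⟨k, rfl⟩ : ∃ j, k = j + 1 := ⟨k - 1, by omega⟩
    have hP0 : P.coeff (k + 1) = 0 := coeff_eq_zero_of_natDegree_lt (by omega)
    have hAP : A.coeff (k + 1) = P.coeff k := by
      rcases eq_or_ne k n with rfl | hkn
      · rw [hP1, ← h.natDegree_eq, coeff_natDegree, h.monic.leadingCoeff]
      · rw [coeff_eq_zero_of_natDegree_lt (by rw [h.natDegree_eq]; omega),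
          coeff_eq_zero_of_natDegree_lt (by omega)]
    simp [hV, hN, hP0, hAP]
  have hV0 : homEval q (n + 1) V = 0 := by
    simp only [hV, hN, map_sub, map_add, homEval_mul_C, homEval_C_mul, homEval_X_mul, hg'eq]
    rw [← neg_eq_iff_eq_neg.2 hp, ← neg_eq_iff_eq_neg.2 hp', hs, mul_assoc,
      inv_mul_cancel₀ hg'0, mul_one, sub_eq_zero,
      ← eq_mul_inv_iff_mul_eq₀ (inv_ne_zero hg0), inv_inv]
    have := (hp'c p hpP).eq
    simp only [hg, hg', mul_add, mul_one, mul_smul_comm, this]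
    module
  obtain ⟨B', hB'deg, hVB⟩ := exists_eq_fixPoly_mul_add q n V hVdeg
  rw [hV0, C_0, zero_mul, add_zero, ← hc] at hVB
  have hVB' : ∀ z : K, evalScalar D z V = ((1 - q) * z - 1) • evalScalar D z B' := fun z => by
    rw [hVB, map_mul, hc, evalScalar_map_fixPoly, Algebra.smul_def]
  have hpair : IsExchangePair q n P B' := by
    refine ⟨hPmonic, hPdeg, hB'deg, fun z w => ?_⟩
    have key : z • (B' * C (evalScalar D z P)) - X * (B' * C (evalScalar D z P)) -
      ((z - 1) • (C (evalScalar D z P) * B') - q • (X * (C (evalScalar D z P) * B')) -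
        (z - (q * z + 1)) • (P * C (evalScalar D z B'))) = 0 :=
      eq_zero_of_fixPoly_smul (q := q) fun w => by
        have h1 := exchange_swap hq hexT z w
        have h2 : (z - w) • (evalScalar D w V * evalScalar D z P) =
            (z - (q * w + 1)) • (evalScalar D z P * evalScalar D w V) -
              (w - (q * w + 1)) • (evalScalar D w P * evalScalar D z V) := by
          have f1 : evalScalar D z P * (s * evalScalar D w P) =
              s * (evalScalar D w P * evalScalar D z P) := by
            rw [← mul_assoc, (hsc _ fun k => (commute_evalScalar (fun j => hPP k j) z).symm).eq,
              mul_assoc, (hPPz z w).eq]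
          have f2 : evalScalar D w P * (s * evalScalar D z P) =
              s * (evalScalar D w P * evalScalar D z P) := by
            rw [← mul_assoc, (hsc _ fun k => (commute_evalScalar (fun j => hPP k j) w).symm).eq,
              mul_assoc]
          simp only [hVz, sub_mul, mul_sub, f1, f2, mul_assoc] at h1 ⊢
          linear_combination (norm := module) h1
        simp only [hVB'] at h2
        simp only [map_sub, map_mul, evalScalar_X, evalScalar_C, evalScalar_smul,
          ← Algebra.smul_def]
        simp only [smul_mul_assoc, mul_smul_comm] at h2
        linear_combination (norm := module) h2
    have := congrArg (evalScalar D w) key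
    simp only [map_sub, map_mul, evalScalar_X, evalScalar_C, evalScalar_smul,
      ← Algebra.smul_def, map_zero] at this
    linear_combination (norm := module) this
  have hVV := commute_of_exchange (V := fun z => evalScalar D z V) hq hexT hTT hPPz
    (fun z => (hp'c _ fun k => (commute_evalScalar (fun j => hPP k j) z).symm).symm) hg'0 hs hVz
    (fun z => by
      have := hpair.mul_homEval z
      rw [← hp'] at this
      simp only [hVB', smul_mul_assoc, mul_smul_comm, this]
      module)
  have hVB'' : ∀ r : D, (∀ z : K, Commute r (evalScalar D z V)) → ∀ k, Commute r (B'.coeff k) :=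
    fun r hr k => by
      have hr' := commute_coeff_of_evalScalar hr
      have := coeff_mem_of_fixPoly_mul_mem (q := q)
        (Subalgebra.toSubmodule (Subalgebra.centralizer K {r})) (f := B')
        (by rw [← hc, ← hVB]; intro k; simpa [Subalgebra.mem_centralizer_iff] using (hr' k).eq) k
      exact (Subalgebra.mem_centralizer_iff K).1 this r rfl
  have hcr : ∀ r : D, (∀ k, Commute r (P.coeff k)) → (∀ z : K, Commute r (evalScalar D z N * g⁻¹)) →
      ∀ k, Commute r (B'.coeff k) := fun r hrP hrN => hVB'' r fun z => by
    rw [hVz]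
    exact (hrN z).sub_right ((hsc r hrP).mul_right (commute_evalScalar hrP z))
  have hpB' : ∀ k, Commute p (B'.coeff k) :=
    hcr p hpP fun z => (hpNz z).mul_right (hgp p (Commute.refl p)).symm.inv_right₀
  have hA : A = (X - C p) * P + (c * B' + C s * P) * C g := by
    rw [← hVB, hV, sub_add_cancel, mul_assoc N, ← C_mul, inv_mul_cancel₀ hg0, C_1, mul_one, hN]
    noncomm_ring
  refine ⟨p, Y, s, P, B', rfl, by rw [hg'eq], ⟨hpair, hPPz, fun z w => ?_, ?_, by rwa [hg'eq]⟩,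
    hY, hYp, hA, hB, hpP, hpB', hYP, ?_⟩
  · exact commute_evalScalar
      (hVB'' _ fun z => (commute_evalScalar (hVB'' _ fun w => hVV z w) _).symm) w
  -- `A` and `B` are left combinations of `A'` and `B'`, so coprimality is inherited.
  · obtain ⟨U, W, hUW⟩ := h.bezout
    refine ⟨U * (X - C p + C s * C g) + W * C Y, U * (c * C g), ?_⟩
    have e1 : C g * P = P * C g := C_mul_eq_mul_C fun k => hgp _ (hpP k)
    have e2 : C g * B' = B' * C g := C_mul_eq_mul_C fun k => hgp _ (hpB' k)
    have e3 : C Y * P = P * C Y := C_mul_eq_mul_C hYP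
    rw [← hUW, hA, hB, add_mul, mul_assoc W, e3, mul_assoc U, mul_assoc U, mul_assoc c, e2, add_mul,
      mul_assoc (C s), e1]
    noncomm_ring
  · refine hcr Y hYP fun z => ?_
    have h1 : Y * evalScalar D z N = q • (evalScalar D z N * Y) := by
      have h2 : evalScalar D z N =
          evalScalar D z A - z • evalScalar D z P + p * evalScalar D z P := by
        rw [hAN]; abel
      have h3 : Y * (p * evalScalar D z P) = q • (p * (evalScalar D z P * Y)) +
          evalScalar D z P * Y := by
        rw [← mul_assoc, hYp, add_mul, smul_mul_assoc, mul_assoc,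
          (commute_evalScalar hYP z).eq]
      rw [h2, mul_add, mul_sub, h.coeff_mul_eval, hBz, h3, mul_smul_comm,
        (commute_evalScalar hYP z).eq, add_mul, sub_mul (evalScalar D z A), smul_mul_assoc,
        mul_assoc p, ← hYdef]
      module
    rw [Commute, SemiconjBy, ← mul_assoc, h1, smul_mul_assoc, mul_assoc, hgY, mul_smul_comm,
      smul_smul,
      mul_inv_cancel₀ hq, one_smul, mul_assoc]

end IsTodaPair

end Step

/-! ### Weyl coordinates from a Toda pair -/

section Coordinates

variable {K D : Type*} [Field K]

/-- The polynomials all of whose coefficients lie in a given subalgebra. -/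
def coeffSubring [Ring D] [Algebra K D] (S : Subalgebra K D) : Subring D[X] where
  carrier := {f | ∀ k, f.coeff k ∈ S}
  mul_mem' ha hb k := by
    rw [coeff_mul]
    exact S.sum_mem fun x _ => S.mul_mem (ha _) (hb _)
  one_mem' k := by
    rw [coeff_one]
    split_ifs
    exacts [S.one_mem, S.zero_mem]
  add_mem' ha hb k := by rw [coeff_add]; exact S.add_mem (ha k) (hb k)
  zero_mem' k := by rw [coeff_zero]; exact S.zero_mem
  neg_mem' ha k := by rw [coeff_neg]; exact S.neg_mem (ha k)

theorem C_mem_coeffSubring [Ring D] [Algebra K D] {S : Subalgebra K D} {r : D} (hr : r ∈ S) :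
    C r ∈ coeffSubring S := fun k => by
  rw [coeff_C]
  split_ifs
  exacts [hr, S.zero_mem]

theorem X_mem_coeffSubring [Ring D] [Algebra K D] (S : Subalgebra K D) :
    (X : D[X]) ∈ coeffSubring S := fun k => by
  rw [coeff_X]
  split_ifs
  exacts [S.one_mem, S.zero_mem]

theorem map_mem_coeffSubring [Ring D] [Algebra K D] (S : Subalgebra K D) (f : K[X]) :
    f.map (algebraMap K D) ∈ coeffSubring S := fun k => by
  rw [coeff_map]
  exact S.algebraMap_mem _

theorem homEval_mem [Ring D] [Algebra K D] {S : Subalgebra K D} {f : D[X]}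
    (hf : f ∈ coeffSubring S) (q : K) (n : ℕ) : homEval q n f ∈ S := by
  rw [homEval_apply]
  exact S.sum_mem fun k _ => S.smul_mem (hf k) _

variable [DivisionRing D] [Algebra K D]

/-- Elements `p i`, `Y i` of a skew field with `Y i * p i = (q p i + 1) * Y i`, all other pairs
commuting. Then `x i = p i (Y i)⁻¹` and `y i = Y i` satisfy `y i * x i - q x i * y i = 1`. The
factor `1 + (q - 1) p i`, which `Y i` multiplies by `q`, is required not to vanish. -/
structure IsWeylFamily {ι : Type*} (q : K) (p Y : ι → D) : Prop where
  ne_zero : ∀ i, Y i ≠ 0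
  one_add_ne_zero : ∀ i, 1 + (q - 1) • p i ≠ 0
  mul_eq : ∀ i, Y i * p i = q • (p i * Y i) + Y i
  commute_left : ∀ i j, Commute (p i) (p j)
  commute_right : ∀ i j, Commute (Y i) (Y j)
  commute : ∀ i j, i ≠ j → Commute (p i) (Y j)

/-- The algebra generated by a Weyl family and the inverses of `Y i` and `1 + (q - 1) p i`. -/
def weylAdjoin {ι : Type*} (q : K) (p Y : ι → D) : Subalgebra K D :=
  Algebra.adjoin K (⋃ i, {p i, Y i, (Y i)⁻¹, (1 + (q - 1) • p i)⁻¹})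

section
variable {ι : Type*} (q : K) (p Y : ι → D) (i : ι)

theorem left_mem_weylAdjoin : p i ∈ weylAdjoin q p Y :=
  Algebra.subset_adjoin (Set.mem_iUnion.2 ⟨i, by simp⟩)

theorem right_mem_weylAdjoin : Y i ∈ weylAdjoin q p Y :=
  Algebra.subset_adjoin (Set.mem_iUnion.2 ⟨i, by simp⟩)

theorem inv_mem_weylAdjoin : (1 + (q - 1) • p i)⁻¹ ∈ weylAdjoin q p Y :=
  Algebra.subset_adjoin (Set.mem_iUnion.2 ⟨i, by simp⟩)

theorem weylAdjoin_le_cons {n : ℕ} (p' Y' : Fin n → D) (a b : D) :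
    weylAdjoin q p' Y' ≤ weylAdjoin (ι := Fin (n + 1)) q (Fin.cons a p') (Fin.cons b Y') :=
  Algebra.adjoin_mono <| Set.iUnion_subset fun i =>
    Set.subset_iUnion_of_subset i.succ (by simp)

end

variable {q : K} {n : ℕ} {A B : D[X]}

namespace IsTodaPair

/-- The data of the step are rational in the coefficients of the pair. -/
theorem Next.mem {p Y s : D} {A' B' : D[X]} (h : Next q n A B p Y s A' B')
    (h0 : 1 + (q - 1) • p ≠ 0) {S : Subalgebra K D}
    (hS : ∀ a ∈ S, a⁻¹ ∈ S) (hA : A ∈ coeffSubring S) (hB : B ∈ coeffSubring S) :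
    p ∈ S ∧ Y ∈ S ∧ A' ∈ coeffSubring S ∧ B' ∈ coeffSubring S := by
  have hp : p ∈ S := h.eq_p ▸ S.neg_mem (homEval_mem hA q _)
  have hA'1 : A'.coeff n = 1 := by
    rw [← h.pair.natDegree_eq, coeff_natDegree, h.pair.monic.leadingCoeff]
  have hY : Y ∈ S := by
    have := hB n
    rwa [h.right_eq, coeff_mul_C, hA'1, one_mul] at this
  have hA' : A' ∈ coeffSubring S := by
    have : A' = B * C Y⁻¹ := by
      rw [h.right_eq, mul_assoc, ← C_mul, mul_inv_cancel₀ h.ne_zero, C_1, mul_one]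
    rw [this]
    exact mul_mem hB (C_mem_coeffSubring (hS _ hY))
  have hs : s ∈ S := by
    rw [h.eq_s]
    exact S.mul_mem (S.neg_mem (homEval_mem hA' q _)) (hS _ (homEval_mem hA' q _))
  have hg : 1 + (q - 1) • p ∈ S := S.add_mem S.one_mem (S.smul_mem hp _)
  refine ⟨hp, hY, hA', fun k => coeff_mem_of_fixPoly_mul_mem (q := q) S.toSubmodule ?_ k⟩
  have : (fixPoly q).map (algebraMap K D) * B' =
      (A - (X - C p) * A') * C (1 + (q - 1) • p)⁻¹ - C s * A' := by
    rw [h.left_eq, add_sub_cancel_left, mul_assoc, ← C_mul, mul_inv_cancel₀ h0, C_1, mul_one,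
      add_sub_cancel_right]
  rw [this]
  exact sub_mem (mul_mem (sub_mem hA (mul_mem (sub_mem (X_mem_coeffSubring S)
    (C_mem_coeffSubring hp)) hA')) (C_mem_coeffSubring (hS _ hg)))
    (mul_mem (C_mem_coeffSubring hs) hA')

/-- A Toda pair yields a Weyl family that is rational in its coefficients; conversely the
coefficients are polynomial in the Weyl family and the inverses of the elements `Y i` and
`1 + (q - 1) p i`. -/
theorem exists_weylFamily [CharZero K] (hq : q ≠ 0) (h : IsTodaPair q n A B) :
    ∃ p Y : Fin n → D, IsWeylFamily q p Y ∧
      (∀ S : Subalgebra K D, (∀ a ∈ S, a⁻¹ ∈ S) → A ∈ coeffSubring S → B ∈ coeffSubring S →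
        ∀ i, p i ∈ S ∧ Y i ∈ S) ∧
      A ∈ coeffSubring (weylAdjoin q p Y) ∧ B ∈ coeffSubring (weylAdjoin q p Y) ∧
      (homEval q (n + 1) A)⁻¹ ∈ weylAdjoin q p Y := by
  induction n generalizing A B with
  | zero =>
    have hA : A = 1 := eq_one_of_monic_natDegree_zero h.monic h.natDegree_eq
    have hB : B = 0 := by simpa using h.degree_lt
    refine ⟨Fin.elim0, Fin.elim0, ⟨fun i => i.elim0, fun i => i.elim0, fun i => i.elim0,
      fun i => i.elim0, fun i => i.elim0, fun i => i.elim0⟩, fun S _ _ _ i => i.elim0, ?_, ?_, ?_⟩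
    · rw [hA]; exact one_mem _
    · rw [hB]; exact zero_mem _
    · rw [hA, ← pow_zero X, homEval_X_pow, inv_one]; exact one_mem _
  | succ n ih =>
    obtain ⟨a, b, s, A', B', hN⟩ := h.exists_next hq
    have hgA : homEval q (n + 1 + 1) A = 1 + (q - 1) • a := by rw [h.homEval_eq, ← hN.eq_p]
    have hg0 : 1 + (q - 1) • a ≠ 0 := hgA ▸ h.homEval_ne_zero
    obtain ⟨p, Y, hW, hmem, hA', hB', hinv⟩ := ih hN.pair
    -- The family of the smaller pair is rational in its coefficients, so it commutes with whatever
    -- commutes with these.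
    have hcent : ∀ r : D, (∀ k, Commute r (A'.coeff k)) → (∀ k, Commute r (B'.coeff k)) →
        ∀ i, Commute r (p i) ∧ Commute r (Y i) := fun r hrA hrB i => by
      have := hmem (Subalgebra.centralizer K {r})
        (fun x hx => (Subalgebra.mem_centralizer_iff K).2 fun y hy => by
          obtain rfl : y = r := hy
          exact (Commute.inv_right₀ ((Subalgebra.mem_centralizer_iff K).1 hx y rfl)).eq)
        (fun k => (Subalgebra.mem_centralizer_iff K).2 fun y hy => by
          obtain rfl : y = r := hy
          exact (hrA k).eq)
        (fun k => (Subalgebra.mem_centralizer_iff K).2 fun y hy => by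
          obtain rfl : y = r := hy
          exact (hrB k).eq) i
      exact ⟨(Subalgebra.mem_centralizer_iff K).1 this.1 r rfl,
        (Subalgebra.mem_centralizer_iff K).1 this.2 r rfl⟩
    have ha := hcent a hN.commute_p_left hN.commute_p_right
    have hb := hcent b hN.commute_Y_left hN.commute_Y_right
    have hle := weylAdjoin_le_cons q p Y a b
    set W := weylAdjoin (ι := Fin (n + 1)) q (Fin.cons a p) (Fin.cons b Y) with hWdef
    have haW : a ∈ W := left_mem_weylAdjoin (ι := Fin (n + 1)) q (Fin.cons a p) (Fin.cons b Y) 0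
    have hbW : b ∈ W := right_mem_weylAdjoin (ι := Fin (n + 1)) q (Fin.cons a p) (Fin.cons b Y) 0
    have hgW : (1 + (q - 1) • a)⁻¹ ∈ W :=
      inv_mem_weylAdjoin (ι := Fin (n + 1)) q (Fin.cons a p) (Fin.cons b Y) 0
    have hA'W : A' ∈ coeffSubring W := fun k => hle (hA' k)
    have hB'W : B' ∈ coeffSubring W := fun k => hle (hB' k)
    have hsW : s ∈ W := by
      rw [hN.eq_s]
      exact W.mul_mem (W.neg_mem (homEval_mem hA'W q _)) (hle hinv)
    refine ⟨Fin.cons a p, Fin.cons b Y, ⟨?_, ?_, ?_, ?_, ?_, ?_⟩, ?_, ?_, ?_, ?_⟩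
    · exact Fin.cases hN.ne_zero hW.ne_zero
    · exact Fin.cases hg0 hW.one_add_ne_zero
    · exact Fin.cases hN.mul_eq hW.mul_eq
    · exact Fin.cases (Fin.cases (Commute.refl a) fun j => (ha j).1)
        fun i => Fin.cases (ha i).1.symm (hW.commute_left i)
    · exact Fin.cases (Fin.cases (Commute.refl b) fun j => (hb j).2)
        fun i => Fin.cases (hb i).2.symm (hW.commute_right i)
    · exact Fin.cases (Fin.cases (fun h => (h rfl).elim) fun j _ => (ha j).2)
        fun i => Fin.cases (fun _ => (hb i).1.symm) fun j hij =>
          hW.commute i j fun h => hij (congrArg Fin.succ h)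
    · intro S hS hA hB
      obtain ⟨h1, h2, h3, h4⟩ := hN.mem hg0 hS hA hB
      exact Fin.cases ⟨h1, h2⟩ (hmem S hS h3 h4)
    · rw [hN.left_eq]
      exact add_mem (mul_mem (sub_mem (X_mem_coeffSubring _) (C_mem_coeffSubring haW)) hA'W)
        (mul_mem (add_mem (mul_mem (map_mem_coeffSubring _ _) hB'W)
          (mul_mem (C_mem_coeffSubring hsW) hA'W))
          (C_mem_coeffSubring (W.add_mem W.one_mem (W.smul_mem haW _))))
    · rw [hN.right_eq]
      exact mul_mem hA'W (C_mem_coeffSubring hbW)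
    · rw [hgA]
      exact hgW

end IsTodaPair

end Coordinates

/-! ### Leading exponents with respect to a basis -/

section Leading

open Module

variable {K R I Γ : Type*} [Field K] [Ring R] [Algebra K R]

theorem repr_mul_apply (b : Basis I K R) (f g : R) (k : I) :
    b.repr (f * g) k =
      ∑ i ∈ (b.repr f).support, ∑ j ∈ (b.repr g).support,
        b.repr f i * b.repr g j * b.repr (b i * b j) k := by
  conv_lhs => rw [← b.linearCombination_repr f, ← b.linearCombination_repr g]
  simp [Finsupp.linearCombination_apply, Finsupp.sum, Finset.sum_mul_sum, Finsupp.finsetSum_apply,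
    mul_assoc, mul_left_comm]

variable [AddCommMonoid I]

/-- A basis indexed by exponents in which products behave as for monomials: the product of the basis
elements at `i` and `j` involves `i + j`, and otherwise only smaller exponents. -/
structure IsMonomialBasis [PartialOrder I] (b : Basis I K R) : Prop where
  le_of_ne_zero : ∀ i j k, b.repr (b i * b j) k ≠ 0 → k ≤ i + j
  repr_add_ne_zero : ∀ i j, b.repr (b i * b j) (i + j) ≠ 0

variable [AddCommMonoid Γ] [LinearOrder Γ]

/-- `m` is the leading exponent of `f` with respect to the weight `w`. -/
structure IsLeading (b : Basis I K R) (w : I →+ Γ) (f : R) (m : I) : Prop where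
  ne_zero : b.repr f m ≠ 0
  le : ∀ k, b.repr f k ≠ 0 → w k ≤ w m

variable {b : Basis I K R} {w : I →+ Γ}

theorem exists_isLeading (w : I →+ Γ) {f : R} (hf : f ≠ 0) : ∃ m, IsLeading b w f m := by
  have h : (b.repr f).support.Nonempty := by
    rw [Finsupp.support_nonempty_iff]
    simpa using hf
  obtain ⟨m, hm, hle⟩ := Finset.exists_max_image _ w h
  exact ⟨m, Finsupp.mem_support_iff.1 hm, fun k hk => hle k (Finsupp.mem_support_iff.2 hk)⟩

theorem IsLeading.ne_zero' {f : R} {m : I} (h : IsLeading b w f m) : f ≠ 0 := by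
  rintro rfl
  simpa using h.ne_zero

theorem isLeading_basis (w : I →+ Γ) (m : I) : IsLeading b w (b m) m where
  ne_zero := by simp
  le k hk := by
    classical
    rw [Basis.repr_self, Finsupp.single_apply] at hk
    split_ifs at hk with h
    · rw [h]
    · exact (hk rfl).elim

theorem linearIndependent_of_isLeading (hinj : Function.Injective w) {ι : Type*} {v : ι → R}
    {e : ι → I} (he : Function.Injective e) (hv : ∀ i, IsLeading b w (v i) (e i)) :
    LinearIndependent K v := by
  classical
  rw [linearIndependent_iff']
  intro s c hc
  by_contra! hne
  obtain ⟨i₀, hi₀, hci₀⟩ := hne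
  obtain ⟨i, hi, hmax⟩ := Finset.exists_max_image (s.filter fun i => c i ≠ 0) (fun i => w (e i))
    ⟨i₀, Finset.mem_filter.2 ⟨hi₀, hci₀⟩⟩
  rw [Finset.mem_filter] at hi
  have := congrArg (fun f => b.repr f (e i)) hc
  simp only [map_sum, map_smul, Finsupp.finsetSum_apply, Finsupp.smul_apply, smul_eq_mul,
    map_zero, Finsupp.zero_apply] at this
  rw [Finset.sum_eq_single i] at this
  · exact (mul_ne_zero hi.2 (hv i).ne_zero) this
  · intro j hj hji
    by_contra h
    have h1 := hmax j (Finset.mem_filter.2 ⟨hj, left_ne_zero_of_mul h⟩)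
    have h2 := (hv j).le _ (right_ne_zero_of_mul h)
    exact hji (he (hinj (le_antisymm h1 h2)))
  · intro h
    exact (h hi.1).elim

variable [PartialOrder I]

theorem exists_of_repr_mul_ne_zero (hb : IsMonomialBasis b) {f g : R} {k : I}
    (h : b.repr (f * g) k ≠ 0) :
    ∃ i j, b.repr f i ≠ 0 ∧ b.repr g j ≠ 0 ∧ k ≤ i + j := by
  rw [repr_mul_apply] at h
  obtain ⟨i, hi, h⟩ := Finset.exists_ne_zero_of_sum_ne_zero h
  obtain ⟨j, hj, h⟩ := Finset.exists_ne_zero_of_sum_ne_zero h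
  exact ⟨i, j, Finsupp.mem_support_iff.1 hi, Finsupp.mem_support_iff.1 hj,
    hb.le_of_ne_zero i j k (right_ne_zero_of_mul h)⟩

variable [IsOrderedCancelAddMonoid Γ]

theorem IsLeading.mul (hb : IsMonomialBasis b) (hw : Monotone w) (hinj : Function.Injective w)
    {f g : R} {i j : I} (hf : IsLeading b w f i) (hg : IsLeading b w g j) :
    IsLeading b w (f * g) (i + j) where
  ne_zero := by
    rw [repr_mul_apply, Finset.sum_eq_single i, Finset.sum_eq_single j]
    · exact mul_ne_zero (mul_ne_zero hf.ne_zero hg.ne_zero) (hb.repr_add_ne_zero i j)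
    · intro j' hj' hne
      by_contra h
      have h1 := hw (hb.le_of_ne_zero _ _ _ (right_ne_zero_of_mul h))
      rw [map_add, map_add] at h1
      exact hne (hinj (le_antisymm (hg.le j' (Finsupp.mem_support_iff.1 hj'))
        (le_of_add_le_add_left h1)))
    · intro h
      exact (hg.ne_zero (Finsupp.notMem_support_iff.1 h)).elim
    · intro i' hi' hne
      refine Finset.sum_eq_zero fun j' hj' => ?_
      by_contra h
      have h1 := hw (hb.le_of_ne_zero _ _ _ (right_ne_zero_of_mul h))
      rw [map_add, map_add] at h1
      have hi := hf.le i' (Finsupp.mem_support_iff.1 hi')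
      have hj := hg.le j' (Finsupp.mem_support_iff.1 hj')
      refine hne (hinj (le_antisymm hi ?_))
      by_contra h2
      exact absurd (add_lt_add_of_lt_of_le (not_le.1 h2) hj) (not_lt.2 h1)
    · intro h
      exact (hf.ne_zero (Finsupp.notMem_support_iff.1 h)).elim
  le k hk := by
    obtain ⟨i', j', hi', hj', hle⟩ := exists_of_repr_mul_ne_zero hb hk
    refine (hw hle).trans ?_
    rw [map_add, map_add]
    exact add_le_add (hf.le i' hi') (hg.le j' hj')

theorem noZeroDivisors_of_isMonomialBasis (hb : IsMonomialBasis b) (hw : Monotone w)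
    (hinj : Function.Injective w) : NoZeroDivisors R where
  eq_zero_or_eq_zero_of_mul_eq_zero {f g} h := by
    by_contra hfg
    rw [not_or] at hfg
    obtain ⟨i, hi⟩ := exists_isLeading (b := b) w hfg.1
    obtain ⟨j, hj⟩ := exists_isLeading (b := b) w hfg.2
    exact (hi.mul hb hw hinj hj).ne_zero' h

end Leading

/-! ### The monomial basis of the quantum Weyl algebra -/

namespace QuantumWeyl

open Module

variable (K : Type*) [Field K] (q : K)

/-- The generator `x` of the quantum Weyl algebra. -/
noncomputable def genX : QuantumWeyl K q :=
  RingQuot.mkAlgHom K _ (FreeAlgebra.ι K QuantumWeylGen.x)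

/-- The generator `y` of the quantum Weyl algebra. -/
noncomputable def genY : QuantumWeyl K q :=
  RingQuot.mkAlgHom K _ (FreeAlgebra.ι K QuantumWeylGen.y)

theorem genY_mul_genX : genY K q * genX K q = q • (genX K q * genY K q) + 1 := by
  have := RingQuot.mkAlgHom_rel K (QuantumWeylRel.yx (K := K) (q := q))
  simp only [map_sub, map_mul, map_smul, map_one] at this
  exact (sub_eq_iff_eq_add'.1 this)

variable {K q}

/-- The homomorphism from the quantum Weyl algebra given by a pair of elements satisfying its
relation. -/
noncomputable def lift {R : Type*} [Ring R] [Algebra K R] (a b : R) (h : b * a = q • (a * b) + 1) :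
    QuantumWeyl K q →ₐ[K] R :=
  RingQuot.liftAlgHom K ⟨FreeAlgebra.lift K fun | .x => a | .y => b, by
    rintro _ _ ⟨⟩
    simp [h]⟩

section
variable {R : Type*} [Ring R] [Algebra K R] (a b : R) (h : b * a = q • (a * b) + 1)

@[simp] theorem lift_genX : lift a b h (genX K q) = a := by
  rw [lift, genX, RingQuot.liftAlgHom_mkAlgHom_apply, FreeAlgebra.lift_ι_apply]

@[simp] theorem lift_genY : lift a b h (genY K q) = b := by
  rw [lift, genY, RingQuot.liftAlgHom_mkAlgHom_apply, FreeAlgebra.lift_ι_apply]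

end

theorem algHom_ext {R : Type*} [Ring R] [Algebra K R] {f g : QuantumWeyl K q →ₐ[K] R}
    (hx : f (genX K q) = g (genX K q)) (hy : f (genY K q) = g (genY K q)) : f = g := by
  refine RingQuot.ringQuot_ext' _ _ _ (FreeAlgebra.hom_ext (funext fun i => ?_))
  cases i
  exacts [hx, hy]

theorem genY_mul_genX_pow (a : ℕ) : genY K q * genX K q ^ a =
    q ^ a • (genX K q ^ a * genY K q) + (∑ i ∈ Finset.range a, q ^ i) • genX K q ^ (a - 1) := by
  induction a with
  | zero => simp
  | succ a ih =>
    have h1 : (∑ i ∈ Finset.range a, q ^ i) • (genX K q ^ (a - 1) * genX K q) =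
        (∑ i ∈ Finset.range a, q ^ i) • genX K q ^ a := by
      cases a with
      | zero => simp
      | succ a => simp [pow_succ]
    rw [pow_succ, ← mul_assoc, ih, add_mul, smul_mul_assoc, smul_mul_assoc, h1, mul_assoc,
      genY_mul_genX, Finset.sum_range_succ, mul_add, mul_smul_comm, mul_one, ← mul_assoc, pow_succ,
      add_tsub_cancel_right]
    module

variable (K q)

/-- The operator of left multiplication by `x` in the monomial basis. -/
noncomputable def opX : (ℕ × ℕ →₀ K) →ₗ[K] (ℕ × ℕ →₀ K) :=
  Finsupp.lmapDomain K K fun m => (m.1 + 1, m.2)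

/-- The operator of left multiplication by `y` in the monomial basis. -/
noncomputable def opY : (ℕ × ℕ →₀ K) →ₗ[K] (ℕ × ℕ →₀ K) :=
  Finsupp.linearCombination K fun m : ℕ × ℕ => q ^ m.1 • Finsupp.single (m.1, m.2 + 1) (1 : K) +
    (∑ i ∈ Finset.range m.1, q ^ i) • Finsupp.single (m.1 - 1, m.2) (1 : K)

theorem opX_single (m : ℕ × ℕ) (c : K) :
    opX K (Finsupp.single m c) = Finsupp.single (m.1 + 1, m.2) c := by
  simp [opX, Finsupp.mapDomain_single]

theorem opY_single (m : ℕ × ℕ) : opY K q (Finsupp.single m 1) =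
    q ^ m.1 • Finsupp.single (m.1, m.2 + 1) (1 : K) +
      (∑ i ∈ Finset.range m.1, q ^ i) • Finsupp.single (m.1 - 1, m.2) (1 : K) := by
  simp [opY]

theorem opY_mul_opX : (opY K q * opX K : Module.End K (ℕ × ℕ →₀ K)) =
    q • (opX K * opY K q) + 1 := by
  refine Finsupp.lhom_ext' fun m => LinearMap.ext_ring ?_
  obtain ⟨a, b⟩ := m
  simp only [LinearMap.comp_apply, Finsupp.lsingle_apply, Module.End.mul_apply, LinearMap.add_apply,
    LinearMap.smul_apply, Module.End.one_apply, opX_single, opY_single, map_add, map_smul]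
  have h1 : (∑ i ∈ Finset.range a, q ^ i) • Finsupp.single (a - 1 + 1, b) (1 : K) =
      (∑ i ∈ Finset.range a, q ^ i) • Finsupp.single (a, b) (1 : K) := by
    cases a with
    | zero => simp
    | succ a => simp
  rw [h1, add_tsub_cancel_right, Finset.range_eq_Ico, Finset.sum_eq_sum_Ico_succ_bot (by omega)]
  simp only [pow_zero, smul_add, smul_smul, ← pow_succ', add_smul, one_smul]
  have h2 : ∑ i ∈ Finset.Ico (0 + 1) (a + 1), q ^ i = q * ∑ i ∈ Finset.range a, q ^ i := by
    rw [Finset.mul_sum, Finset.range_eq_Ico, ← Finset.sum_Ico_add' _ 0 a 1]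
    exact Finset.sum_congr rfl fun i _ => pow_succ' q i
  rw [h2]
  abel

/-- The monomials are independent because the operators that they induce on the space with basis
`ℕ × ℕ` send the basis element at `(0, 0)` to distinct basis elements. -/
theorem linearIndependent_monomial :
    LinearIndependent K fun m : ℕ × ℕ => genX K q ^ m.1 * genY K q ^ m.2 := by
  let ρ : QuantumWeyl K q →ₐ[K] Module.End K (ℕ × ℕ →₀ K) :=
    lift (opX K) (opY K q) (opY_mul_opX K q)
  let ev : QuantumWeyl K q →ₗ[K] (ℕ × ℕ →₀ K) :=
    (LinearMap.applyₗ (Finsupp.single (0, 0) (1 : K))).comp ρ.toLinearMap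
  refine LinearIndependent.of_comp ev ?_
  have hY : ∀ k, (opY K q ^ k) (Finsupp.single (0, 0) (1 : K)) = Finsupp.single (0, k) 1 := by
    intro k
    induction k with
    | zero => simp
    | succ k ih => rw [pow_succ', Module.End.mul_apply, ih, opY_single]; simp
  have hX : ∀ j k, (opX K ^ j) (Finsupp.single (0, k) (1 : K)) = Finsupp.single (j, k) 1 := by
    intro j k
    induction j with
    | zero => simp
    | succ j ih => rw [pow_succ', Module.End.mul_apply, ih, opX_single]
  have : ev ∘ (fun m : ℕ × ℕ => genX K q ^ m.1 * genY K q ^ m.2) =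
      fun m => Finsupp.single m (1 : K) := by
    funext m
    simp only [ev, ρ, Function.comp_apply, LinearMap.comp_apply, AlgHom.toLinearMap_apply, map_mul,
      map_pow, lift_genX, lift_genY, LinearMap.applyₗ_apply_apply, Module.End.mul_apply, hY, hX]
  rw [this]
  exact (Finsupp.basisSingleOne (R := K) (ι := ℕ × ℕ)).linearIndependent

theorem adjoin_gen : Algebra.adjoin K {genX K q, genY K q} = ⊤ := by
  have h1 := FreeAlgebra.adjoin_range_ι K QuantumWeylGen
  have h2 := congrArg (Subalgebra.map (RingQuot.mkAlgHom K (QuantumWeylRel K q))) h1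
  rw [AlgHom.map_adjoin, Algebra.map_top,
    (AlgHom.range_eq_top _).2 (RingQuot.mkAlgHom_surjective K _)] at h2
  rw [← h2]
  congr 1
  ext z
  constructor
  · rintro (rfl | rfl)
    exacts [⟨_, ⟨.x, rfl⟩, rfl⟩, ⟨_, ⟨.y, rfl⟩, rfl⟩]
  · rintro ⟨_, ⟨i, rfl⟩, rfl⟩
    cases i
    exacts [Or.inl rfl, Or.inr rfl]

theorem span_monomial :
    ⊤ ≤ Submodule.span K (Set.range fun m : ℕ × ℕ => genX K q ^ m.1 * genY K q ^ m.2) := by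
  set S := Submodule.span K (Set.range fun m : ℕ × ℕ => genX K q ^ m.1 * genY K q ^ m.2) with hS
  have hmem : ∀ a b, genX K q ^ a * genY K q ^ b ∈ S := fun a b =>
    Submodule.subset_span ⟨(a, b), rfl⟩
  have key : ∀ r ∈ Algebra.adjoin K {genX K q, genY K q}, ∀ s ∈ S, r * s ∈ S := by
    intro r hr
    induction hr using Algebra.adjoin_induction with
    | mem r hr =>
      intro s hs
      induction hs using Submodule.span_induction with
      | mem s hs =>
        obtain ⟨⟨a, b⟩, rfl⟩ := hs
        rcases hr with rfl | rfl
        · simp only [← mul_assoc, ← pow_succ']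
          exact hmem _ _
        · simp only [← mul_assoc, genY_mul_genX_pow, add_mul, smul_mul_assoc]
          rw [mul_assoc, ← pow_succ']
          exact S.add_mem (S.smul_mem _ (hmem _ _)) (S.smul_mem _ (hmem _ _))
      | zero => simp
      | add s t _ _ hs ht => rw [mul_add]; exact S.add_mem hs ht
      | smul c s _ hs => rw [mul_smul_comm]; exact S.smul_mem _ hs
    | algebraMap c => intro s hs; rw [← Algebra.smul_def]; exact S.smul_mem _ hs
    | add r r' _ _ h h' => intro s hs; rw [add_mul]; exact S.add_mem (h s hs) (h' s hs)
    | mul r r' _ _ h h' => intro s hs; rw [mul_assoc]; exact h _ (h' s hs)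
  intro r _
  have := key r (by rw [adjoin_gen]; trivial) 1 (by simpa using hmem 0 0)
  rwa [mul_one] at this

/-- The basis of the quantum Weyl algebra formed by the monomials `x ^ a * y ^ b`. -/
noncomputable def monomialBasis : Basis (ℕ × ℕ) K (QuantumWeyl K q) :=
  Basis.mk (linearIndependent_monomial K q) (span_monomial K q)

theorem monomialBasis_apply (m : ℕ × ℕ) :
    monomialBasis K q m = genX K q ^ m.1 * genY K q ^ m.2 := by
  simp [monomialBasis]

variable {K q}

theorem monomial_mem_span_Iio {c b i j : ℕ} (hi : i ≤ c) (hj : j ≤ b) (h : i < c ∨ j < b) :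
    genX K q ^ i * genY K q ^ j ∈ Submodule.span K (monomialBasis K q '' Set.Iio (c, b)) :=
  Submodule.subset_span ⟨(i, j), Prod.lt_iff.2 (h.imp (fun h => ⟨h, hj⟩) fun h => ⟨hi, h⟩),
    monomialBasis_apply K q _⟩

/-- Commuting a power of `y` past a power of `x` changes the monomial by a power of `q` and by
terms with smaller exponents. -/
theorem genY_pow_mul_genX_pow (b c : ℕ) :
    ∃ r ∈ Submodule.span K (monomialBasis K q '' Set.Iio (c, b)),
      genY K q ^ b * genX K q ^ c = q ^ (b * c) • (genX K q ^ c * genY K q ^ b) + r := by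
  induction b with
  | zero => exact ⟨0, zero_mem _, by simp⟩
  | succ b ih =>
    obtain ⟨r, hr, h⟩ := ih
    set S := Submodule.span K (monomialBasis K q '' Set.Iio (c, b + 1)) with hS
    have hyx : ∀ i j, genY K q * (genX K q ^ i * genY K q ^ j) =
        q ^ i • (genX K q ^ i * genY K q ^ (j + 1)) +
          (∑ k ∈ Finset.range i, q ^ k) • (genX K q ^ (i - 1) * genY K q ^ j) := fun i j => by
      rw [← mul_assoc, genY_mul_genX_pow, add_mul, smul_mul_assoc, smul_mul_assoc, mul_assoc,
        ← pow_succ']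
    have hyr : genY K q * r ∈ S := by
      clear h
      induction hr using Submodule.span_induction with
      | mem s hs =>
        obtain ⟨⟨i, j⟩, hij, rfl⟩ := hs
        have hij' := Prod.lt_iff.1 hij
        simp only at hij'
        rw [monomialBasis_apply, hyx]
        exact S.add_mem (S.smul_mem _ (monomial_mem_span_Iio (by omega) (by omega) (by omega)))
          (S.smul_mem _ (monomial_mem_span_Iio (by omega) (by omega) (by omega)))
      | zero => simp
      | add s t _ _ hs ht => rw [mul_add]; exact S.add_mem hs ht
      | smul a s _ hs => rw [mul_smul_comm]; exact S.smul_mem _ hs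
    refine ⟨q ^ (b * c) • (∑ k ∈ Finset.range c, q ^ k) • (genX K q ^ (c - 1) * genY K q ^ b) +
      genY K q * r, S.add_mem (S.smul_mem _ (S.smul_mem _
        (monomial_mem_span_Iio (by omega) (by omega) (by omega)))) hyr, ?_⟩
    rw [pow_succ' (genY K q), mul_assoc, h, mul_add, mul_smul_comm, hyx, smul_add, smul_smul,
      ← pow_add, add_assoc, Nat.succ_mul, pow_succ']

theorem isMonomialBasis (hq : q ≠ 0) : IsMonomialBasis (monomialBasis K q) := by
  have key : ∀ m m' : ℕ × ℕ, ∃ r ∈ Submodule.span K (monomialBasis K q '' Set.Iio (m + m')),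
      monomialBasis K q m * monomialBasis K q m' =
        q ^ (m.2 * m'.1) • monomialBasis K q (m + m') + r := by
    rintro ⟨a, b⟩ ⟨c, d⟩
    obtain ⟨r, hr, h⟩ := genY_pow_mul_genX_pow (K := K) (q := q) b c
    refine ⟨genX K q ^ a * r * genY K q ^ d, ?_, ?_⟩
    · set S := Submodule.span K (monomialBasis K q '' Set.Iio ((a, b) + (c, d))) with hS
      clear h
      induction hr using Submodule.span_induction with
      | mem s hs =>
        obtain ⟨⟨i, j⟩, hij, rfl⟩ := hs
        have hij' := Prod.lt_iff.1 hij
        simp only at hij'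
        rw [monomialBasis_apply, ← mul_assoc, mul_assoc, ← pow_add, ← pow_add]
        exact monomial_mem_span_Iio (by omega) (by omega) (by omega)
      | zero => simp
      | add s t _ _ hs ht => rw [mul_add, add_mul]; exact S.add_mem hs ht
      | smul a s _ hs => rw [mul_smul_comm, smul_mul_assoc]; exact S.smul_mem _ hs
    · simp only [monomialBasis_apply, Prod.fst_add, Prod.snd_add, pow_add]
      rw [mul_assoc, ← mul_assoc (genY K q ^ b), h]
      simp only [add_mul, mul_add, smul_mul_assoc, mul_smul_comm, mul_assoc]
  have hr0 : ∀ {m r}, r ∈ Submodule.span K (monomialBasis K q '' Set.Iio m) →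
      ∀ k, (monomialBasis K q).repr r k ≠ 0 → k < m := fun hr k hk =>
    (monomialBasis K q).mem_span_image.1 hr (Finsupp.mem_support_iff.2 hk)
  constructor
  · intro m m' k hk
    obtain ⟨r, hr, h⟩ := key m m'
    by_contra hle
    have h1 : (monomialBasis K q).repr r k = 0 := by
      by_contra h1
      exact hle (hr0 hr k h1).le
    rw [h, map_add, map_smul, Module.Basis.repr_self, Finsupp.add_apply, h1, Finsupp.smul_apply,
      Finsupp.single_eq_of_ne fun h => hle h.le] at hk
    simp at hk
  · intro m m'
    obtain ⟨r, hr, h⟩ := key m m'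
    have h1 : (monomialBasis K q).repr r (m + m') = 0 := by
      by_contra h1
      exact lt_irrefl _ (hr0 hr _ h1)
    rw [h, map_add (monomialBasis K q).repr, map_smul, Module.Basis.repr_self,
      Finsupp.add_apply, h1, Finsupp.smul_apply, Finsupp.single_eq_same]
    simpa using fun h => (hq h).elim

end QuantumWeyl

/-! ### Growth and the Ore condition -/

section Growth

open Module

variable {K R : Type*} [Field K] [Ring R] [Algebra K R] {n : ℕ}

/-- The span of the monomials in which all exponents are at most `N`. -/
def boxSpan (b : Basis (Fin n → ℕ × ℕ) K R) (N : ℕ) : Submodule K R :=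
  Submodule.span K (b '' Set.Iic fun _ => (N, N))

theorem mem_boxSpan {b : Basis (Fin n → ℕ × ℕ) K R} {N : ℕ} {f : R} :
    f ∈ boxSpan b N ↔ ∀ m, b.repr f m ≠ 0 → m ≤ fun _ => (N, N) := by
  rw [boxSpan, b.mem_span_image]
  exact ⟨fun h m hm => h (Finsupp.mem_support_iff.2 hm),
    fun h m hm => h m (Finsupp.mem_support_iff.1 hm)⟩

theorem boxSpan_mono (b : Basis (Fin n → ℕ × ℕ) K R) : Monotone (boxSpan b) := fun _ _ h =>
  Submodule.span_mono (Set.image_mono (Set.Iic_subset_Iic.2 fun _ => ⟨h, h⟩))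

theorem mul_mem_boxSpan {b : Basis (Fin n → ℕ × ℕ) K R} (hb : IsMonomialBasis b) {M N : ℕ} {f g : R}
    (hf : f ∈ boxSpan b M) (hg : g ∈ boxSpan b N) : f * g ∈ boxSpan b (M + N) :=
  mem_boxSpan.2 fun m hm => by
    obtain ⟨i, j, hi, hj, hle⟩ := exists_of_repr_mul_ne_zero hb hm
    exact hle.trans (add_le_add (mem_boxSpan.1 hf i hi) (mem_boxSpan.1 hg j hj))

theorem exists_mem_boxSpan (b : Basis (Fin n → ℕ × ℕ) K R) (f : R) : ∃ N, f ∈ boxSpan b N := by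
  refine ⟨∑ m ∈ (b.repr f).support, ∑ i, ((m i).1 + (m i).2), mem_boxSpan.2 fun m hm i => ?_⟩
  have h1 : (m i).1 + (m i).2 ≤ ∑ m ∈ (b.repr f).support, ∑ i, ((m i).1 + (m i).2) :=
    (Finset.single_le_sum (f := fun i => (m i).1 + (m i).2) (fun _ _ => Nat.zero_le _)
      (Finset.mem_univ i)).trans
      (Finset.single_le_sum (f := fun m => ∑ i, ((m i).1 + (m i).2)) (fun _ _ => Nat.zero_le _)
        (Finsupp.mem_support_iff.2 hm))
  exact ⟨by simp only; omega, by simp only; omega⟩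

theorem card_Iic_box (N : ℕ) :
    (Finset.Iic fun _ : Fin n => ((N, N) : ℕ × ℕ)).card = (N + 1) ^ (2 * n) := by
  rw [Pi.card_Iic]
  simp only [Finset.prod_const, Finset.card_univ, Fintype.card_fin]
  rw [show (Finset.Iic ((N, N) : ℕ × ℕ)) = Finset.Iic N ×ˢ Finset.Iic N from rfl,
    Finset.card_product, Nat.card_Iic, pow_mul, sq]

instance finiteDimensional_boxSpan (b : Basis (Fin n → ℕ × ℕ) K R) (N : ℕ) :
    FiniteDimensional K (boxSpan b N) :=
  FiniteDimensional.span_of_finite K ((Set.finite_Iic _).image _)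

theorem finrank_boxSpan (b : Basis (Fin n → ℕ × ℕ) K R) (N : ℕ) :
    finrank K (boxSpan b N) = (N + 1) ^ (2 * n) := by
  classical
  have h : boxSpan b N = Submodule.span K
      (Set.range fun m : (Finset.Iic fun _ : Fin n => ((N, N) : ℕ × ℕ)) => b m) := by
    rw [boxSpan]
    congr 1
    ext z
    simp
  rw [h, ← card_Iic_box N, ← Fintype.card_coe]
  exact finrank_span_eq_card (b.linearIndependent.comp _ Subtype.val_injective)

theorem add_pow_succ_le (T d m : ℕ) :
    (T + d) ^ (m + 1) ≤ T ^ (m + 1) + (m + 1) * d * (T + d) ^ m := by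
  induction m with
  | zero => simp
  | succ m ih =>
    calc (T + d) ^ (m + 1 + 1) = T * (T + d) ^ (m + 1) + d * (T + d) ^ (m + 1) := by ring
      _ ≤ T * (T ^ (m + 1) + (m + 1) * d * (T + d) ^ m) + d * (T + d) ^ (m + 1) := by gcongr
      _ = T ^ (m + 1 + 1) + (m + 1) * d * (T * (T + d) ^ m) + d * (T + d) ^ (m + 1) := by ring
      _ ≤ T ^ (m + 1 + 1) + (m + 1) * d * ((T + d) * (T + d) ^ m) + d * (T + d) ^ (m + 1) := by
        gcongr; omega
      _ = _ := by ring

/-- Shifting the argument changes a power by less than any fixed multiple of the same power. -/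
theorem exists_add_pow_lt_pow_add_pow (m s d : ℕ) :
    ∃ N : ℕ, (s * N + d + 1) ^ m < (N + 1) ^ m + (s * N + 1) ^ m := by
  cases m with
  | zero => exact ⟨0, by simp⟩
  | succ m =>
    set N := (m + 1) * d * (s + d + 1) ^ m with hN
    refine ⟨N, ?_⟩
    have h1 := add_pow_succ_le (s * N + 1) d m
    have h2 : s * N + 1 + d ≤ (s + d + 1) * (N + 1) := by nlinarith [Nat.zero_le (d * N)]
    have h3 : (m + 1) * d * (s * N + 1 + d) ^ m ≤ N * (N + 1) ^ m := by
      calc (m + 1) * d * (s * N + 1 + d) ^ m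
          ≤ (m + 1) * d * ((s + d + 1) * (N + 1)) ^ m := by gcongr
        _ = N * (N + 1) ^ m := by rw [mul_pow, hN]; ring
    have h4 : N * (N + 1) ^ m < (N + 1) ^ (m + 1) := by
      rw [pow_succ']
      exact Nat.mul_lt_mul_of_pos_right (Nat.lt_succ_self N) (by positivity)
    rw [show s * N + d + 1 = s * N + 1 + d by ring]
    omega

variable [IsDomain R] {b : Basis (Fin n → ℕ × ℕ) K R}

/-- A domain with a monomial basis has polynomial growth, so the images of a large box under two
injective maps of bounded degree meet nontrivially. Applied to the multiplications by two elements,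
this gives the Ore conditions. -/
theorem isOreDomain_of_isMonomialBasis (hb : IsMonomialBasis b) : IsOreDomain R := by
  have key : ∀ (l r : R →ₗ[K] R) (d : ℕ), Function.Injective l → Function.Injective r →
      (∀ N f, f ∈ boxSpan b N → l f ∈ boxSpan b (N + d)) →
      (∀ N f, f ∈ boxSpan b N → r f ∈ boxSpan b (N + d)) →
      ∃ f g, l f = r g ∧ f ≠ 0 := by
    intro l r d hl hr hld hrd
    obtain ⟨N, hN⟩ := exists_add_pow_lt_pow_add_pow (2 * n) 1 d
    rw [one_mul] at hN
    have h1 : (boxSpan b N).map l ≤ boxSpan b (N + d) := by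
      rintro _ ⟨f, hf, rfl⟩; exact hld N f hf
    have h2 : (boxSpan b N).map r ≤ boxSpan b (N + d) := by
      rintro _ ⟨f, hf, rfl⟩; exact hrd N f hf
    have h3 := Submodule.finrank_sup_add_finrank_inf_eq ((boxSpan b N).map l) ((boxSpan b N).map r)
    have h4 := Submodule.finrank_mono (sup_le h1 h2)
    rw [← (Submodule.equivMapOfInjective l hl _).finrank_eq,
      ← (Submodule.equivMapOfInjective r hr _).finrank_eq, finrank_boxSpan] at h3
    rw [finrank_boxSpan] at h4
    have h5 : 0 < finrank K ((boxSpan b N).map l ⊓ (boxSpan b N).map r : Submodule K R) := by omega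
    obtain ⟨x, hx⟩ := (Module.finrank_pos_iff_exists_ne_zero).1 h5
    obtain ⟨⟨f, hf, hfx⟩, ⟨g, hg, hgx⟩⟩ := x.2
    refine ⟨f, g, hfx.trans hgx.symm, ?_⟩
    rintro rfl
    exact hx (Subtype.ext (by rw [← hfx, map_zero]; rfl))
  refine { ‹IsDomain R› with left_ore := fun a s hs => ?_, right_ore := fun a s hs => ?_ }
  · rcases eq_or_ne a 0 with rfl | ha
    · exact ⟨0, 1, one_ne_zero, by simp⟩
    obtain ⟨d, hd⟩ := exists_mem_boxSpan b a
    obtain ⟨d', hd'⟩ := exists_mem_boxSpan b s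
    obtain ⟨f, g, hfg, hf⟩ := key (LinearMap.mulRight K a) (LinearMap.mulRight K s) (max d d')
      (fun x y h => mul_right_cancel₀ ha h) (fun x y h => mul_right_cancel₀ hs h)
      (fun N f hf => mul_mem_boxSpan hb hf (boxSpan_mono b (le_max_left _ _) hd))
      (fun N f hf => mul_mem_boxSpan hb hf (boxSpan_mono b (le_max_right _ _) hd'))
    exact ⟨g, f, hf, hfg⟩
  · rcases eq_or_ne a 0 with rfl | ha
    · exact ⟨0, 1, one_ne_zero, by simp⟩
    obtain ⟨d, hd⟩ := exists_mem_boxSpan b a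
    obtain ⟨d', hd'⟩ := exists_mem_boxSpan b s
    obtain ⟨f, g, hfg, hf⟩ := key (LinearMap.mulLeft K a) (LinearMap.mulLeft K s) (max d d')
      (fun x y h => mul_left_cancel₀ ha h) (fun x y h => mul_left_cancel₀ hs h)
      (fun N f hf => add_comm N _ ▸ mul_mem_boxSpan hb (boxSpan_mono b (le_max_left _ _) hd) hf)
      (fun N f hf => add_comm N _ ▸ mul_mem_boxSpan hb (boxSpan_mono b (le_max_right _ _) hd') hf)
    exact ⟨g, f, hf, hfg⟩

/-- An algebra homomorphism with nontrivial kernel strictly reduces the growth. -/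
theorem finrank_map_boxSpan_le (hb : IsMonomialBasis b) {S : Type*} [Ring S] [Algebra K S]
    (φ : R →ₐ[K] S) {f : R} (hf : f ≠ 0) (hφ : φ f = 0) {d : ℕ} (hd : f ∈ boxSpan b d) (N : ℕ) :
    finrank K ((boxSpan b (N + d)).map φ.toLinearMap) + (N + 1) ^ (2 * n) ≤
      (N + d + 1) ^ (2 * n) := by
  set ψ := φ.toLinearMap.domRestrict (boxSpan b (N + d)) with hψ
  have h1 := LinearMap.finrank_range_add_finrank_ker ψ
  rw [finrank_boxSpan, show LinearMap.range ψ = _ from LinearMap.range_domRestrict _ _] at h1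
  have h2 : finrank K (boxSpan b N) ≤ finrank K (LinearMap.ker ψ) := by
    have hmem : ∀ g : boxSpan b N, f * g.1 ∈ boxSpan b (N + d) := fun g =>
      add_comm d N ▸ mul_mem_boxSpan hb hd g.2
    refine LinearMap.finrank_le_finrank_of_injective
      (f := ((((LinearMap.mulLeft K f).comp (boxSpan b N).subtype).codRestrict _ hmem).codRestrict
        (LinearMap.ker ψ) fun g => ?_)) fun x y h => ?_
    · rw [LinearMap.mem_ker]
      change φ (f * g.1) = 0
      rw [map_mul, hφ, zero_mul]
    · have := congrArg (fun z => z.1.1) h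
      exact Subtype.ext (mul_left_cancel₀ hf this)
  rw [finrank_boxSpan] at h2
  omega

end Growth

/-- Bases of an algebra over a field. The module structure is the one that underlies the algebra
structure; for a tensor power it is definitionally equal, but not syntactically, to the one found
by instance search. -/
abbrev AlgebraBasis (I K R : Type*) [Field K] [Ring R] [Algebra K R] : Type _ :=
  Module.Basis I K R

/-! ### Tensor powers of the quantum Weyl algebra -/

namespace QuantumWeylPower

open Module

variable {K : Type*} [Field K] {q : K} {n : ℕ}

/-- The basis of the tensor power formed by the tensors of monomials. -/
noncomputable def monomialBasis (K : Type*) [Field K] (q : K) (n : ℕ) :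
    AlgebraBasis (Fin n → ℕ × ℕ) K (QuantumWeylPower K q n) :=
  Basis.piTensorProduct fun _ => QuantumWeyl.monomialBasis K q

theorem repr_mul (m m' k : Fin n → ℕ × ℕ) :
    (monomialBasis K q n).repr (monomialBasis K q n m * monomialBasis K q n m') k =
      ∏ i, (QuantumWeyl.monomialBasis K q).repr
        (QuantumWeyl.monomialBasis K q (m i) * QuantumWeyl.monomialBasis K q (m' i)) (k i) := by
  simp only [monomialBasis, Basis.piTensorProduct_apply, PiTensorProduct.tprod_mul_tprod,
    Basis.piTensorProduct_repr_tprod_apply, Pi.mul_apply]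

theorem isMonomialBasis (hq : q ≠ 0) : IsMonomialBasis (monomialBasis K q n) where
  le_of_ne_zero i j k h l := by
    rw [repr_mul, Finset.prod_ne_zero_iff] at h
    exact (QuantumWeyl.isMonomialBasis hq).le_of_ne_zero _ _ _ (h l (Finset.mem_univ l))
  repr_add_ne_zero i j := by
    rw [repr_mul, Finset.prod_ne_zero_iff]
    exact fun l _ => (QuantumWeyl.isMonomialBasis hq).repr_add_ne_zero _ _

/-- The lexicographic order on exponents. -/
def lexExponent (n : ℕ) : (Fin n → ℕ × ℕ) →+ Lex (Fin n → ℕ ×ₗ ℕ) where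
  toFun m := toLex fun i => toLex (m i)
  map_zero' := rfl
  map_add' _ _ := rfl

theorem lexExponent_injective : Function.Injective (lexExponent n) := fun _ _ h => h

theorem lexExponent_mono : Monotone (lexExponent n) := fun _ _ h =>
  Pi.toLex_monotone fun i => Prod.Lex.toLex_mono (h i)

theorem isOreDomain (hq : q ≠ 0) (n : ℕ) : IsOreDomain (QuantumWeylPower K q n) := by
  have := noZeroDivisors_of_isMonomialBasis (isMonomialBasis (n := n) hq) lexExponent_mono
    lexExponent_injective
  have : Nontrivial (QuantumWeylPower K q n) :=
    ⟨monomialBasis K q n 0, 0, (monomialBasis K q n).ne_zero 0⟩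
  have := NoZeroDivisors.to_isDomain (QuantumWeylPower K q n)
  exact isOreDomain_of_isMonomialBasis (isMonomialBasis hq)

end QuantumWeylPower

/-! ### The Toda pair of separated variables -/

section Separated

variable {K F D : Type*} [Field K] [Field F] [Algebra K F] [DivisionRing D] [Algebra K D]

/-- A commutative field `F` inside the skew field `D`, with elements `t i` of `F`, and commuting
elements `u i` of `D` that induce by conjugation automorphisms `σ i` of `F`, which shift `t i` to
`q t i + 1` and fix the other `t j`. -/
structure IsShiftSystem {n : ℕ} (q : K) (φ : F →ₐ[K] D) (t : Fin n → F) (σ : Fin n → F ≃ₐ[K] F)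
    (u : Fin n → D) : Prop where
  ne_zero : ∀ i, u i ≠ 0
  injective : Function.Injective t
  shift_ne : ∀ i j, i ≠ j → q • t i + 1 ≠ t j
  one_add_ne_zero : ∀ i, 1 + (q - 1) • t i ≠ 0
  apply_self : ∀ i, σ i (t i) = q • t i + 1
  apply_ne : ∀ i j, i ≠ j → σ i (t j) = t j
  mul_map : ∀ i f, u i * φ f = φ (σ i f) * u i
  commute : ∀ i j, Commute (u i) (u j)

/-- The polynomial `∏ i, (X - t i)`, over `D`. -/
noncomputable def nodalPoly {n : ℕ} (φ : F →ₐ[K] D) (t : Fin n → F) : D[X] :=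
  (Lagrange.nodal Finset.univ t).map (φ : F →+* D)

/-- The interpolation polynomial with value `u i` at `t i`, the argument being substituted to the
left of the coefficients. -/
noncomputable def interpolant {n : ℕ} (φ : F →ₐ[K] D) (t : Fin n → F) (u : Fin n → D) : D[X] :=
  ∑ i, (Lagrange.basis Finset.univ t i).map (φ : F →+* D) * C (u i)

theorem evalScalar_map (φ : F →ₐ[K] D) (z : K) (f : F[X]) :
    evalScalar D z (f.map (φ : F →+* D)) = φ (f.eval (algebraMap K F z)) := by
  have h : (evalScalar D z).comp (mapRingHom (φ : F →+* D)) =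
      (φ : F →+* D).comp (evalRingHom (algebraMap K F z)) := by
    ext <;> simp
  exact RingHom.congr_fun h f

theorem homEval_map (φ : F →ₐ[K] D) (q : K) (n : ℕ) (f : F[X]) :
    homEval q n (f.map (φ : F →+* D)) = φ (homEval q n f) := by
  simp [homEval_apply]

/-- The homogenized value of `∏ i, (X - t i)` at the fixed point of `z ↦ q z + 1`. -/
theorem homEval_nodal {ι : Type*} (q : K) (t : ι → F) (s : Finset ι) :
    homEval q (s.card + 1) (Lagrange.nodal s t) = ∏ i ∈ s, (1 + (q - 1) • t i) := by
  classical
  induction s using Finset.induction_on with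
  | empty => simpa using homEval_X_pow (D := F) q 0
  | insert a s ha ih =>
    rw [Lagrange.nodal_insert_eq_nodal ha, Finset.card_insert_of_notMem ha,
      Finset.prod_insert ha, ← ih, sub_mul, map_sub, homEval_X_mul, homEval_C_mul,
      homEval_succ_of_degree_lt (n := s.card + 1)]
    · simp only [Algebra.smul_def, map_sub, map_one]; ring
    · rw [Lagrange.degree_nodal]; exact_mod_cast Nat.lt_succ_self _

namespace IsShiftSystem

variable {n : ℕ} {q : K} {φ : F →ₐ[K] D} {t : Fin n → F} {σ : Fin n → F ≃ₐ[K] F} {u : Fin n → D}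

theorem evalScalar_nodalPoly (z : K) : evalScalar D z (nodalPoly φ t) =
    φ (∏ i, (algebraMap K F z - t i)) := by
  rw [nodalPoly, evalScalar_map, Lagrange.eval_nodal]

theorem evalScalar_interpolant (z : K) : evalScalar D z (interpolant φ t u) =
    ∑ i, φ ((Lagrange.basis Finset.univ t i).eval (algebraMap K F z)) * u i := by
  simp only [interpolant, map_sum, map_mul, evalScalar_map, evalScalar_C]

theorem eval_basis (i : Fin n) (z : F) : (Lagrange.basis Finset.univ t i).eval z =
    ∏ j ∈ Finset.univ.erase i, ((t i - t j)⁻¹ * (z - t j)) := by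
  simp [Lagrange.basis, Lagrange.basisDivisor, eval_prod]

theorem exchange (h : IsShiftSystem q φ t σ u) (z w : K) :
    (z - w) • (evalScalar D w (interpolant φ t u) * evalScalar D z (nodalPoly φ t)) =
      (z - (q * w + 1)) •
        (evalScalar D z (nodalPoly φ t) * evalScalar D w (interpolant φ t u)) -
      (z - (q * z + 1)) •
        (evalScalar D w (nodalPoly φ t) * evalScalar D z (interpolant φ t u)) := by
  simp only [evalScalar_nodalPoly, evalScalar_interpolant, Finset.sum_mul, Finset.mul_sum,
    Finset.smul_sum, ← Finset.sum_sub_distrib]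
  refine Finset.sum_congr rfl fun i _ => ?_
  have hσ : σ i (∏ j, (algebraMap K F z - t j)) = (algebraMap K F z - (q • t i + 1)) *
      ∏ j ∈ Finset.univ.erase i, (algebraMap K F z - t j) := by
    rw [map_prod, ← Finset.mul_prod_erase _ _ (Finset.mem_univ i)]
    simp only [map_sub, AlgEquiv.commutes, h.apply_self]
    congr 1
    refine Finset.prod_congr rfl fun j hj => ?_
    rw [h.apply_ne i j (Finset.ne_of_mem_erase hj).symm]
  rw [mul_assoc, h.mul_map, hσ, ← mul_assoc, ← mul_assoc, ← mul_assoc, ← map_mul, ← map_mul,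
    ← map_mul, ← smul_mul_assoc, ← smul_mul_assoc, ← smul_mul_assoc, ← sub_mul, ← map_smul,
    ← map_smul, ← map_smul, ← map_sub]
  congr 2
  rw [eval_basis, eval_basis, Finset.prod_mul_distrib, Finset.prod_mul_distrib,
    ← Finset.mul_prod_erase _ (fun j => algebraMap K F z - t j) (Finset.mem_univ i),
    ← Finset.mul_prod_erase _ (fun j => algebraMap K F w - t j) (Finset.mem_univ i)]
  simp only [Algebra.smul_def, map_sub, map_add, map_mul, map_one]
  ring

/-- The values of the interpolation polynomial commute: after symmetrization in `i`, `j`, the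
product of the values at `z` and `w` has coefficients symmetric in `z` and `w`. -/
theorem commute_interpolant [CharZero K] (h : IsShiftSystem q φ t σ u) (z w : K) :
    Commute (evalScalar D z (interpolant φ t u)) (evalScalar D w (interpolant φ t u)) := by
  set l : Fin n → K → F := fun i z => (Lagrange.basis Finset.univ t i).eval (algebraMap K F z)
    with hl
  have hprod : ∀ z w : K, evalScalar D z (interpolant φ t u) * evalScalar D w (interpolant φ t u) =
      ∑ i, ∑ j, φ (l i z * σ i (l j w)) * (u i * u j) := fun z w => by
    simp only [evalScalar_interpolant, Finset.sum_mul_sum]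
    refine Finset.sum_congr rfl fun i _ => Finset.sum_congr rfl fun j _ => ?_
    rw [mul_assoc, ← mul_assoc (u i), h.mul_map, map_mul]
    simp only [mul_assoc]
    rfl
  -- Moving `u i` to the right past `l j w` applies the shift `σ i`. The coefficient of `u i * u j`
  -- in the symmetrized product is symmetric in `z` and `w`.
  have hsymm : ∀ i j (z w : K), l i z * σ i (l j w) + l j z * σ j (l i w) =
      l i w * σ i (l j z) + l j w * σ j (l i z) := by
    intro i j z w
    rcases eq_or_ne i j with rfl | hij
    · have hσ : ∀ z : K, σ i (l i z) =
          ∏ j ∈ Finset.univ.erase i, ((q • t i + 1 - t j)⁻¹ * (algebraMap K F z - t j)) := by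
        intro z
        simp only [hl, eval_basis, map_prod]
        refine Finset.prod_congr rfl fun j hj => ?_
        rw [map_mul, map_inv₀, map_sub, map_sub, AlgEquiv.commutes, h.apply_self,
          h.apply_ne i j (Finset.ne_of_mem_erase hj).symm]
      rw [hσ, hσ]
      simp only [hl, eval_basis, Finset.prod_mul_distrib]
      ring
    · set E : K → F := fun z => ∏ k ∈ (Finset.univ.erase i).erase j, (algebraMap K F z - t k)
        with hE
      -- `E z` and `e i`, `e j` collect the factors with index other than `i` and `j`. `E z` is
      -- fixed by `σ i` and `σ j`, `e j` by `σ i`, and `e i` by `σ j`, so what remains is an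
      -- identity of rational functions of `t i`, `t j`, `z`, `w`.
      have hE' : ∀ z, E z = ∏ k ∈ (Finset.univ.erase j).erase i, (algebraMap K F z - t k) :=
        fun z => by rw [Finset.erase_right_comm]
      set e : Fin n → F := fun l => ∏ k ∈ (Finset.univ.erase i).erase j, (t l - t k)⁻¹ with he
      have he' : ∀ l, e l = ∏ k ∈ (Finset.univ.erase j).erase i, (t l - t k)⁻¹ :=
        fun z => by rw [Finset.erase_right_comm]
      have hli : ∀ z, l i z = (t i - t j)⁻¹ * (algebraMap K F z - t j) * (e i * E z) := fun z => by
        simp only [hl, eval_basis]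
        rw [← Finset.mul_prod_erase _ _ (Finset.mem_erase.2 ⟨hij.symm, Finset.mem_univ j⟩),
          Finset.prod_mul_distrib]
      have hlj : ∀ z, l j z = (t j - t i)⁻¹ * (algebraMap K F z - t i) * (e j * E z) := fun z => by
        simp only [hl, eval_basis]
        rw [← Finset.mul_prod_erase _ _ (Finset.mem_erase.2 ⟨hij, Finset.mem_univ i⟩),
          Finset.prod_mul_distrib, he', hE']
      have hσE : ∀ z, σ i (E z) = E z ∧ σ j (E z) = E z := fun z => by
        simp only [hE, map_prod, map_sub, AlgEquiv.commutes]
        refine ⟨Finset.prod_congr rfl fun k hk => ?_, Finset.prod_congr rfl fun k hk => ?_⟩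
        · rw [h.apply_ne i k (Finset.ne_of_mem_erase (Finset.mem_of_mem_erase hk)).symm]
        · rw [h.apply_ne j k (Finset.ne_of_mem_erase hk).symm]
      have hσej : σ i (e j) = e j := by
        simp only [he, map_prod, map_inv₀, map_sub]
        refine Finset.prod_congr rfl fun k hk => ?_
        rw [h.apply_ne i k (Finset.ne_of_mem_erase (Finset.mem_of_mem_erase hk)).symm,
          h.apply_ne i j hij]
      have hσei : σ j (e i) = e i := by
        simp only [he, map_prod, map_inv₀, map_sub]
        refine Finset.prod_congr rfl fun k hk => ?_
        rw [h.apply_ne j k (Finset.ne_of_mem_erase hk).symm, h.apply_ne j i hij.symm]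
      simp only [hli, hlj, map_mul, map_inv₀, map_sub, AlgEquiv.commutes, h.apply_self,
        h.apply_ne i j hij, h.apply_ne j i hij.symm, hσej, hσei, (hσE _).1, (hσE _).2]
      have h1 : t i - t j ≠ 0 := sub_ne_zero.2 fun h' => hij (h.injective h')
      have h2 : t j - t i ≠ 0 := sub_ne_zero.2 fun h' => hij (h.injective h').symm
      have h3 : t j - (q • t i + 1) ≠ 0 := sub_ne_zero.2 (h.shift_ne i j hij).symm
      have h4 : t i - (q • t j + 1) ≠ 0 := sub_ne_zero.2 (h.shift_ne j i hij.symm).symm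
      generalize q • t i + 1 = a at *
      generalize q • t j + 1 = b at *
      rw [← neg_sub (t i) (t j)]
      field_simp
      ring
  -- Symmetrization uses `u i * u j = u j * u i` and division by `2`.
  have hdouble : ∀ z w : K, (2 : K) •
      (evalScalar D z (interpolant φ t u) * evalScalar D w (interpolant φ t u)) =
      ∑ i, ∑ j, φ (l i z * σ i (l j w) + l j z * σ j (l i w)) * (u i * u j) := fun z w => by
    have h1 : ∑ i, ∑ j, φ (l i z * σ i (l j w)) * (u i * u j) =
        ∑ i, ∑ j, φ (l j z * σ j (l i w)) * (u i * u j) := by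
      rw [Finset.sum_comm]
      exact Finset.sum_congr rfl fun i _ => Finset.sum_congr rfl fun j _ => by
        rw [(h.commute j i).eq]
    simp only [map_add, add_mul, Finset.sum_add_distrib]
    rw [← h1, ← hprod, two_smul]
  refine smul_right_injective D (two_ne_zero (α := K)) ?_
  simp only
  rw [hdouble, hdouble]
  exact Finset.sum_congr rfl fun i _ => Finset.sum_congr rfl fun j _ => by rw [hsymm]

theorem isExchangePair (h : IsShiftSystem q φ t σ u) :
    IsExchangePair q n (nodalPoly φ t) (interpolant φ t u) where
  monic := (Lagrange.nodal_monic).map _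
  natDegree_eq := by
    rw [nodalPoly, (Lagrange.nodal_monic).natDegree_map, Lagrange.natDegree_nodal,
      Finset.card_univ, Fintype.card_fin]
  degree_lt := by
    refine (degree_sum_le _ _).trans_lt ?_
    rw [Finset.sup_lt_iff (WithBot.bot_lt_coe _)]
    intro i _
    refine (degree_mul_le _ _).trans_lt ?_
    refine (add_le_add degree_map_le degree_C_le).trans_lt ?_
    rw [Lagrange.degree_basis (h.injective.injOn) (Finset.mem_univ i), add_zero, Finset.card_univ,
      Fintype.card_fin]
    exact_mod_cast Nat.sub_lt i.pos one_pos
  exchange := h.exchange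

theorem C_mul_map (h : IsShiftSystem q φ t σ u) (i : Fin n) (f : F[X]) :
    f.map (φ : F →+* D) * C (u i) =
      C (u i) * (f.map ((σ i).symm : F →+* F)).map (φ : F →+* D) := by
  ext k
  simp only [coeff_mul_C, coeff_C_mul, coeff_map, RingHom.coe_coe]
  rw [h.mul_map]
  simp

theorem symm_apply_ne (h : IsShiftSystem q φ t σ u) {i j : Fin n} (hij : i ≠ j) :
    (σ i).symm (t j) = t j := by
  rw [AlgEquiv.symm_apply_eq, h.apply_ne i j hij]

theorem symm_apply_self (h : IsShiftSystem q φ t σ u) (i : Fin n) :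
    (σ i).symm (q • t i + 1) = t i := by
  rw [AlgEquiv.symm_apply_eq, h.apply_self i]

/-- Coprimality. The left ideal `J` generated by the two polynomials contains `∏ j ≠ i, (X - t j)`
for each `i`: multiplying the interpolation polynomial by `V = ∏ j ≠ i, (X - (q t j + 1))` turns all
its terms except the `i`-th into multiples of `∏ j, (X - t j)`, and `V` does not vanish at `t i`. By
Lagrange interpolation, `1` lies in `J`. -/
theorem bezout (h : IsShiftSystem q φ t σ u) :
    ∃ U V : D[X], U * nodalPoly φ t + V * interpolant φ t u = 1 := by
  classical
  set J : Submodule D[X] D[X] := Submodule.span D[X] {nodalPoly φ t, interpolant φ t u} with hJ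
  suffices h1 : (1 : D[X]) ∈ J by
    obtain ⟨U, V, hUV⟩ := Submodule.mem_span_pair.1 h1
    exact ⟨U, V, hUV⟩
  have hmul : ∀ (a : D[X]) {b : D[X]}, b ∈ J → a * b ∈ J := fun a b hb => J.smul_mem a hb
  have hP : nodalPoly φ t ∈ J := Submodule.subset_span (by simp)
  have hQ : interpolant φ t u ∈ J := Submodule.subset_span (by simp)
  have hdvd : ∀ f : F[X], Lagrange.nodal Finset.univ t ∣ f → f.map (φ : F →+* D) ∈ J := by
    rintro _ ⟨f, rfl⟩
    rw [mul_comm, Polynomial.map_mul]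
    exact hmul _ hP
  set d : Fin n → F := fun i => ∏ j ∈ Finset.univ.erase i, (t i - t j)⁻¹ with hd
  set N : Fin n → F[X] := fun i => Lagrange.nodal (Finset.univ.erase i) t with hN
  have hd0 : ∀ i, d i ≠ 0 := fun i => Finset.prod_ne_zero_iff.2 fun j hj =>
    inv_ne_zero (sub_ne_zero.2 fun h' => Finset.ne_of_mem_erase hj (h.injective h').symm)
  have hl : ∀ i, Lagrange.basis Finset.univ t i = C (d i) * N i := fun i => by
    simp only [Lagrange.basis, Lagrange.basisDivisor, Finset.prod_mul_distrib, hN,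
      Lagrange.nodal, hd, map_prod]
  have hPN : ∀ i, Lagrange.nodal Finset.univ t = (X - C (t i)) * N i := fun i =>
    Lagrange.nodal_eq_mul_nodal_erase (Finset.mem_univ i)
  have hNσ : ∀ i, (N i).map ((σ i).symm : F →+* F) = N i := fun i => by
    simp only [hN, Lagrange.nodal, Polynomial.map_prod, Polynomial.map_sub, map_X, map_C]
    refine Finset.prod_congr rfl fun j hj => ?_
    rw [RingHom.coe_coe, h.symm_apply_ne (Finset.ne_of_mem_erase hj).symm]
  have hNJ : ∀ i, (N i).map (φ : F →+* D) ∈ J := fun i => by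
    set V : F[X] := Lagrange.nodal (Finset.univ.erase i) (fun j => q • t j + 1) with hV
    -- Moving `u m` to the left substitutes `t m` for `q t m + 1`, which turns the factor
    -- `X - (q t m + 1)` of `V` into the factor `X - t m` missing from the `m`-th basis polynomial.
    have hother : ∀ m, m ≠ i → (V * Lagrange.basis Finset.univ t m).map (φ : F →+* D) * C (u m) ∈
        J := fun m hm => by
      rw [h.C_mul_map]
      refine hmul _ (hdvd _ ?_)
      rw [Polynomial.map_mul, hl, Polynomial.map_mul, hNσ, hPN m]
      refine mul_dvd_mul ?_ (Dvd.intro_left _ rfl)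
      have : (X - C (q • t m + 1)) ∣ V :=
        Finset.dvd_prod_of_mem (fun j => X - C (q • t j + 1))
          (Finset.mem_erase.2 ⟨hm, Finset.mem_univ m⟩)
      have := map_dvd (mapRingHom ((σ m).symm : F →+* F)) this
      simpa only [coe_mapRingHom, Polynomial.map_sub, map_X, map_C, RingHom.coe_coe,
        h.symm_apply_self] using this
    have hi : (V * Lagrange.basis Finset.univ t i).map (φ : F →+* D) * C (u i) ∈ J := by
      have hsum : V.map (φ : F →+* D) * interpolant φ t u =
          ∑ m, (V * Lagrange.basis Finset.univ t m).map (φ : F →+* D) * C (u m) := by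
        simp only [interpolant, Finset.mul_sum, Polynomial.map_mul, mul_assoc]
      rw [← Finset.add_sum_erase _ _ (Finset.mem_univ i)] at hsum
      have h1 := hmul (V.map (φ : F →+* D)) hQ
      rw [hsum] at h1
      exact (J.add_mem_iff_left (J.sum_mem fun m hm => hother m (Finset.ne_of_mem_erase hm))).1 h1
    have hVσ : V.map ((σ i).symm : F →+* F) = V := by
      simp only [hV, Lagrange.nodal, Polynomial.map_prod, Polynomial.map_sub, map_X, map_C]
      refine Finset.prod_congr rfl fun j hj => ?_
      rw [RingHom.coe_coe, map_add, map_smul, map_one,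
        h.symm_apply_ne (Finset.ne_of_mem_erase hj).symm]
    set e := (σ i).symm (d i) with he
    have he0 : e ≠ 0 := by simpa [he] using hd0 i
    rw [h.C_mul_map, Polynomial.map_mul ((σ i).symm : F →+* F), hVσ, hl,
      Polynomial.map_mul ((σ i).symm : F →+* F), hNσ, map_C] at hi
    have h2 := hmul (C (φ e⁻¹)) (hmul (C (u i)⁻¹) hi)
    rw [← mul_assoc (C (u i)⁻¹), ← C_mul, inv_mul_cancel₀ (h.ne_zero i), C_1, one_mul,
      show C (φ e⁻¹) = (C e⁻¹).map (φ : F →+* D) by simp, ← Polynomial.map_mul] at h2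
    have h3 : (C e⁻¹ * (V * (C e * N i))) = V * N i := by
      rw [mul_left_comm V, ← mul_assoc, ← C_mul, inv_mul_cancel₀ he0, C_1, one_mul]
    rw [RingHom.coe_coe, ← he, h3] at h2
    have hVi : V.eval (t i) ≠ 0 := by
      rw [hV, Lagrange.eval_nodal, Finset.prod_ne_zero_iff]
      exact fun j hj => sub_ne_zero.2 (h.shift_ne j i (Finset.ne_of_mem_erase hj)).symm
    -- `V - V (t i)` is divisible by `X - t i`, so modulo `J` the factor `V` of `N i` is the nonzero
    -- scalar `V (t i)` of `F`.
    have h4 : ((V - C (V.eval (t i))) * N i).map (φ : F →+* D) ∈ J := hdvd _ <| by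
      rw [hPN i]
      exact mul_dvd_mul (X_sub_C_dvd_sub_C_eval) (dvd_refl _)
    have h5 : N i = C (V.eval (t i))⁻¹ * (V * N i - (V - C (V.eval (t i))) * N i) := by
      rw [sub_mul, sub_sub_cancel, ← mul_assoc, ← C_mul, inv_mul_cancel₀ hVi, C_1, one_mul]
    rw [h5, Polynomial.map_mul, Polynomial.map_sub]
    exact hmul _ (J.sub_mem h2 h4)
  rcases Nat.eq_zero_or_pos n with rfl | hn
  · have : nodalPoly φ t = 1 := by simp [nodalPoly, Lagrange.nodal]
    rwa [← this]
  · have : Nonempty (Fin n) := ⟨⟨0, hn⟩⟩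
    have h1 := congrArg (Polynomial.map (φ : F →+* D))
      (Lagrange.sum_basis (h.injective.injOn (s := ((Finset.univ : Finset (Fin n)) : Set (Fin n))))
        Finset.univ_nonempty)
    rw [Polynomial.map_sum, Polynomial.map_one] at h1
    rw [← h1]
    refine J.sum_mem fun i _ => ?_
    rw [hl, Polynomial.map_mul]
    exact hmul _ (hNJ i)

/-- The separated variables `t i`, `u i` give rise to a Toda pair. -/
theorem isTodaPair [CharZero K] (h : IsShiftSystem q φ t σ u) :
    IsTodaPair q n (nodalPoly φ t) (interpolant φ t u) where
  toIsExchangePair := h.isExchangePair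
  commute_left z w := by
    rw [evalScalar_nodalPoly, evalScalar_nodalPoly]
    exact (Commute.all _ _).map φ
  commute_right := h.commute_interpolant
  bezout := h.bezout
  homEval_ne_zero := by
    have := homEval_nodal q t Finset.univ
    rw [Finset.card_univ, Fintype.card_fin] at this
    rw [nodalPoly, homEval_map, this, _root_.map_ne_zero, Finset.prod_ne_zero_iff]
    exact fun i _ => h.one_add_ne_zero i

theorem interpolant_coeff (k : ℕ) : (interpolant φ t u).coeff k =
    ∑ i, φ ((Lagrange.basis Finset.univ t i).coeff k) * u i := by
  simp [interpolant, finsetSum_coeff]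

/-- The interpolation property: the value at `t i`, with the argument substituted on the left, is
`u i`. -/
theorem sum_map_pow_mul_coeff (h : IsShiftSystem q φ t σ u) (i : Fin n) :
    ∑ k ∈ Finset.range n, φ (t i) ^ k * (interpolant φ t u).coeff k = u i := by
  have hsum : ∀ j, ∑ k ∈ Finset.range n, t i ^ k * (Lagrange.basis Finset.univ t j).coeff k =
      (Lagrange.basis Finset.univ t j).eval (t i) := fun j => by
    have hj : (Lagrange.basis Finset.univ t j).natDegree < n := by
      rw [Lagrange.natDegree_basis (h.injective.injOn) (Finset.mem_univ j), Finset.card_univ,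
        Fintype.card_fin]
      exact Nat.sub_lt i.pos one_pos
    rw [eval_eq_sum_range' hj]
    exact Finset.sum_congr rfl fun _ _ => mul_comm _ _
  have h1 : ∑ k ∈ Finset.range n, φ (t i) ^ k * (interpolant φ t u).coeff k =
      ∑ j, φ ((Lagrange.basis Finset.univ t j).eval (t i)) * u j := by
    simp only [interpolant_coeff, Finset.mul_sum]
    rw [Finset.sum_comm]
    refine Finset.sum_congr rfl fun j _ => ?_
    rw [← hsum, map_sum, Finset.sum_mul]
    exact Finset.sum_congr rfl fun k _ => by rw [map_mul, map_pow, mul_assoc]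
  rw [h1, Finset.sum_eq_single i]
  · rw [Lagrange.eval_basis_self h.injective.injOn (Finset.mem_univ i), map_one, one_mul]
  · intro j _ hj
    rw [Lagrange.eval_basis_of_ne hj (Finset.mem_univ i), map_zero, zero_mul]
  · simp

end IsShiftSystem

end Separated

open scoped IsMulCommutative

/-! ### Polynomials in commuting elements -/

section CommAeval

variable {K R σ : Type*} [Field K] [Ring R] [Algebra K R]

/-- Evaluation of polynomials at a family of commuting elements of a noncommutative algebra. -/
noncomputable def commAeval (c : σ → R) (hc : ∀ i j, Commute (c i) (c j)) :
    MvPolynomial σ K →ₐ[K] R :=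
  haveI : IsMulCommutative (Algebra.adjoin K (Set.range c)) := Algebra.isMulCommutative_adjoin K (by
    rintro _ ⟨i, rfl⟩ _ ⟨j, rfl⟩
    exact hc i j)
  (Algebra.adjoin K (Set.range c)).val.comp
    (MvPolynomial.aeval fun i => ⟨c i, Algebra.subset_adjoin ⟨i, rfl⟩⟩)

variable {c : σ → R} {hc : ∀ i j, Commute (c i) (c j)}

@[simp] theorem commAeval_X (i : σ) : commAeval (K := K) c hc (MvPolynomial.X i) = c i := by
  simp [commAeval]

theorem commAeval_mem {S : Subalgebra K R} (h : ∀ i, c i ∈ S) (f : MvPolynomial σ K) :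
    commAeval c hc f ∈ S := by
  induction f using MvPolynomial.induction_on with
  | C a => rw [← MvPolynomial.algebraMap_eq, AlgHom.commutes]; exact S.algebraMap_mem a
  | add p q hp hq => rw [map_add]; exact S.add_mem hp hq
  | mul_X p i hp => rw [map_mul, commAeval_X]; exact S.mul_mem hp (h i)

theorem commute_commAeval {r : R} (h : ∀ i, Commute r (c i)) (f : MvPolynomial σ K) :
    Commute r (commAeval c hc f) := by
  have := commAeval_mem (hc := hc) (S := Subalgebra.centralizer K {r})
    (fun i => (Subalgebra.mem_centralizer_iff K).2 fun y hy => by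
      obtain rfl : y = r := hy
      exact (h i).eq) f
  exact (Subalgebra.mem_centralizer_iff K).1 this r rfl

theorem algHom_commAeval {S : Type*} [Ring S] [Algebra K S] (f : R →ₐ[K] S)
    (hc' : ∀ i j, Commute (f (c i)) (f (c j))) (p : MvPolynomial σ K) :
    f (commAeval c hc p) = commAeval (fun i => f (c i)) hc' p := by
  have : f.comp (commAeval c hc) = commAeval (fun i => f (c i)) hc' :=
    MvPolynomial.algHom_ext fun i => by simp
  exact AlgHom.congr_fun this p

/-- The monomial with exponent `m` in a family of commuting elements. -/
noncomputable abbrev commMonomial (K : Type*) [Field K] [Algebra K R] (c : σ → R)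
    (hc : ∀ i j, Commute (c i) (c j)) (m : σ →₀ ℕ) : R :=
  commAeval c hc (MvPolynomial.monomial m (1 : K))

theorem commMonomial_zero : commMonomial K c hc 0 = 1 := by
  rw [commMonomial, ← MvPolynomial.C_apply, MvPolynomial.C_1, map_one]

theorem commMonomial_add (m m' : σ →₀ ℕ) :
    commMonomial K c hc (m + m') = commMonomial K c hc m * commMonomial K c hc m' := by
  rw [commMonomial, ← map_mul, MvPolynomial.monomial_mul, mul_one]

theorem commMonomial_single (i : σ) (k : ℕ) :
    commMonomial K c hc (Finsupp.single i k) = c i ^ k := by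
  rw [commMonomial, ← MvPolynomial.X_pow_eq_monomial, map_pow, commAeval_X]

theorem isLeading_commMonomial {I Γ : Type*} [AddCommMonoid I] [PartialOrder I] [AddCommMonoid Γ]
    [LinearOrder Γ] [IsOrderedCancelAddMonoid Γ] {b : Module.Basis I K R} {w : I →+ Γ}
    (hb : IsMonomialBasis b) (hw : Monotone w) (hinj : Function.Injective w) (h1 : b 0 = 1)
    {e : σ → I} (he : ∀ i, IsLeading b w (c i) (e i)) (m : σ →₀ ℕ) :
    IsLeading b w (commMonomial K c hc m) (m.sum fun i k => k • e i) := by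
  have hone : IsLeading b w 1 0 := h1 ▸ isLeading_basis w 0
  induction m using Finsupp.induction_linear with
  | zero => rw [commMonomial_zero, Finsupp.sum_zero_index]; exact hone
  | add m m' hm hm' =>
    rw [commMonomial_add, Finsupp.sum_add_index' (by simp) (by simp [add_smul])]
    exact hm.mul hb hw hinj hm'
  | single i k =>
    rw [commMonomial_single, Finsupp.sum_single_index (by simp)]
    induction k with
    | zero => simpa using hone
    | succ k ih => rw [pow_succ, succ_nsmul]; exact ih.mul hb hw hinj (he i)

end CommAeval

/-! ### The commutative field of a Weyl family -/

namespace IsWeylFamily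

variable {K D : Type*} [Field K] [DivisionRing D] [Algebra K D] {n : ℕ} {q : K} {h u : Fin n → D}

/-- A Weyl family is independent if the ordered monomials `h ^ α * u ^ β` are linearly
independent. -/
def Independent (hW : IsWeylFamily q h u) : Prop :=
  LinearIndependent K fun m : (Fin n →₀ ℕ) × (Fin n →₀ ℕ) =>
    commMonomial K h hW.commute_left m.1 * commMonomial K u hW.commute_right m.2

variable {hW : IsWeylFamily q h u}

theorem Independent.commAeval_injective (hi : hW.Independent) :
    Function.Injective (commAeval (K := K) h hW.commute_left) := by
  have h1 : LinearIndependent K fun m : Fin n →₀ ℕ => commMonomial K h hW.commute_left m := by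
    have := hi.comp (fun m : Fin n →₀ ℕ => (m, 0)) fun m m' h => (Prod.ext_iff.1 h).1
    simpa [Function.comp_def, commMonomial_zero] using this
  rw [injective_iff_map_eq_zero]
  intro f hf
  rw [MvPolynomial.as_sum f, map_sum] at hf
  have h2 := linearIndependent_iff'.1 h1 f.support (fun m => f.coeff m) (by
    rw [← hf]
    refine Finset.sum_congr rfl fun m _ => ?_
    rw [commMonomial, ← map_smul, MvPolynomial.smul_monomial, smul_eq_mul, mul_one])
  ext m
  by_cases hm : m ∈ f.support
  · exact h2 m hm
  · exact MvPolynomial.notMem_support_iff.1 hm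

/-- The field of rational functions in `n` variables. -/
abbrev RatFunc (K : Type*) [Field K] (n : ℕ) : Type _ := FractionRing (MvPolynomial (Fin n) K)

/-- The embedding of the field of rational functions that sends the variables to the `h i`. -/
noncomputable def ratFuncHom (hi : hW.Independent) : RatFunc K n →ₐ[K] D where
  __ := OreLocalization.universalHom
    (commAeval (K := K) h hW.commute_left : MvPolynomial (Fin n) K →+* D)
    ({ toFun s := Units.mk0 (commAeval (K := K) h hW.commute_left s) (by
          rw [Ne, map_eq_zero_iff _ hi.commAeval_injective]
          exact nonZeroDivisors.coe_ne_zero s)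
       map_one' := by ext; simp
       map_mul' s t := by ext; simp } : nonZeroDivisors (MvPolynomial (Fin n) K) →* Dˣ)
    fun _ => rfl
  commutes' r := by
    have h1 : algebraMap K (RatFunc K n) r =
        algebraMap (MvPolynomial (Fin n) K) _ (algebraMap K _ r) :=
      IsScalarTower.algebraMap_apply K (MvPolynomial (Fin n) K) (RatFunc K n) r
    rw [h1]
    exact (OreLocalization.universalHom_commutes _ _ fun _ => rfl).trans
      ((commAeval (K := K) h hW.commute_left).commutes r)

theorem ratFuncHom_algebraMap (hi : hW.Independent) (f : MvPolynomial (Fin n) K) :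
    ratFuncHom hi (algebraMap _ (RatFunc K n) f) = commAeval h hW.commute_left f :=
  OreLocalization.universalHom_commutes _ _ fun _ => rfl

/-- The automorphism of the polynomial ring that shifts the `i`-th variable `X i` to `q X i + 1`. -/
noncomputable def polyShift (q : K) (hq : q ≠ 0) (i : Fin n) :
    MvPolynomial (Fin n) K ≃ₐ[K] MvPolynomial (Fin n) K :=
  AlgEquiv.ofAlgHom
    (MvPolynomial.aeval (Function.update MvPolynomial.X i (q • MvPolynomial.X i + 1)))
    (MvPolynomial.aeval (Function.update MvPolynomial.X i (q⁻¹ • (MvPolynomial.X i - 1))))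
    (by
      refine MvPolynomial.algHom_ext fun j => ?_
      rcases eq_or_ne j i with rfl | hj
      · simp [smul_smul, inv_mul_cancel₀ hq]
      · simp [hj])
    (by
      refine MvPolynomial.algHom_ext fun j => ?_
      rcases eq_or_ne j i with rfl | hj
      · simp [smul_smul, mul_inv_cancel₀ hq]
      · simp [hj])

theorem polyShift_X_self (hq : q ≠ 0) (i : Fin n) :
    polyShift q hq i (MvPolynomial.X i) = q • MvPolynomial.X i + 1 := by
  simp [polyShift]

theorem polyShift_X_ne (hq : q ≠ 0) {i j : Fin n} (hij : j ≠ i) :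
    polyShift q hq i (MvPolynomial.X j) = MvPolynomial.X j := by
  simp [polyShift, hij]

/-- The automorphism of the field of rational functions that shifts the `i`-th variable `X i` to
`q X i + 1`. -/
noncomputable def ratShift (q : K) (hq : q ≠ 0) (i : Fin n) : RatFunc K n ≃ₐ[K] RatFunc K n :=
  IsFractionRing.fieldEquivOfAlgEquiv K (RatFunc K n) (RatFunc K n) (polyShift q hq i)

theorem ratShift_algebraMap (hq : q ≠ 0) (i : Fin n) (f : MvPolynomial (Fin n) K) :
    ratShift q hq i (algebraMap _ (RatFunc K n) f) = algebraMap _ _ (polyShift q hq i f) :=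
  IsFractionRing.fieldEquivOfAlgEquiv_algebraMap _ _ _ _ _

/-- The `i`-th variable, as a rational function. -/
noncomputable def ratVar (K : Type*) [Field K] {n : ℕ} (i : Fin n) : RatFunc K n :=
  algebraMap (MvPolynomial (Fin n) K) _ (MvPolynomial.X i)

theorem ratFuncHom_ratVar (hi : hW.Independent) (i : Fin n) :
    ratFuncHom hi (ratVar K i) = h i := by
  rw [ratVar, ratFuncHom_algebraMap, commAeval_X]

theorem mul_commAeval (hW : IsWeylFamily q h u) (hq : q ≠ 0) (i : Fin n)
    (f : MvPolynomial (Fin n) K) :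
    u i * commAeval h hW.commute_left f =
      commAeval h hW.commute_left (polyShift q hq i f) * u i := by
  induction f using MvPolynomial.induction_on with
  | C a =>
    rw [← MvPolynomial.algebraMap_eq, AlgEquiv.commutes, AlgHom.commutes, Algebra.commutes]
  | add p r hp hr => rw [map_add, map_add, map_add, mul_add, add_mul, hp, hr]
  | mul_X p j hp =>
    rw [map_mul, map_mul, map_mul, ← mul_assoc, hp, mul_assoc, mul_assoc, commAeval_X]
    congr 1
    rcases eq_or_ne j i with rfl | hj
    · rw [polyShift_X_self, map_add, map_smul, map_one, commAeval_X, hW.mul_eq, add_mul, one_mul,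
        smul_mul_assoc]
    · rw [polyShift_X_ne hq hj, commAeval_X, (hW.commute j i hj).eq]

theorem mul_ratFuncHom (hi : hW.Independent) (hq : q ≠ 0) (i : Fin n) (f : RatFunc K n) :
    u i * ratFuncHom hi f = ratFuncHom hi (ratShift q hq i f) * u i := by
  obtain ⟨a, b, hb, rfl⟩ := IsFractionRing.div_surjective (A := MvPolynomial (Fin n) K) f
  have hb0 : b ≠ 0 := nonZeroDivisors.ne_zero hb
  have hb1 : commAeval (K := K) h hW.commute_left b ≠ 0 := by
    rwa [Ne, map_eq_zero_iff _ hi.commAeval_injective]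
  have hb2 : commAeval (K := K) h hW.commute_left (polyShift q hq i b) ≠ 0 := by
    rwa [Ne, map_eq_zero_iff _ hi.commAeval_injective, EmbeddingLike.map_eq_zero_iff]
  simp only [map_div₀, ratShift_algebraMap, ratFuncHom_algebraMap]
  rw [div_eq_mul_inv, div_eq_mul_inv, ← mul_assoc, mul_commAeval hW hq, mul_assoc, mul_assoc]
  congr 1
  rw [mul_inv_eq_iff_eq_mul₀ hb1, mul_assoc, mul_commAeval hW hq, ← mul_assoc,
    inv_mul_cancel₀ hb2, one_mul]

/-- The elements of an independent Weyl family are separated variables. -/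
theorem isShiftSystem (hi : hW.Independent) (hq : q ≠ 0) :
    IsShiftSystem q (ratFuncHom hi) (ratVar K) (ratShift q hq) u where
  ne_zero := hW.ne_zero
  injective := fun i j hij => MvPolynomial.X_injective
    (IsFractionRing.injective (MvPolynomial (Fin n) K) (RatFunc K n) hij)
  shift_ne i j hij h' := by
    have h1 : algebraMap (MvPolynomial (Fin n) K) (RatFunc K n) (q • MvPolynomial.X i + 1) =
        algebraMap (MvPolynomial (Fin n) K) (RatFunc K n) (MvPolynomial.X j) := by
      rw [← ratVar, ← h', map_add, map_one, ratVar, Algebra.smul_def, Algebra.smul_def, map_mul,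
        ← IsScalarTower.algebraMap_apply]
    have h2 := congrArg (MvPolynomial.eval (0 : Fin n → K))
      (IsFractionRing.injective (MvPolynomial (Fin n) K) (RatFunc K n) h1)
    simp at h2
  one_add_ne_zero i h' := hW.one_add_ne_zero i (by
    have := congrArg (ratFuncHom hi) h'
    simpa [ratFuncHom_ratVar] using this)
  apply_self i := by
    rw [ratVar, ratShift_algebraMap, polyShift_X_self, map_add, map_one, Algebra.smul_def,
      Algebra.smul_def, map_mul, ← IsScalarTower.algebraMap_apply]
  apply_ne i j hij := by
    rw [ratVar, ratShift_algebraMap, polyShift_X_ne hq hij.symm]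
  mul_map := mul_ratFuncHom hi hq
  commute := hW.commute_right

end IsWeylFamily

/-! ### Independence of the coefficients of the Toda pair -/

theorem coeff_nodal_eq_esymm {F : Type*} [Field F] {n : ℕ} (t : Fin n → F) {k : ℕ} (hk : k ≤ n) :
    (Lagrange.nodal Finset.univ t).coeff (n - k) =
      (-1) ^ k * (Finset.univ.val.map t).esymm k := by
  have h1 : Lagrange.nodal Finset.univ t = ((Finset.univ.val.map t).map fun a => X - C a).prod := by
    rw [Lagrange.nodal, Multiset.map_map]
    rfl
  have hc : Multiset.card (Finset.univ.val.map t) = n := by simp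
  rw [h1, Multiset.prod_X_sub_C_coeff _ (by rw [hc]; omega), hc, Nat.sub_sub_self hk]

namespace IsWeylFamily

variable {K D : Type*} [Field K] [DivisionRing D] [Algebra K D] {n : ℕ} {q : K} {h u : Fin n → D}
  {hW : IsWeylFamily q h u}

theorem commAeval_esymm_mem (hi : hW.Independent) {S : Subalgebra K D}
    (hS : nodalPoly (ratFuncHom hi) (ratVar K) ∈ coeffSubring S) {k : ℕ} (hk : k ≤ n) :
    commAeval h hW.commute_left (MvPolynomial.esymm (Fin n) K k) ∈ S := by
  have h1 := hS (n - k)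
  rw [nodalPoly, coeff_map, coeff_nodal_eq_esymm _ hk] at h1
  have h2 : (Finset.univ.val.map (ratVar K)).esymm k =
      algebraMap (MvPolynomial (Fin n) K) (RatFunc K n) (MvPolynomial.esymm (Fin n) K k) := by
    have := MvPolynomial.aeval_esymm_eq_multiset_esymm (Fin n) K k (ratVar K)
    rw [← this]
    have h3 : MvPolynomial.aeval (ratVar K) =
        IsScalarTower.toAlgHom K (MvPolynomial (Fin n) K) (RatFunc K n) :=
      MvPolynomial.algHom_ext fun i => by simp [ratVar]
    rw [h3]
    rfl
  rw [h2, RingHom.coe_coe, map_mul, ratFuncHom_algebraMap, map_pow, map_neg, map_one] at h1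
  have h4 := S.mul_mem (S.pow_mem (S.neg_mem S.one_mem) k) h1
  rwa [← mul_assoc, ← (Commute.refl (-1 : D)).mul_pow, neg_one_mul, neg_neg, one_pow, one_mul] at h4

/-- A symmetric polynomial in the `h i` lies in every subalgebra that contains the coefficients of
`∏ i, (X - h i)`. -/
theorem commAeval_mem_of_isSymmetric (hi : hW.Independent) {S : Subalgebra K D}
    (hS : nodalPoly (ratFuncHom hi) (ratVar K) ∈ coeffSubring S) {f : MvPolynomial (Fin n) K}
    (hf : f.IsSymmetric) : commAeval h hW.commute_left f ∈ S := by
  obtain ⟨g, hg⟩ := (MvPolynomial.esymmAlgHom_fin_bijective K n).2 ⟨f, hf⟩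
  have hg' : MvPolynomial.aeval (fun i : Fin n => MvPolynomial.esymm (Fin n) K (i + 1)) g = f := by
    rw [← MvPolynomial.esymmAlgHom_apply, hg]
  rw [← hg']
  clear hg hg' hf
  induction g using MvPolynomial.induction_on with
  | C a =>
    rw [← MvPolynomial.algebraMap_eq, AlgHom.commutes, AlgHom.commutes]
    exact S.algebraMap_mem a
  | add p r hp hr => rw [map_add, map_add]; exact S.add_mem hp hr
  | mul_X p j hp =>
    rw [map_mul, map_mul, MvPolynomial.aeval_X]
    exact S.mul_mem hp (commAeval_esymm_mem hi hS j.2)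

theorem commute_interpolant_coeff [CharZero K] (hi : hW.Independent) (hq : q ≠ 0) (j k : Fin n) :
    Commute ((interpolant (ratFuncHom hi) (ratVar K) u).coeff j)
      ((interpolant (ratFuncHom hi) (ratVar K) u).coeff k) :=
  (isShiftSystem hi hq).isTodaPair.commute_coeff_right j k

/-- The action of the rational functions of the `h i` on the skew field from the left. -/
noncomputable abbrev leftModule (hi : hW.Independent) : Module (RatFunc K n) D :=
  Module.compHom D (ratFuncHom hi : RatFunc K n →+* D)

/-- The monomials in the `u i` are independent over the rational functions of the `h i`. -/
theorem linearIndependent_right (hi : hW.Independent) :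
    letI := leftModule hi
    LinearIndependent (RatFunc K n) fun m => commMonomial K u hW.commute_right m := by
  let := leftModule hi
  let : Module (MvPolynomial (Fin n) K) D :=
    Module.compHom D (commAeval (K := K) h hW.commute_left : MvPolynomial (Fin n) K →+* D)
  have : IsScalarTower (MvPolynomial (Fin n) K) (RatFunc K n) D := ⟨fun f g d => by
    change ratFuncHom hi (f • g) * d = commAeval h hW.commute_left f * (ratFuncHom hi g * d)
    rw [Algebra.smul_def, map_mul, ratFuncHom_algebraMap, mul_assoc]⟩
  rw [← LinearIndependent.iff_fractionRing (MvPolynomial (Fin n) K) (RatFunc K n),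
    linearIndependent_iff']
  intro s g hg γ hγ
  classical
  set T := s.biUnion fun γ => (g γ).support with hT
  have h1 : ∀ γ ∈ s, g γ • commMonomial K u hW.commute_right γ = ∑ m ∈ T, (g γ).coeff m •
      (commMonomial K h hW.commute_left m * commMonomial K u hW.commute_right γ) := by
    intro γ hγ
    change commAeval h hW.commute_left (g γ) * _ = _
    conv_lhs => rw [(g γ).as_sum]
    rw [map_sum, Finset.sum_mul]
    rw [Finset.sum_subset (Finset.subset_biUnion_of_mem (fun γ => (g γ).support) hγ)]
    · refine Finset.sum_congr rfl fun m _ => ?_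
      rw [← smul_mul_assoc, commMonomial, ← map_smul, MvPolynomial.smul_monomial, smul_eq_mul,
        mul_one]
    · intro m _ hm
      rw [MvPolynomial.notMem_support_iff.1 hm, map_zero, map_zero, zero_mul]
  rw [Finset.sum_congr rfl h1, Finset.sum_comm, ← Finset.sum_product'] at hg
  have h2 := linearIndependent_iff'.1 hi (T ×ˢ s) (fun x => (g x.2).coeff x.1) hg
  ext m
  by_cases hm : m ∈ (g γ).support
  · exact h2 (m, γ) (Finset.mem_product.2 ⟨Finset.mem_biUnion.2 ⟨γ, hγ, hm⟩, hγ⟩)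
  · exact MvPolynomial.notMem_support_iff.1 hm

/-- The monomials in the coefficients `Q k` of the interpolation polynomial are independent over the
rational functions of the `h i`: by `u i = ∑ k, h i ^ k * Q k`, those of degree at most `d` span a
space containing the monomials of degree at most `d` in the `u i`, and there are equally many of
both. -/
theorem linearIndependent_interpolant_coeff [CharZero K] (hi : hW.Independent) (hq : q ≠ 0) :
    letI := leftModule hi
    LinearIndependent (RatFunc K n) fun m => commMonomial K
      (fun k : Fin n => (interpolant (ratFuncHom hi) (ratVar K) u).coeff k)
      (commute_interpolant_coeff hi hq) m := by
  let := leftModule hi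
  have hsmul : ∀ (f : RatFunc K n) (d : D), f • d = ratFuncHom hi f * d := fun _ _ => rfl
  set c := fun k : Fin n => (interpolant (ratFuncHom hi) (ratVar K) u).coeff k with hc
  have hS := isShiftSystem hi hq
  set W : ℕ → Submodule (RatFunc K n) D := fun d => Submodule.span (RatFunc K n)
    (Set.range fun m : {m : Fin n →₀ ℕ | m.degree ≤ d} =>
      commMonomial K c (commute_interpolant_coeff hi hq) m) with hWd
  -- `W d` is the left span of the monomials of degree at most `d` in the `Q k`. Left multiplication
  -- by `u i` is semilinear, so it suffices to expand `u i` on monomials.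
  have hmul : ∀ (i : Fin n) (d : ℕ) (r : D), r ∈ W d → u i * r ∈ W (d + 1) := by
    intro i d r hr
    induction hr using Submodule.span_induction with
    | mem r hr =>
      obtain ⟨⟨m, hm⟩, rfl⟩ := hr
      rw [← hS.sum_map_pow_mul_coeff i, Finset.sum_range, Finset.sum_mul]
      refine sum_mem fun k _ => ?_
      have : commMonomial K c (commute_interpolant_coeff hi hq) (Finsupp.single k 1 + m) ∈
          W (d + 1) :=
        Submodule.subset_span ⟨⟨_, by
          simp only [Set.mem_ofPred_eq, map_add, Finsupp.degree_single] at hm ⊢; omega⟩, rfl⟩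
      rw [commMonomial_add, commMonomial_single, pow_one] at this
      rw [mul_assoc, ← map_pow, ← hsmul]
      exact (W (d + 1)).smul_mem _ this
    | zero => rw [mul_zero]; exact zero_mem _
    | add r r' _ _ hr hr' => rw [mul_add]; exact add_mem hr hr'
    | smul f r _ hr =>
      rw [hsmul, ← mul_assoc, hS.mul_map, mul_assoc, ← hsmul]
      exact (W (d + 1)).smul_mem _ hr
  have hmono : Monotone W := fun d d' hd => Submodule.span_mono (by
    rintro _ ⟨⟨m, hm⟩, rfl⟩
    exact ⟨⟨m, le_trans hm hd⟩, rfl⟩)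
  have hu : ∀ (m : Fin n →₀ ℕ) (d : ℕ) (r : D), r ∈ W d →
      commMonomial K u hW.commute_right m * r ∈ W (d + m.degree) := by
    intro m
    induction m using Finsupp.induction_linear with
    | zero => intro d r hr; rwa [commMonomial_zero, one_mul, map_zero, add_zero]
    | add m m' hm hm' =>
      intro d r hr
      rw [commMonomial_add, mul_assoc, map_add, add_comm m.degree, ← add_assoc]
      exact hm _ _ (hm' _ _ hr)
    | single i k =>
      intro d r hr
      rw [commMonomial_single, Finsupp.degree_single]
      induction k with
      | zero => rwa [pow_zero, one_mul]
      | succ k ih =>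
        rw [pow_succ', mul_assoc, ← add_assoc]
        exact hmul i _ _ ih
  have hu' : ∀ (m : Fin n →₀ ℕ) (d : ℕ), m.degree ≤ d →
      commMonomial K u hW.commute_right m ∈ W d := fun m d hm => by
    have h1 : (1 : D) ∈ W 0 :=
      Submodule.subset_span ⟨⟨0, by simp⟩, by simp only [commMonomial_zero]⟩
    have := hu m 0 1 h1
    rw [mul_one, zero_add] at this
    exact hmono hm this
  have hfin : ∀ d : ℕ, LinearIndependent (RatFunc K n) fun m : {m : Fin n →₀ ℕ | m.degree ≤ d} =>
      commMonomial K c (commute_interpolant_coeff hi hq) m := fun d => by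
    have : Fintype {m : Fin n →₀ ℕ | m.degree ≤ d} := (Finsupp.finite_of_degree_le d).fintype
    -- A spanning family of `W d` is independent once the dimension is at least its size; the
    -- equally many monomials in the `u i` are independent elements of `W d`.
    rw [linearIndependent_iff_card_le_finrank_span]
    have h1 : LinearIndependent (RatFunc K n) fun m : {m : Fin n →₀ ℕ | m.degree ≤ d} =>
        (⟨commMonomial K u hW.commute_right m, hu' m d m.2⟩ : W d) :=
      LinearIndependent.of_comp (W d).subtype
        ((linearIndependent_right hi).comp _ Subtype.val_injective)
    have : Module.Finite (RatFunc K n) (W d) :=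
      Module.Finite.span_of_finite _ (Set.finite_range _)
    exact h1.fintype_card_le_finrank
  rw [linearIndependent_iff']
  intro s g hg m hm
  obtain ⟨d, hd⟩ : ∃ d : ℕ, ∀ m ∈ s, m.degree ≤ d :=
    ⟨∑ m ∈ s, m.degree, fun m hm =>
      Finset.single_le_sum (f := fun m : Fin n →₀ ℕ => m.degree) (fun _ _ => Nat.zero_le _) hm⟩
  have h1 : LinearIndepOn (RatFunc K n)
    (fun m => commMonomial K c (commute_interpolant_coeff hi hq) m)
    {m : Fin n →₀ ℕ | m.degree ≤ d} := hfin d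
  exact linearIndepOn_iff'.1 h1 s g hd hg m hm

theorem commute_esymm (hW : IsWeylFamily q h u) (j k : Fin n) :
    Commute (commAeval h hW.commute_left (MvPolynomial.esymm (Fin n) K (j + 1)))
      (commAeval h hW.commute_left (MvPolynomial.esymm (Fin n) K (k + 1))) :=
  (Commute.all _ _).map _

/-- The ordered monomials in the elementary symmetric functions of the `h i` and the coefficients of
the interpolation polynomial are linearly independent. -/
theorem linearIndependent_esymm_mul_coeff [CharZero K] (hi : hW.Independent) (hq : q ≠ 0) :
    LinearIndependent K fun m : (Fin n →₀ ℕ) × (Fin n →₀ ℕ) =>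
      commMonomial K
        (fun k : Fin n => commAeval h hW.commute_left (MvPolynomial.esymm (Fin n) K (k + 1)))
        hW.commute_esymm m.1 *
      commMonomial K (fun k : Fin n => (interpolant (ratFuncHom hi) (ratVar K) u).coeff k)
        (commute_interpolant_coeff hi hq) m.2 := by
  let := leftModule hi
  have : IsScalarTower K (RatFunc K n) D := ⟨fun a f d => by
    change ratFuncHom hi (a • f) * d = a • (ratFuncHom hi f * d)
    rw [map_smul, smul_mul_assoc]⟩
  let ψ : MvPolynomial (Fin n) K →ₐ[K] MvPolynomial (Fin n) K :=
    (MvPolynomial.symmetricSubalgebra (Fin n) K).val.comp (MvPolynomial.esymmAlgHom (Fin n) K n)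
  have hψ : Function.Injective ψ :=
    Subtype.val_injective.comp (MvPolynomial.esymmAlgHom_fin_injective K le_rfl)
  have h1 : LinearIndependent K fun m : Fin n →₀ ℕ =>
      algebraMap (MvPolynomial (Fin n) K) (RatFunc K n) (ψ (MvPolynomial.monomial m 1)) := by
    have h2 := (MvPolynomial.basisMonomials (Fin n) K).linearIndependent.map_injOn
      ((IsScalarTower.toAlgHom K (MvPolynomial (Fin n) K) (RatFunc K n)).comp ψ).toLinearMap
      (((IsFractionRing.injective (MvPolynomial (Fin n) K) (RatFunc K n)).comp hψ).injOn)
    simpa [Function.comp_def] using h2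
  have h3 := linearIndependent_smul h1 (linearIndependent_interpolant_coeff hi hq)
  have h4 : ∀ f, commAeval h hW.commute_left (ψ f) = commAeval _ hW.commute_esymm f :=
    AlgHom.congr_fun (φ₁ := (commAeval h hW.commute_left).comp ψ) <|
      MvPolynomial.algHom_ext fun i => by
        simp [ψ, MvPolynomial.esymmAlgHom]
  convert! h3 using 2 with m
  rw [commMonomial, ← h4, ← ratFuncHom_algebraMap hi]
  rfl

end IsWeylFamily

/-! ### Homomorphisms out of a tensor power -/

theorem prod_ofFn_mul {R : Type*} [Monoid R] {n : ℕ} (f g : Fin n → R)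
    (h : ∀ i j, i ≠ j → Commute (f i) (g j)) :
    (List.ofFn fun i => f i * g i).prod = (List.ofFn f).prod * (List.ofFn g).prod := by
  induction n with
  | zero => simp
  | succ n ih =>
    rw [List.ofFn_succ, List.ofFn_succ, List.ofFn_succ, List.prod_cons, List.prod_cons,
      List.prod_cons, ih _ _ fun i j hij => h _ _ fun h' => hij (Fin.succ_injective n h')]
    have h1 : Commute (List.ofFn fun i : Fin n => f i.succ).prod (g 0) :=
      (Commute.list_prod_right _ _ fun x hx => by
        obtain ⟨i, rfl⟩ := (List.mem_ofFn' _ _).1 hx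
        exact (h i.succ 0 (Fin.succ_ne_zero i)).symm).symm
    rw [mul_assoc, mul_assoc, ← mul_assoc (g 0), ← h1.eq, mul_assoc]

/-- The homomorphism from a tensor power given by homomorphisms on the factors whose images
commute. -/
noncomputable def tensorPowerLift {K A R : Type*} [Field K] [Ring A] [Algebra K A] [Ring R]
    [Algebra K R] {n : ℕ} (f : Fin n → A →ₐ[K] R)
    (hf : ∀ i j, i ≠ j → ∀ a b, Commute (f i a) (f j b)) : (⨂[K] _ : Fin n, A) →ₐ[K] R :=
  PiTensorProduct.liftAlgHom
    ((MultilinearMap.mkPiAlgebraFin K n R).compLinearMap fun i => (f i).toLinearMap)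
    (by simp)
    (fun a b => by
      simpa using prod_ofFn_mul (fun i => f i (a i)) (fun i => f i (b i)) fun i j hij =>
        hf i j hij _ _)

theorem prod_ofFn_mulSingle {R : Type*} [Monoid R] {n : ℕ} (i : Fin n) (a : R) :
    (List.ofFn (Pi.mulSingle i a : Fin n → R)).prod = a := by
  induction n with
  | zero => exact i.elim0
  | succ n ih =>
    rw [List.ofFn_succ, List.prod_cons]
    refine Fin.cases ?_ (fun j => ?_) i
    · simp
    · have h1 : (fun k : Fin n => (Pi.mulSingle j.succ a : Fin (n + 1) → R) k.succ) =
          Pi.mulSingle j a := by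
        ext k
        simp [Pi.mulSingle_apply]
      rw [h1, ih, Pi.mulSingle_eq_of_ne (Fin.succ_ne_zero j).symm, one_mul]

theorem tensorPowerLift_single {K A R : Type*} [Field K] [Ring A] [Algebra K A] [Ring R]
    [Algebra K R] {n : ℕ} (f : Fin n → A →ₐ[K] R)
    (hf : ∀ i j, i ≠ j → ∀ a b, Commute (f i a) (f j b)) (i : Fin n) (a : A) :
    tensorPowerLift f hf (PiTensorProduct.singleAlgHom (R := K) (A := fun _ => A) i a) = f i a := by
  have h1 : (fun j => f j ((Pi.mulSingle i a : Fin n → A) j)) = Pi.mulSingle i (f i a) := by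
    ext j
    rcases eq_or_ne j i with rfl | hj
    · simp
    · simp [hj]
  change PiTensorProduct.lift _ (PiTensorProduct.tprod K (Pi.mulSingle (M := fun _ => A) i a)) = _
  rw [PiTensorProduct.lift.tprod, MultilinearMap.compLinearMap_apply,
    MultilinearMap.mkPiAlgebraFin_apply]
  exact (congrArg (fun l => (List.ofFn l).prod) h1).trans (prod_ofFn_mulSingle i _)

theorem QuantumWeyl.algHom_mem {K R : Type*} [Field K] {q : K} [Ring R] [Algebra K R]
    (f : QuantumWeyl K q →ₐ[K] R) {S : Subalgebra K R} (hX : f (genX K q) ∈ S)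
    (hY : f (genY K q) ∈ S) (a : QuantumWeyl K q) : f a ∈ S := by
  have h1 : (⊤ : Subalgebra K (QuantumWeyl K q)) ≤ S.comap f := by
    rw [← adjoin_gen, Algebra.adjoin_le_iff]
    rintro _ (rfl | rfl)
    exacts [hX, hY]
  exact h1 (Algebra.mem_top (R := K) (x := a))

namespace QuantumWeylPower

variable {K : Type*} [Field K] {q : K} {n : ℕ}

/-- The embedding of the quantum Weyl algebra as the `i`-th tensor factor. -/
noncomputable abbrev single (K : Type*) [Field K] (q : K) {n : ℕ} (i : Fin n) :
    QuantumWeyl K q →ₐ[K] QuantumWeylPower K q n :=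
  PiTensorProduct.singleAlgHom (R := K) (A := fun _ => QuantumWeyl K q) i

/-- The generator `x` of the `i`-th tensor factor. -/
noncomputable def genX (K : Type*) [Field K] (q : K) {n : ℕ} (i : Fin n) : QuantumWeylPower K q n :=
  single K q i (QuantumWeyl.genX K q)

/-- The generator `y` of the `i`-th tensor factor. -/
noncomputable def genY (K : Type*) [Field K] (q : K) {n : ℕ} (i : Fin n) : QuantumWeylPower K q n :=
  single K q i (QuantumWeyl.genY K q)

theorem genY_mul_genX (i : Fin n) : 
    genY K q i * genX K q i = algebraMap K _ q * (genX K q i * genY K q i) + 1 := by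
  rw [genX, genY, ← map_mul, ← map_mul, QuantumWeyl.genY_mul_genX, map_add,
    Algebra.smul_def, map_mul,
    AlgHom.commutes, map_one]

theorem commute_single {i j : Fin n} (hij : i ≠ j) (a b : QuantumWeyl K q) :
    Commute (single K q i a)
      (single K q j b) := by
  have h1 : Commute (Pi.mulSingle i a : Fin n → QuantumWeyl K q) (Pi.mulSingle j b) :=
    Pi.mulSingle_commute (f := fun _ => QuantumWeyl K q) hij a b
  exact Commute.tprod h1

theorem algHom_ext {R : Type*} [Ring R] [Algebra K R] {f g : QuantumWeylPower K q n →ₐ[K] R}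
    (hX : ∀ i, f (genX K q i) = g (genX K q i)) (hY : ∀ i, f (genY K q i) = g (genY K q i)) :
    f = g :=
  PiTensorProduct.algHom_ext fun i => QuantumWeyl.algHom_ext (hX i) (hY i)

theorem monomialBasis_single (i : Fin n) (m : ℕ × ℕ) :
    monomialBasis K q n (Pi.single i m) =
      single K q i
        (QuantumWeyl.monomialBasis K q m) := by
  rw [monomialBasis, Basis.piTensorProduct_apply]
  change _ = PiTensorProduct.tprod K (Pi.mulSingle (M := fun _ => QuantumWeyl K q) i
    (QuantumWeyl.monomialBasis K q m))
  congr 1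
  ext j
  rcases eq_or_ne j i with rfl | hj
  · simp
  · simp [hj, QuantumWeyl.monomialBasis_apply]

theorem genX_eq (i : Fin n) : genX K q i = monomialBasis K q n (Pi.single i (1, 0)) := by
  rw [monomialBasis_single, QuantumWeyl.monomialBasis_apply, pow_one, pow_zero, mul_one, genX]

theorem genY_eq (i : Fin n) : genY K q i = monomialBasis K q n (Pi.single i (0, 1)) := by
  rw [monomialBasis_single, QuantumWeyl.monomialBasis_apply, pow_one, pow_zero, one_mul, genY]

theorem one_eq : (1 : QuantumWeylPower K q n) = monomialBasis K q n 0 := by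
  rw [monomialBasis, Basis.piTensorProduct_apply, PiTensorProduct.one_def]
  congr 1
  ext j
  simp [QuantumWeyl.monomialBasis_apply]

end QuantumWeylPower

namespace IsWeylFamily

variable {K D : Type*} [Field K] [DivisionRing D] [Algebra K D] {n : ℕ} {q : K} {p Y : Fin n → D}

/-- The homomorphism `x ↦ p i * (Y i)⁻¹`, `y ↦ Y i` from the quantum Weyl algebra. -/
noncomputable def factorHom (hW : IsWeylFamily q p Y) (i : Fin n) : QuantumWeyl K q →ₐ[K] D :=
  QuantumWeyl.lift (p i * (Y i)⁻¹) (Y i) (by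
    rw [← mul_assoc, hW.mul_eq, add_mul, mul_inv_cancel₀ (hW.ne_zero i), smul_mul_assoc,
      mul_assoc, mul_assoc, mul_inv_cancel₀ (hW.ne_zero i), inv_mul_cancel₀ (hW.ne_zero i)])

theorem commute_factorHom (hW : IsWeylFamily q p Y) (i : Fin n) {r : D} (hp : Commute r (p i))
    (hY : Commute r (Y i)) (a : QuantumWeyl K q) : Commute r (hW.factorHom i a) := by
  refine (Subalgebra.mem_centralizer_iff K).1 (QuantumWeyl.algHom_mem (hW.factorHom i)
    (S := Subalgebra.centralizer K {r}) ?_ ?_ a) r rfl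
  · rw [factorHom, QuantumWeyl.lift_genX, Subalgebra.mem_centralizer_iff]
    rintro _ rfl
    exact hp.mul_right hY.inv_right₀
  · rw [factorHom, QuantumWeyl.lift_genY, Subalgebra.mem_centralizer_iff]
    rintro _ rfl
    exact hY

/-- The homomorphism from the tensor power that sends the generators `x`, `y` of the `i`-th factor
to `p i * (Y i)⁻¹` and `Y i`. -/
noncomputable def quantumWeylHom (hW : IsWeylFamily q p Y) : QuantumWeylPower K q n →ₐ[K] D :=
  tensorPowerLift hW.factorHom fun i j hij a b =>
    hW.commute_factorHom j
      (hW.commute_factorHom i (hW.commute_left j i) (hW.commute j i hij.symm) a).symm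
      (hW.commute_factorHom i (hW.commute i j hij).symm (hW.commute_right j i) a).symm b

theorem quantumWeylHom_genX (hW : IsWeylFamily q p Y) (i : Fin n) :
    hW.quantumWeylHom (QuantumWeylPower.genX K q i) = p i * (Y i)⁻¹ := by
  rw [quantumWeylHom, QuantumWeylPower.genX, tensorPowerLift_single, factorHom,
    QuantumWeyl.lift_genX]

theorem quantumWeylHom_genY (hW : IsWeylFamily q p Y) (i : Fin n) :
    hW.quantumWeylHom (QuantumWeylPower.genY K q i) = Y i := by
  rw [quantumWeylHom, QuantumWeylPower.genY, tensorPowerLift_single, factorHom,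
    QuantumWeyl.lift_genY]

end IsWeylFamily

/-! ### Growth -/

section NormalElement

variable {K D : Type*} [Field K] [DivisionRing D] [Algebra K D]

/-- Conjugation by `θ` preserves the space `S`, which contains `1`, and `θ` lies in `S ^ c`. -/
structure IsNormalIn (S : Submodule K D) (θ : D) (c : ℕ) : Prop where
  one_mem : 1 ∈ S
  ne_zero : θ ≠ 0
  mem : θ ∈ S ^ c
  conj_mem : ∀ r ∈ S, θ * r * θ⁻¹ ∈ S

/-- The elements that multiplication by `θ ^ k` brings into `S ^ (c * k)`: fractions with
denominator `θ ^ k` whose numerator has controlled degree. -/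
def denominatorSpan (S : Submodule K D) (θ : D) (c k : ℕ) : Submodule K D :=
  (S ^ (c * k)).comap (LinearMap.mulLeft K (θ ^ k))

theorem mem_denominatorSpan {S : Submodule K D} {θ : D} {c k : ℕ} {r : D} :
    r ∈ denominatorSpan S θ c k ↔ θ ^ k * r ∈ S ^ (c * k) := Iff.rfl

theorem conj_pow_mem {S : Submodule K D} {θ : D} (h0 : θ ≠ 0)
    (h : ∀ r ∈ S, θ * r * θ⁻¹ ∈ S) (N : ℕ) :
    ∀ r ∈ S ^ N, θ * r * θ⁻¹ ∈ S ^ N := by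
  induction N with
  | zero =>
    intro r hr
    obtain ⟨a, rfl⟩ := Submodule.mem_one.1 (pow_zero S ▸ hr)
    rwa [← Algebra.commutes, mul_assoc, mul_inv_cancel₀ h0, mul_one]
  | succ N ih =>
    intro r hr
    rw [pow_succ] at hr ⊢
    induction hr using Submodule.mul_induction_on' with
    | mem_mul_mem a ha b hb =>
      have : θ * (a * b) * θ⁻¹ = (θ * a * θ⁻¹) * (θ * b * θ⁻¹) := by
        simp only [mul_assoc]
        rw [inv_mul_cancel_left₀ h0]
      rw [this]
      exact Submodule.mul_mem_mul (ih a ha) (h b hb)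
    | add a _ b _ ha hb => rw [mul_add, add_mul]; exact add_mem ha hb

namespace IsNormalIn

variable {S : Submodule K D} {θ : D} {c : ℕ}

theorem conj_mem_pow (h : IsNormalIn S θ c) (l N : ℕ) :
    ∀ r ∈ S ^ N, θ ^ l * r * (θ ^ l)⁻¹ ∈ S ^ N := by
  induction l with
  | zero => intro r hr; simpa using hr
  | succ l ih =>
    intro r hr
    have := conj_pow_mem h.ne_zero h.conj_mem N _ (ih r hr)
    rwa [← mul_assoc, mul_assoc _ (θ ^ l)⁻¹, ← mul_inv_rev, ← mul_assoc, ← pow_succ'] at this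

theorem pow_mono (h : IsNormalIn S θ c) {M N : ℕ} (hMN : M ≤ N) : S ^ M ≤ S ^ N := by
  obtain ⟨k, rfl⟩ := Nat.exists_eq_add_of_le hMN
  intro r hr
  rw [pow_add, ← mul_one r]
  refine Submodule.mul_mem_mul hr ?_
  have := Submodule.pow_mem_pow S h.one_mem k
  rwa [one_pow] at this

/-- Fractions multiply with linear control of the degree, because `θ` normalizes the powers of
`S`. -/
theorem mul_mem (h : IsNormalIn S θ c) {k l : ℕ} {r s : D} (hr : r ∈ denominatorSpan S θ c k)
    (hs : s ∈ denominatorSpan S θ c l) : r * s ∈ denominatorSpan S θ c (k + l) := by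
  rw [mem_denominatorSpan] at *
  have : θ ^ (k + l) * (r * s) = (θ ^ l * (θ ^ k * r) * (θ ^ l)⁻¹) * (θ ^ l * s) := by
    rw [mul_assoc _ (θ ^ l)⁻¹, inv_mul_cancel_left₀ (pow_ne_zero l h.ne_zero), add_comm, pow_add]
    simp only [mul_assoc]
  rw [this, mul_add, pow_add]
  exact Submodule.mul_mem_mul (h.conj_mem_pow l _ _ hr) hs

theorem one_mem_denominatorSpan (h : IsNormalIn S θ c) (k : ℕ) : 1 ∈ denominatorSpan S θ c k := by
  rw [mem_denominatorSpan, mul_one, pow_mul]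
  exact Submodule.pow_mem_pow _ h.mem k

theorem denominatorSpan_mono (h : IsNormalIn S θ c) : Monotone (denominatorSpan S θ c) := by
  intro k l hkl r hr
  obtain ⟨m, rfl⟩ := Nat.exists_eq_add_of_le hkl
  rw [← mul_one r]
  exact h.mul_mem hr (h.one_mem_denominatorSpan m)

theorem exists_mem_denominatorSpan (h : IsNormalIn S θ c) {s : Set D}
    (hs : ∀ r ∈ s, ∃ k, r ∈ denominatorSpan S θ c k) {r : D} (hr : r ∈ Algebra.adjoin K s) :
    ∃ k, r ∈ denominatorSpan S θ c k := by
  induction hr using Algebra.adjoin_induction with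
  | mem r hr => exact hs r hr
  | algebraMap a =>
    refine ⟨0, ?_⟩
    rw [Algebra.algebraMap_eq_smul_one]
    exact Submodule.smul_mem _ _ (h.one_mem_denominatorSpan 0)
  | add r r' _ _ hr hr' =>
    obtain ⟨k, hk⟩ := hr
    obtain ⟨l, hl⟩ := hr'
    exact ⟨k + l, add_mem (h.denominatorSpan_mono (Nat.le_add_right _ _) hk)
      (h.denominatorSpan_mono (Nat.le_add_left _ _) hl)⟩
  | mul r r' _ _ hr hr' =>
    obtain ⟨k, hk⟩ := hr
    obtain ⟨l, hl⟩ := hr'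
    exact ⟨k + l, h.mul_mem hk hl⟩

theorem commMonomial_mem (h : IsNormalIn S θ c) {ι : Type*} {a : ι → D}
    {ha : ∀ i j, Commute (a i) (a j)} {k : ℕ} (hk : ∀ i, a i ∈ denominatorSpan S θ c k)
    (m : ι →₀ ℕ) : commMonomial K a ha m ∈ denominatorSpan S θ c (k * m.degree) := by
  induction m using Finsupp.induction_linear with
  | zero => rw [commMonomial_zero]; exact h.one_mem_denominatorSpan _
  | add m m' hm hm' => rw [commMonomial_add, map_add, mul_add]; exact h.mul_mem hm hm'
  | single i l =>
    rw [commMonomial_single, Finsupp.degree_single]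
    induction l with
    | zero => rw [pow_zero]; exact h.one_mem_denominatorSpan _
    | succ l ih => rw [pow_succ, mul_add, mul_one]; exact h.mul_mem ih (hk i)

end IsNormalIn

end NormalElement

section CommAevalProd

variable {K R σ ι : Type*} [Field K] [Ring R] [Algebra K R] {c : σ → R}
  {hc : ∀ i j, Commute (c i) (c j)}

theorem commAeval_prod_mem {S : Submodule K R} (f : ι → MvPolynomial σ K)
    (hf : ∀ i, commAeval c hc (f i) ∈ S) (s : Finset ι) :
    commAeval c hc (∏ i ∈ s, f i) ∈ S ^ s.card := by
  classical
  induction s using Finset.induction_on with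
  | empty =>
    rw [Finset.prod_empty, map_one, Finset.card_empty, pow_zero]
    exact Submodule.one_le.1 le_rfl
  | insert a s ha ih =>
    rw [Finset.prod_insert ha, map_mul, Finset.card_insert_of_notMem ha, pow_succ']
    exact Submodule.mul_mem_mul (hf a) ih

theorem commute_commAeval_prod {r : R} (f : ι → MvPolynomial σ K) (s : Finset ι)
    (hf : ∀ i ∈ s, Commute r (commAeval c hc (f i))) :
    Commute r (commAeval c hc (∏ i ∈ s, f i)) := by
  classical
  induction s using Finset.induction_on with
  | empty => simp
  | insert a s ha ih =>
    rw [Finset.prod_insert ha, map_mul]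
    exact (hf a (Finset.mem_insert_self a s)).mul_right
      (ih fun i hi => hf i (Finset.mem_insert_of_mem hi))

end CommAevalProd

namespace IsWeylFamily

variable {K D : Type*} [Field K] [DivisionRing D] [Algebra K D] {n : ℕ} {q : K} {p Y : Fin n → D}

/-- The span of `1` and the elements of a Weyl family. Its powers filter the algebra that they
generate. -/
def weylSpan (K : Type*) {D : Type*} [Field K] [DivisionRing D] [Algebra K D] (p Y : Fin n → D) :
    Submodule K D :=
  Submodule.span K ({1} ∪ (Set.range p ∪ Set.range Y))

theorem one_mem_weylSpan : 1 ∈ weylSpan K p Y := Submodule.subset_span (by simp)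

theorem left_mem_weylSpan (i : Fin n) : p i ∈ weylSpan K p Y :=
  Submodule.subset_span (by simp)

theorem right_mem_weylSpan (i : Fin n) : Y i ∈ weylSpan K p Y :=
  Submodule.subset_span (by simp)

theorem weylSpan_pow_le (hW : IsWeylFamily q p Y) (hq : q ≠ 0) (N : ℕ) :
    weylSpan K p Y ^ N ≤ (boxSpan (QuantumWeylPower.monomialBasis K q n) (2 * N)).map
      hW.quantumWeylHom.toLinearMap := by
  have hb := QuantumWeylPower.isMonomialBasis (n := n) hq
  have hbasis : ∀ (M : ℕ) (m : Fin n → ℕ × ℕ), (∀ i, m i ≤ (M, M)) →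
      QuantumWeylPower.monomialBasis K q n m ∈
        boxSpan (QuantumWeylPower.monomialBasis K q n) M := fun M m hm =>
    Submodule.subset_span ⟨m, hm, rfl⟩
  have hsingle : ∀ (M : ℕ) (i : Fin n) (m : ℕ × ℕ), m ≤ (M, M) →
      QuantumWeylPower.monomialBasis K q n (Pi.single i m) ∈
        boxSpan (QuantumWeylPower.monomialBasis K q n) M := fun M i m hm =>
    hbasis M _ fun j => by
      rcases eq_or_ne j i with rfl | hj
      · simpa using hm
      · rw [Pi.single_eq_of_ne hj]; exact ⟨Nat.zero_le _, Nat.zero_le _⟩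
  -- `p i` and `Y i` are the images of `x i * y i` and `y i`, hence of elements of the box of size
  -- `2`.
  have hS : weylSpan K p Y ≤ (boxSpan (QuantumWeylPower.monomialBasis K q n) 2).map
      hW.quantumWeylHom.toLinearMap := by
    rw [weylSpan, Submodule.span_le]
    rintro _ (rfl | ⟨i, rfl⟩ | ⟨i, rfl⟩)
    · exact ⟨1, QuantumWeylPower.one_eq (K := K) (q := q) (n := n) ▸ hbasis 2 0 fun _ =>
        ⟨Nat.zero_le _, Nat.zero_le _⟩, map_one hW.quantumWeylHom⟩
    · refine ⟨QuantumWeylPower.genX K q i * QuantumWeylPower.genY K q i, ?_, ?_⟩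
      · refine mul_mem_boxSpan (M := 1) (N := 1) hb ?_ ?_
        · rw [QuantumWeylPower.genX_eq]; exact hsingle 1 i _ (by decide)
        · rw [QuantumWeylPower.genY_eq]; exact hsingle 1 i _ (by decide)
      · rw [AlgHom.toLinearMap_apply, map_mul, quantumWeylHom_genX, quantumWeylHom_genY,
          inv_mul_cancel_right₀ (hW.ne_zero i)]
    · refine ⟨QuantumWeylPower.genY K q i, ?_, ?_⟩
      · rw [QuantumWeylPower.genY_eq]; exact hsingle 2 i _ (by decide)
      · rw [AlgHom.toLinearMap_apply, quantumWeylHom_genY]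
  induction N with
  | zero =>
    rw [pow_zero, Submodule.one_le]
    exact ⟨1, QuantumWeylPower.one_eq (K := K) (q := q) (n := n) ▸ hbasis _ 0 fun _ =>
        ⟨Nat.zero_le _, Nat.zero_le _⟩, map_one hW.quantumWeylHom⟩
  | succ N ih =>
    rw [pow_succ, Submodule.mul_le]
    intro a ha b hb'
    obtain ⟨f, hf, rfl⟩ := ih ha
    obtain ⟨g, hg, rfl⟩ := hS hb'
    exact ⟨f * g, mul_mem_boxSpan hb hf hg, map_mul hW.quantumWeylHom f g⟩

theorem right_mul_one_add (hW : IsWeylFamily q p Y) (i : Fin n) :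
    Y i * (1 + (q - 1) • p i) = q • ((1 + (q - 1) • p i) * Y i) := by
  rw [mul_add, mul_one, mul_smul_comm, hW.mul_eq, add_mul, one_mul, smul_mul_assoc]
  module

/-- The product `θ` of all `Y i` and `1 + (q - 1) p i` is a common denominator: it commutes with the
elements of the family up to affine substitutions, and it cancels the inverses in
`weylAdjoin q p Y`. -/
theorem exists_isNormalIn (hW : IsWeylFamily q p Y) (hq : q ≠ 0) :
    ∃ θ c, IsNormalIn (weylSpan K p Y) θ c ∧ ∀ r ∈ weylAdjoin q p Y,
      ∃ k, r ∈ denominatorSpan (weylSpan K p Y) θ c k := by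
  classical
  set S := weylSpan K p Y with hS
  -- `a s` is the product of the `Y i` and `b s` that of the `1 + (q - 1) p i`, for `i` in `s`. Both
  -- are products of commuting elements, so any factor can be split off on either side.
  let a : Finset (Fin n) → D := fun s => commAeval (K := K) Y hW.commute_right
    (∏ i ∈ s, MvPolynomial.X i)
  let b : Finset (Fin n) → D := fun s => commAeval (K := K) p hW.commute_left
    (∏ i ∈ s, (1 + (q - 1) • MvPolynomial.X i))
  have hg : ∀ i, commAeval (K := K) p hW.commute_left (1 + (q - 1) • MvPolynomial.X i) =
      1 + (q - 1) • p i := fun i => by simp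
  have ha : ∀ i, a Finset.univ = a (Finset.univ.erase i) * Y i := fun i => by
    simp only [a]
    rw [← Finset.prod_erase_mul _ _ (Finset.mem_univ i), map_mul, commAeval_X]
  have hb : ∀ i, b Finset.univ = b (Finset.univ.erase i) * (1 + (q - 1) • p i) := fun i => by
    simp only [b]
    rw [← Finset.prod_erase_mul _ _ (Finset.mem_univ i), map_mul, hg]
  have hamem : ∀ s, a s ∈ S ^ s.card := fun s =>
    commAeval_prod_mem _ (fun i => by rw [commAeval_X]; exact right_mem_weylSpan i) s
  have hbmem : ∀ s, b s ∈ S ^ s.card := fun s =>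
    commAeval_prod_mem _ (fun i => by
      rw [hg]; exact add_mem one_mem_weylSpan (S.smul_mem _ (left_mem_weylSpan i))) s
  have hap : ∀ i, Commute (p i) (a (Finset.univ.erase i)) := fun i =>
    commute_commAeval_prod _ _ fun j hj => by
      rw [commAeval_X]; exact hW.commute i j (Finset.ne_of_mem_erase hj).symm
  have hbY : ∀ i, Commute (Y i) (b (Finset.univ.erase i)) := fun i =>
    commute_commAeval_prod _ _ fun j hj => by
      rw [hg]
      exact (Commute.one_right _).add_right
        ((hW.commute j i (Finset.ne_of_mem_erase hj)).symm.smul_right _)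
  have haY : ∀ i s, Commute (Y i) (a s) := fun i s => commute_commAeval (hW.commute_right i) _
  have hbp : ∀ i s, Commute (p i) (b s) := fun i s => commute_commAeval (hW.commute_left i) _
  have ha0 : ∀ s, a s ≠ 0 := fun s => by
    induction s using Finset.induction_on with
    | empty => simp [a]
    | insert i s hi ih =>
      simp only [a] at ih ⊢
      rw [Finset.prod_insert hi, map_mul, commAeval_X]
      exact mul_ne_zero (hW.ne_zero i) ih
  have hb0 : ∀ s, b s ≠ 0 := fun s => by
    induction s using Finset.induction_on with
    | empty => simp [b]
    | insert i s hi ih =>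
      simp only [b] at ih ⊢
      rw [Finset.prod_insert hi, map_mul, hg]
      exact mul_ne_zero (hW.one_add_ne_zero i) ih
  set θ := b Finset.univ * a Finset.univ with hθ
  have hθ0 : θ ≠ 0 := mul_ne_zero (hb0 _) (ha0 _)
  have hθp : ∀ i, θ * p i = (q • p i + 1) * θ := fun i => by
    have h1 : a Finset.univ * p i = (q • p i + 1) * a Finset.univ := by
      rw [ha, mul_assoc, hW.mul_eq, mul_add, mul_smul_comm, ← mul_assoc, ← (hap i).eq]
      simp only [add_mul, smul_mul_assoc, one_mul, mul_assoc]
    rw [hθ, mul_assoc, h1, ← mul_assoc, ← mul_assoc]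
    congr 1
    exact ((((hbp i _).smul_left q).add_left (Commute.one_left _))).eq.symm
  have hθY : ∀ i, θ * Y i = (q⁻¹ • Y i) * θ := fun i => by
    have h1 : b Finset.univ * Y i = (q⁻¹ • Y i) * b Finset.univ := by
      have h2 : (1 + (q - 1) • p i) * Y i = q⁻¹ • (Y i * (1 + (q - 1) • p i)) := by
        rw [hW.right_mul_one_add, smul_smul, inv_mul_cancel₀ hq, one_smul]
      rw [hb, mul_assoc, h2, mul_smul_comm, ← mul_assoc, ← (hbY i).eq, mul_assoc, smul_mul_assoc]
    rw [hθ, mul_assoc, ← (haY i _).eq, ← mul_assoc, h1, mul_assoc]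
  have hnormal : IsNormalIn S θ (2 * n) := by
    refine ⟨one_mem_weylSpan, hθ0, ?_, ?_⟩
    · have := Submodule.mul_mem_mul (hbmem Finset.univ) (hamem Finset.univ)
      rwa [← pow_add, Finset.card_univ, Fintype.card_fin, ← two_mul] at this
    · intro r hr
      rw [hS, weylSpan] at hr
      induction hr using Submodule.span_induction with
      | mem r hr =>
        obtain rfl | ⟨i, rfl⟩ | ⟨i, rfl⟩ := hr
        · rw [mul_one, mul_inv_cancel₀ hθ0]; exact one_mem_weylSpan
        · rw [hθp, mul_inv_cancel_right₀ hθ0]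
          exact add_mem (S.smul_mem _ (left_mem_weylSpan i)) one_mem_weylSpan
        · rw [hθY, mul_inv_cancel_right₀ hθ0]
          exact S.smul_mem _ (right_mem_weylSpan i)
      | zero => rw [mul_zero, zero_mul]; exact zero_mem _
      | add r s _ _ hr hs => rw [mul_add, add_mul]; exact add_mem hr hs
      | smul x r _ hr => rw [mul_smul_comm, smul_mul_assoc]; exact S.smul_mem _ hr
  have hc : ∀ i, (Finset.univ.erase i : Finset (Fin n)).card ≤ n := fun i =>
    (Finset.card_erase_le).trans (by simp)
  -- The bound for the generators: `θ r` has degree at most `2 n + 1` for `r` in `S`, and in `θ r`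
  -- for an inverse `r` one factor of `θ` cancels, which leaves at most `2 n`.
  have hmem1 : ∀ r ∈ S, r ∈ denominatorSpan S θ (2 * n + 1) 1 := fun r hr => by
    rw [mem_denominatorSpan, pow_one, mul_one, pow_succ]
    exact Submodule.mul_mem_mul hnormal.mem hr
  have hnormal' : IsNormalIn S θ (2 * n + 1) :=
    ⟨hnormal.one_mem, hnormal.ne_zero, hnormal.pow_mono (Nat.le_succ _) hnormal.mem,
      hnormal.conj_mem⟩
  have hmem2 : ∀ {i : Fin n} {r s : D}, r ∈ S ^ n → s ∈ S ^ (Finset.univ.erase i).card →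
      r * s ∈ S ^ ((2 * n + 1) * 1) := fun {i r s} hr hs => by
    have := Submodule.mul_mem_mul hr (hnormal.pow_mono (hc i) hs)
    rw [← pow_add] at this
    exact hnormal.pow_mono (by omega) this
  have hmem3 : ∀ {i : Fin n} {r s : D}, r ∈ S ^ (Finset.univ.erase i).card → s ∈ S ^ n →
      r * s ∈ S ^ ((2 * n + 1) * 1) := fun {i r s} hr hs => by
    have := Submodule.mul_mem_mul (hnormal.pow_mono (hc i) hr) hs
    rw [← pow_add] at this
    exact hnormal.pow_mono (by omega) this
  have hcard : (Finset.univ : Finset (Fin n)).card = n := by simp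
  refine ⟨θ, 2 * n + 1, hnormal', fun r hr => hnormal'.exists_mem_denominatorSpan ?_ hr⟩
  intro r hr
  refine ⟨1, ?_⟩
  obtain ⟨i, rfl | rfl | rfl | rfl⟩ := Set.mem_iUnion.1 hr
  · exact hmem1 _ (left_mem_weylSpan i)
  · exact hmem1 _ (right_mem_weylSpan i)
  · rw [mem_denominatorSpan, pow_one, hθ, ha i, ← mul_assoc, mul_inv_cancel_right₀ (hW.ne_zero i)]
    have := hbmem Finset.univ
    rw [hcard] at this
    exact hmem2 this (hamem _)
  -- Here the inverse has to pass the factor `a Finset.univ`, which costs a scalar.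
  · have hga : a Finset.univ * (1 + (q - 1) • p i) = q • ((1 + (q - 1) • p i) * a Finset.univ) := by
      rw [ha, mul_assoc, hW.right_mul_one_add, mul_smul_comm, ← mul_assoc]
      congr 1
      rw [← mul_assoc]
      congr 1
      exact ((Commute.one_right _).add_right ((hap i).smul_left (q - 1)).symm).eq
    have h1 : θ * (1 + (q - 1) • p i)⁻¹ = q⁻¹ • (b (Finset.univ.erase i) * a Finset.univ) := by
      rw [mul_inv_eq_iff_eq_mul₀ (hW.one_add_ne_zero i), smul_mul_assoc, mul_assoc, hga,
        mul_smul_comm, smul_smul, inv_mul_cancel₀ hq, one_smul, hθ, hb i, mul_assoc]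
    rw [mem_denominatorSpan, pow_one, h1]
    refine Submodule.smul_mem _ _ ?_
    have := hamem Finset.univ
    rw [hcard] at this
    exact hmem3 (hbmem _) this

/-- The homomorphism is injective as soon as `weylAdjoin q p Y` contains two commuting families of
`n` elements whose ordered monomials are linearly independent. Up to a power of `θ`, the
`(N + 1) ^ (2 * n)` monomials with exponents at most `N` lie in the image of a box of size linear in
`N`; a nonzero kernel would bound the dimension of that image by a polynomial in `N` of degree
less than `2 * n`. -/
theorem quantumWeylHom_injective (hW : IsWeylFamily q p Y) (hq : q ≠ 0)
    {a b : Fin n → D} (ha : ∀ i j, Commute (a i) (a j)) (hb : ∀ i j, Commute (b i) (b j))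
    (ha' : ∀ i, a i ∈ weylAdjoin q p Y) (hb' : ∀ i, b i ∈ weylAdjoin q p Y)
    (hi : LinearIndependent K fun m : (Fin n →₀ ℕ) × (Fin n →₀ ℕ) =>
      commMonomial K a ha m.1 * commMonomial K b hb m.2) :
    Function.Injective hW.quantumWeylHom := by
  obtain ⟨θ, c, hθ, hmem⟩ := hW.exists_isNormalIn hq
  set S := weylSpan K p Y
  obtain ⟨k, hka, hkb⟩ : ∃ k, (∀ i, a i ∈ denominatorSpan S θ c k) ∧
      ∀ i, b i ∈ denominatorSpan S θ c k := by
    choose f hf using fun i => hmem _ (ha' i)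
    choose g hg using fun i => hmem _ (hb' i)
    refine ⟨∑ i, (f i + g i), fun i => hθ.denominatorSpan_mono ?_ (hf i),
      fun i => hθ.denominatorSpan_mono ?_ (hg i)⟩
    · exact (Nat.le_add_right _ _).trans
        (Finset.single_le_sum (f := fun i => f i + g i) (fun _ _ => Nat.zero_le _)
          (Finset.mem_univ i))
    · exact (Nat.le_add_left _ _).trans
        (Finset.single_le_sum (f := fun i => f i + g i) (fun _ _ => Nat.zero_le _)
          (Finset.mem_univ i))
  rw [injective_iff_map_eq_zero]
  intro f hf
  by_contra hf0
  obtain ⟨d, hd⟩ := exists_mem_boxSpan (QuantumWeylPower.monomialBasis K q n) f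
  have : IsDomain (QuantumWeylPower K q n) := (QuantumWeylPower.isOreDomain hq n).toIsDomain
  -- With `k` a common denominator exponent for the generators, a product of two monomials, of
  -- degree at most `n N` in each family, becomes regular after multiplication by `θ ^ (2 n k N)`.
  -- The result has degree `2 n k c N` in the `p i`, `Y i`, hence exponents at most `s N` in the
  -- `x i`, `y i`.
  set s := 2 * (c * (k * (2 * n)))
  obtain ⟨N, hN⟩ := exists_add_pow_lt_pow_add_pow (2 * n) s d
  have h1 := finrank_map_boxSpan_le (QuantumWeylPower.isMonomialBasis (n := n) hq)
    hW.quantumWeylHom hf0 hf hd (s * N)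
  set V := (boxSpan (QuantumWeylPower.monomialBasis K q n) (s * N + d)).map
    hW.quantumWeylHom.toLinearMap
  let e : (Fin n → Fin (N + 1)) → (Fin n →₀ ℕ) := fun m =>
    Finsupp.equivFunOnFinite.symm fun i => (m i : ℕ)
  have he : Function.Injective e := fun m m' h => by
    ext i
    exact DFunLike.congr_fun h i
  have hdeg : ∀ m, (e m).degree ≤ n * N := fun m => by
    rw [Finsupp.degree_eq_sum]
    refine (Finset.sum_le_card_nsmul _ _ N fun i _ => Nat.le_of_lt_succ (m i).2).trans ?_
    simp
  have hv : ∀ m : (Fin n → Fin (N + 1)) × (Fin n → Fin (N + 1)),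
      θ ^ (k * (n * N) + k * (n * N)) *
        (commMonomial K a ha (e m.1) * commMonomial K b hb (e m.2)) ∈ V := fun m => by
    have h2 := hθ.mul_mem
      (hθ.denominatorSpan_mono (Nat.mul_le_mul_left k (hdeg m.1))
        (hθ.commMonomial_mem (ha := ha) hka (e m.1)))
      (hθ.denominatorSpan_mono (Nat.mul_le_mul_left k (hdeg m.2))
        (hθ.commMonomial_mem (ha := hb) hkb (e m.2)))
    rw [mem_denominatorSpan] at h2
    refine Submodule.map_mono (boxSpan_mono _ (Nat.le_add_right (s * N) d)) ?_
    have h3 := hW.weylSpan_pow_le hq _ h2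
    rwa [show 2 * (c * (k * (n * N) + k * (n * N))) = s * N by ring] at h3
  have h4 : LinearIndependent K fun m => (⟨_, hv m⟩ : V) := by
    refine LinearIndependent.of_comp V.subtype ?_
    have h5 := hi.comp (Prod.map e e) (he.prodMap he)
    exact h5.map_injOn (LinearMap.mulLeft K (θ ^ (k * (n * N) + k * (n * N))))
      (mul_right_injective₀ (pow_ne_zero _ hθ.ne_zero)).injOn
  have h6 := h4.fintype_card_le_finrank
  rw [Fintype.card_prod, Fintype.card_fun, Fintype.card_fin, Fintype.card_fin, ← pow_add,
    ← two_mul] at h6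
  omega

end IsWeylFamily

/-! ### Symmetric polynomials and invariants -/

section Symmetric

variable {K : Type*} [Field K] {n : ℕ}

theorem isIntegral_X_symmetricSubalgebra (i : Fin n) :
    IsIntegral (MvPolynomial.symmetricSubalgebra (Fin n) K) (MvPolynomial.X (R := K) i) := by
  set S := MvPolynomial.symmetricSubalgebra (Fin n) K
  rw [← neg_neg (MvPolynomial.X (R := K) i)]
  refine IsIntegral.neg ?_
  have h1 := MvPolynomial.prod_C_add_X_eq_sum_esymm K (Fin n)
  let f : S[X] := ∑ j ∈ Finset.range (n + 1),
    C ⟨MvPolynomial.esymm (Fin n) K j, MvPolynomial.esymm_isSymmetric _ _ _⟩ * X ^ (n - j)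
  have hf : f.map S.val.toRingHom = ∏ j : Fin n, (X + C (MvPolynomial.X j)) := by
    rw [h1, Fintype.card_fin]
    simp [f, Polynomial.map_sum]
  refine ⟨f, ?_, ?_⟩
  · rw [Function.Injective.monic_map_iff (f := S.val.toRingHom) Subtype.val_injective, hf]
    exact monic_prod_of_monic _ _ fun j _ => monic_X_add_C _
  · have h2 : eval₂ (algebraMap S (MvPolynomial (Fin n) K)) (-MvPolynomial.X i) f =
        (f.map S.val.toRingHom).eval (-MvPolynomial.X i) := by
      rw [eval_map]; rfl
    rw [h2, hf, eval_prod]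
    exact Finset.prod_eq_zero (Finset.mem_univ i) (by simp)

theorem finite_symmetricSubalgebra :
    Module.Finite (MvPolynomial.symmetricSubalgebra (Fin n) K) (MvPolynomial (Fin n) K) := by
  set S := MvPolynomial.symmetricSubalgebra (Fin n) K
  have h1 : Algebra.IsIntegral S (MvPolynomial (Fin n) K) := ⟨fun f => by
    induction f using MvPolynomial.induction_on with
    | C a => exact isIntegral_algebraMap (R := S) (x := algebraMap K S a)
    | add p r hp hr => exact hp.add hr
    | mul_X p i hp => exact hp.mul (isIntegral_X_symmetricSubalgebra i)⟩
  have h2 : Algebra.FiniteType S (MvPolynomial (Fin n) K) :=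
    Algebra.FiniteType.of_restrictScalars_finiteType K S _
  exact Algebra.IsIntegral.finite

end Symmetric

namespace IsWeylFamily

variable {K D E : Type*} [Field K] [DivisionRing D] [Algebra K D] [DivisionRing E] [Algebra K E]
  {n : ℕ} {q : K} {h u : Fin n → D} {hW : IsWeylFamily q h u}

/-- The right action of `E` on `D` through `Φ`. -/
noncomputable abbrev rightModule (Φ : E →ₐ[K] D) : Module Eᵐᵒᵖ D :=
  Module.compHom D ((Φ : E →+* D).op)

/-- If the coefficients of the Toda pair lie in the image of `Φ : E → D`, then `D` is spanned over
`E` by the polynomials in the `h i`. Indeed their span `M` is finite-dimensional, since polynomials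
are finite over symmetric polynomials; hence the elements `d` with `d M ⊆ M` form a skew field. It
contains the `h i`, and the `u i` by `u i = ∑ k, h i ^ k * Q k`. -/
theorem exists_span_eq_top (hi : hW.Independent) (hq : q ≠ 0) (Φ : E →ₐ[K] D)
    (hP : nodalPoly (ratFuncHom hi) (ratVar K) ∈ coeffSubring Φ.range)
    (hQ : interpolant (ratFuncHom hi) (ratVar K) u ∈ coeffSubring Φ.range)
    (hgen : ∀ S : Subalgebra K D, (∀ a ∈ S, a⁻¹ ∈ S) → (∀ i, h i ∈ S) → (∀ i, u i ∈ S) → S = ⊤) :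
    letI := rightModule Φ
    Submodule.span Eᵐᵒᵖ (Set.range (commAeval (K := K) h hW.commute_left)) = ⊤ := by
  let := rightModule Φ
  have hsmul : ∀ (e : Eᵐᵒᵖ) (d : D), e • d = d * Φ e.unop := fun _ _ => rfl
  set M : Submodule Eᵐᵒᵖ D :=
    Submodule.span Eᵐᵒᵖ (Set.range (commAeval (K := K) h hW.commute_left)) with hM
  -- Symmetric polynomials in the `h i` lie in the image of `E`, and the polynomial ring is finite
  -- over the symmetric polynomials.
  have hfin : Module.Finite Eᵐᵒᵖ M := by
    obtain ⟨s, hs⟩ := (finite_symmetricSubalgebra (K := K) (n := n)).fg_top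
    have hle : M ≤ Submodule.span Eᵐᵒᵖ ((commAeval (K := K) h hW.commute_left) '' s) := by
      rw [hM, Submodule.span_le]
      rintro _ ⟨f, rfl⟩
      have hf : f ∈ Submodule.span (MvPolynomial.symmetricSubalgebra (Fin n) K)
        (s : Set (MvPolynomial (Fin n) K)) := hs ▸ Submodule.mem_top
      induction hf using Submodule.span_induction with
      | mem f hf => exact Submodule.subset_span ⟨f, hf, rfl⟩
      | zero => rw [map_zero]; exact zero_mem _
      | add f g _ _ hf hg => rw [map_add]; exact add_mem hf hg
      | smul a f _ hf =>
        obtain ⟨e, he⟩ := commAeval_mem_of_isSymmetric hi hP a.2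
        have : commAeval h hW.commute_left (a • f) =
            MulOpposite.op e • commAeval h hW.commute_left f := by
          rw [hsmul, MulOpposite.unop_op]
          change commAeval h hW.commute_left (a.1 * f) = _ * (Φ : E →+* D) e
          rw [mul_comm, map_mul, ← he]
          rfl
        rw [this]
        exact Submodule.smul_mem _ _ hf
    have := Module.Finite.span_of_finite Eᵐᵒᵖ
      (s.finite_toSet.image (commAeval (K := K) h hW.commute_left))
    exact Submodule.finiteDimensional_of_le hle
  let l : D → D →ₗ[Eᵐᵒᵖ] D := fun d =>
    { toFun := fun r => d * r
      map_add' := mul_add d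
      map_smul' := fun e r => (mul_assoc d r _).symm }
  let T : Subalgebra K D :=
    { carrier := {d | ∀ r ∈ M, d * r ∈ M}
      mul_mem' := fun ha hb r hr => by rw [mul_assoc]; exact ha _ (hb _ hr)
      add_mem' := fun ha hb r hr => by rw [add_mul]; exact add_mem (ha _ hr) (hb _ hr)
      algebraMap_mem' := fun a r hr => by
        have : algebraMap K D a * r = MulOpposite.op (algebraMap K E a) • r := by
          rw [hsmul, MulOpposite.unop_op, AlgHom.commutes, Algebra.commutes]
        rw [this]
        exact M.smul_mem _ hr }
  -- Multiplication by `a ≠ 0` in `T` is an injective endomorphism of the finite-dimensional space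
  -- `M`, hence surjective.
  have hTinv : ∀ a ∈ T, a⁻¹ ∈ T := fun a ha => by
    rcases eq_or_ne a 0 with rfl | ha0
    · rwa [inv_zero]
    intro r hr
    let f : M →ₗ[Eᵐᵒᵖ] M := (l a).restrict ha
    have hinj : Function.Injective f := fun x y hxy =>
      Subtype.ext (mul_left_cancel₀ ha0 (congrArg Subtype.val hxy))
    obtain ⟨x, hx⟩ := LinearMap.injective_iff_surjective.1 hinj ⟨r, hr⟩
    have hx' : a * x.1 = r := congrArg Subtype.val hx
    rw [← hx', inv_mul_cancel_left₀ ha0]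
    exact x.2
  have hTF : ∀ f, commAeval (K := K) h hW.commute_left f ∈ T := fun f r hr => by
    rw [hM] at hr
    induction hr using Submodule.span_induction with
    | mem r hr =>
      obtain ⟨g, rfl⟩ := hr
      exact Submodule.subset_span ⟨f * g, map_mul _ _ _⟩
    | zero => rw [mul_zero]; exact zero_mem _
    | add r s _ _ hr hs => rw [mul_add]; exact add_mem hr hs
    | smul e r _ hr => rw [hsmul, ← mul_assoc, ← hsmul]; exact M.smul_mem _ hr
  have hu : ∀ i, u i ∈ M := fun i => by
    rw [← (isShiftSystem hi hq).sum_map_pow_mul_coeff i]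
    refine sum_mem fun k _ => ?_
    obtain ⟨e, he⟩ := hQ k
    rw [← he, ratFuncHom_ratVar]
    exact M.smul_mem (MulOpposite.op e)
      (Submodule.subset_span ⟨MvPolynomial.X i ^ k, by rw [map_pow, commAeval_X]⟩)
  have hTu : ∀ i, u i ∈ T := fun i r hr => by
    rw [hM] at hr
    induction hr using Submodule.span_induction with
    | mem r hr =>
      obtain ⟨g, rfl⟩ := hr
      rw [mul_commAeval hW hq]
      exact hTF _ _ (hu i)
    | zero => rw [mul_zero]; exact zero_mem _
    | add r s _ _ hr hs => rw [mul_add]; exact add_mem hr hs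
    | smul e r _ hr => rw [hsmul, ← mul_assoc, ← hsmul]; exact M.smul_mem _ hr
  have hT := hgen T hTinv (fun i => by
    have := hTF (MvPolynomial.X i)
    rwa [commAeval_X] at this) hTu
  rw [eq_top_iff]
  intro d _
  have hd : d ∈ T := hT ▸ Algebra.mem_top
  have := hd 1 (Submodule.subset_span ⟨1, map_one _⟩)
  rwa [mul_one] at this

/-- Elements invariant under permutations of the `h i` lie in the image of `Φ`: averaging turns a
combination of polynomials in the `h i` with coefficients in `E` into one of symmetric
polynomials. -/
theorem mem_range_of_forall_eq [CharZero K] (hi : hW.Independent) (hq : q ≠ 0) (Φ : E →ₐ[K] D)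
    (hP : nodalPoly (ratFuncHom hi) (ratVar K) ∈ coeffSubring Φ.range)
    (hQ : interpolant (ratFuncHom hi) (ratVar K) u ∈ coeffSubring Φ.range)
    (hgen : ∀ S : Subalgebra K D, (∀ a ∈ S, a⁻¹ ∈ S) → (∀ i, h i ∈ S) → (∀ i, u i ∈ S) → S = ⊤)
    (ρ : Equiv.Perm (Fin n) → D →ₐ[K] D) (hρ : ∀ σ i, ρ σ (h i) = h (σ i))
    (hρΦ : ∀ σ e, ρ σ (Φ e) = Φ e) {w : D} (hw : ∀ σ, ρ σ w = w) : w ∈ Φ.range := by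
  have hspan := exists_span_eq_top hi hq Φ hP hQ hgen
  let := rightModule Φ
  have hsmul : ∀ (e : Eᵐᵒᵖ) (d : D), e • d = d * Φ e.unop := fun _ _ => rfl
  have hsum : ∀ d : D, ∑ σ, ρ σ d ∈ Φ.range := fun d => by
    have hd : d ∈ Submodule.span Eᵐᵒᵖ (Set.range (commAeval (K := K) h hW.commute_left)) :=
      hspan ▸ Submodule.mem_top
    induction hd using Submodule.span_induction with
    | mem r hr =>
      obtain ⟨f, rfl⟩ := hr
      have h1 : ∀ σ, ρ σ (commAeval h hW.commute_left f) =
          commAeval h hW.commute_left (MvPolynomial.rename σ f) := fun σ =>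
        AlgHom.congr_fun (φ₁ := (ρ σ).comp (commAeval h hW.commute_left))
          (φ₂ := (commAeval h hW.commute_left).comp (MvPolynomial.rename σ))
          (MvPolynomial.algHom_ext fun i => by simp [hρ]) f
      simp only [h1, ← map_sum]
      refine commAeval_mem_of_isSymmetric hi hP fun τ => ?_
      rw [map_sum]
      refine Fintype.sum_equiv (Equiv.mulLeft τ) _ _ fun σ => ?_
      rw [MvPolynomial.rename_rename]
      rfl
    | zero => simp
    | add r s _ _ hr hs => simp only [map_add, Finset.sum_add_distrib]; exact add_mem hr hs
    | smul e r _ hr =>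
      simp only [hsmul, map_mul, hρΦ, ← Finset.sum_mul]
      exact mul_mem hr ⟨_, rfl⟩
  have h1 := hsum w
  simp only [hw, Finset.sum_const, Finset.card_univ] at h1
  have h2 := Φ.range.smul_mem h1 ((Fintype.card (Equiv.Perm (Fin n)) : K)⁻¹)
  rwa [← Nat.cast_smul_eq_nsmul K, smul_smul, inv_mul_cancel₀, one_smul] at h2
  exact_mod_cast Fintype.card_ne_zero

end IsWeylFamily

/-! ### Invariance of the Toda pair -/

section Invariance

variable {K F D : Type*} [Field K] [Field F] [Algebra K F] [DivisionRing D] [Algebra K D] {n : ℕ}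

theorem map_nodal (f : F →+* F) (t : Fin n → F) (s : Finset (Fin n)) :
    (Lagrange.nodal s t).map f = Lagrange.nodal s fun i => f (t i) := by
  simp [Lagrange.nodal, Polynomial.map_prod]

theorem map_basis (f : F →+* F) (t : Fin n → F) (i : Fin n) :
    (Lagrange.basis Finset.univ t i).map f =
      Lagrange.basis Finset.univ (fun j => f (t j)) i := by
  simp [Lagrange.basis, Lagrange.basisDivisor, Polynomial.map_prod]

theorem basis_comp_perm (t : Fin n → F) (σ : Equiv.Perm (Fin n)) (i : Fin n) :
    Lagrange.basis Finset.univ (fun j => t (σ j)) i = Lagrange.basis Finset.univ t (σ i) := by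
  refine Finset.prod_equiv σ (fun j => ?_) fun _ _ => rfl
  simp

theorem nodal_comp_perm (t : Fin n → F) (σ : Equiv.Perm (Fin n)) :
    Lagrange.nodal Finset.univ (fun j => t (σ j)) = Lagrange.nodal Finset.univ t :=
  Fintype.prod_equiv σ _ _ fun _ => rfl

variable {φ : F →ₐ[K] D} {t : Fin n → F} {u : Fin n → D} {ρ : D →ₐ[K] D} {π : F ≃ₐ[K] F}
  {σ : Equiv.Perm (Fin n)}

theorem map_nodalPoly (hφ : ∀ f, ρ (φ f) = φ (π f)) (ht : ∀ i, π (t i) = t (σ i)) :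
    (nodalPoly φ t).map (ρ : D →+* D) = nodalPoly φ t := by
  have h1 : (ρ : D →+* D).comp (φ : F →+* D) = (φ : F →+* D).comp (π : F →+* F) := RingHom.ext hφ
  rw [nodalPoly, Polynomial.map_map, h1, ← Polynomial.map_map, map_nodal]
  simp only [RingHom.coe_coe, ht, nodal_comp_perm]

theorem map_interpolant (hφ : ∀ f, ρ (φ f) = φ (π f)) (ht : ∀ i, π (t i) = t (σ i))
    (hu : ∀ i, ρ (u i) = u (σ i)) :
    (interpolant φ t u).map (ρ : D →+* D) = interpolant φ t u := by
  have h1 : (ρ : D →+* D).comp (φ : F →+* D) = (φ : F →+* D).comp (π : F →+* F) := RingHom.ext hφ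
  rw [interpolant, Polynomial.map_sum]
  refine Fintype.sum_equiv σ _ _ fun i => ?_
  rw [Polynomial.map_mul, Polynomial.map_map, h1, ← Polynomial.map_map, map_basis, map_C]
  simp only [RingHom.coe_coe, ht, basis_comp_perm, hu]

theorem mem_of_map_eq {f : D[X]} (hf : f.map (ρ : D →+* D) = f) (k : ℕ) :
    ρ (f.coeff k) = f.coeff k := by
  conv_rhs => rw [← hf]
  rw [coeff_map]
  rfl

end Invariance

namespace IsWeylFamily

variable {K D : Type*} [Field K] [DivisionRing D] [Algebra K D] {n : ℕ} {q : K} {h u : Fin n → D}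
  {hW : IsWeylFamily q h u}

theorem map_ratFuncHom (hi : hW.Independent) {ρ : D →ₐ[K] D} {σ : Equiv.Perm (Fin n)}
    (hρ : ∀ i, ρ (h i) = h (σ i)) (f : RatFunc K n) :
    ρ (ratFuncHom hi f) = ratFuncHom hi
      (IsFractionRing.fieldEquivOfAlgEquiv K (RatFunc K n) (RatFunc K n)
        (MvPolynomial.renameEquiv K σ) f) := by
  have h1 : ∀ f, ρ (commAeval h hW.commute_left f) =
      commAeval h hW.commute_left (MvPolynomial.rename σ f) :=
    AlgHom.congr_fun (φ₁ := ρ.comp (commAeval h hW.commute_left))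
      (φ₂ := (commAeval h hW.commute_left).comp (MvPolynomial.rename σ))
      (MvPolynomial.algHom_ext fun i => by simp [hρ])
  obtain ⟨a, b, _, rfl⟩ := IsFractionRing.div_surjective (A := MvPolynomial (Fin n) K) f
  simp only [map_div₀, IsFractionRing.fieldEquivOfAlgEquiv_algebraMap, ratFuncHom_algebraMap, h1,
    MvPolynomial.renameEquiv_apply]

theorem renameEquiv_ratVar (σ : Equiv.Perm (Fin n)) (i : Fin n) :
    IsFractionRing.fieldEquivOfAlgEquiv K (RatFunc K n) (RatFunc K n)
        (MvPolynomial.renameEquiv K σ) (ratVar K i) = ratVar K (σ i) := by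
  rw [ratVar, IsFractionRing.fieldEquivOfAlgEquiv_algebraMap]
  simp [ratVar]

end IsWeylFamily

/-! ### Extending homomorphisms to the skew field of fractions -/

namespace SkewFrac

variable {K A D : Type*} [Field K] [Ring A] [Algebra K A] [IsOreDomain A] [DivisionRing D]
  [Algebra K D]

/-- The canonical embedding `A → Frac A`, as a homomorphism of algebras. -/
noncomputable def coeAlgHom (K A : Type*) [Field K] [Ring A] [Algebra K A] [IsOreDomain A] :
    A →ₐ[K] SkewFrac A where
  __ := coeHom A
  commutes' _ := rfl

theorem coeAlgHom_injective : Function.Injective (coeAlgHom K A) := coeHom_injective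

/-- The extension to `Frac A` of an injective homomorphism from `A` to a skew field. -/
noncomputable def lift (f : A →ₐ[K] D) (hf : Function.Injective f) : SkewFrac A →ₐ[K] D where
  __ := OreLocalization.universalHom (f : A →+* D)
    ({ toFun s := Units.mk0 (f s) (by
          rw [Ne, map_eq_zero_iff _ hf]
          exact nonZeroDivisors.coe_ne_zero s)
       map_one' := by ext; simp
       map_mul' s t := by ext; simp } : nonZeroDivisors A →* Dˣ)
    fun _ => rfl
  commutes' r := (OreLocalization.universalHom_commutes _ _ fun _ => rfl).trans (f.commutes r)

theorem lift_coe (f : A →ₐ[K] D) (hf : Function.Injective f) (a : A) :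
    lift f hf (coeAlgHom K A a) = f a :=
  OreLocalization.universalHom_commutes _ _ fun _ => rfl

theorem exists_eq (w : SkewFrac A) : ∃ a s : A, w = (coeAlgHom K A s)⁻¹ * coeAlgHom K A a := by
  induction w using OreLocalization.ind with
  | c r s =>
    refine ⟨r, s, ?_⟩
    have hs : coeAlgHom K A s ≠ 0 := by
      rw [Ne, map_eq_zero_iff _ coeAlgHom_injective]
      exact nonZeroDivisors.coe_ne_zero s
    rw [eq_inv_mul_iff_mul_eq₀ hs]
    exact OreLocalization.smul_cancel

theorem eq_top_of_coe_mem {S : Subalgebra K (SkewFrac A)} (hS : ∀ a ∈ S, a⁻¹ ∈ S)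
    (h : ∀ a, coeAlgHom K A a ∈ S) : S = ⊤ := by
  rw [eq_top_iff]
  intro w _
  obtain ⟨a, s, rfl⟩ := exists_eq (K := K) w
  exact S.mul_mem (hS _ (h s)) (h a)

theorem inv_mem_invariants {G : Type*} [Group G] {ρ : G →* (A ≃ₐ[K] A)} {a : SkewFrac A}
    (ha : a ∈ invariants ρ) : a⁻¹ ∈ invariants ρ := fun g => by
  rw [map_inv₀, ha g]

theorem lift_mem (f : A →ₐ[K] D) (hf : Function.Injective f) {S : Subalgebra K D}
    (hS : ∀ a ∈ S, a⁻¹ ∈ S) (h : ∀ a, f a ∈ S) (w : SkewFrac A) : lift f hf w ∈ S := by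
  obtain ⟨a, s, rfl⟩ := exists_eq (K := K) w
  rw [map_mul, map_inv₀, lift_coe, lift_coe]
  exact S.mul_mem (hS _ (h s)) (h a)

end SkewFrac

/-- The leading exponents of the ordered monomials in the `x i * y i` and `y i` are distinct. -/
theorem linearIndependent_commMonomial_mul {K R S : Type*} [Field K] [Ring R] [Algebra K R] [Ring S]
    [Algebra K S] {n : ℕ} {b : Module.Basis (Fin n → ℕ × ℕ) K R} (hb : IsMonomialBasis b)
    (h1 : b 0 = 1) {x y e : Fin n → R} (hx : ∀ i, x i = b (Pi.single i (1, 0)))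
    (hy : ∀ i, y i = b (Pi.single i (0, 1))) (he : ∀ i, e i = x i * y i)
    {f : R →ₐ[K] S} (hf : Function.Injective f)
    (hc : ∀ i j, Commute (f (e i)) (f (e j))) (hc' : ∀ i j, Commute (f (y i)) (f (y j))) :
    LinearIndependent K fun m : (Fin n →₀ ℕ) × (Fin n →₀ ℕ) =>
      commMonomial K (fun i => f (e i)) hc m.1 * commMonomial K (fun i => f (y i)) hc' m.2 := by
  have hcR : ∀ i j, Commute (e i) (e j) := fun i j => hf (by
    rw [map_mul, map_mul]; exact hc i j)
  have hcR' : ∀ i j, Commute (y i) (y j) := fun i j => hf (by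
    rw [map_mul, map_mul]; exact hc' i j)
  suffices h : LinearIndependent K fun m : (Fin n →₀ ℕ) × (Fin n →₀ ℕ) =>
      commMonomial K e hcR m.1 * commMonomial K y hcR' m.2 by
    convert! h.map_injOn f.toLinearMap hf.injOn using 2 with m
    rw [Function.comp_apply, AlgHom.toLinearMap_apply, map_mul, commMonomial, commMonomial,
      algHom_commAeval f hc, algHom_commAeval f hc']
  have hw := QuantumWeylPower.lexExponent_mono (n := n)
  have hinj := QuantumWeylPower.lexExponent_injective (n := n)
  have hY : ∀ i, IsLeading b (QuantumWeylPower.lexExponent n) (y i) (Pi.single i (0, 1)) :=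
    fun i => hy i ▸ isLeading_basis _ _
  have hX : ∀ i, IsLeading b (QuantumWeylPower.lexExponent n) (x i) (Pi.single i (1, 0)) :=
    fun i => hx i ▸ isLeading_basis _ _
  have hE : ∀ i, IsLeading b (QuantumWeylPower.lexExponent n) (e i)
      (Pi.single i (1, 0) + Pi.single i (0, 1)) := fun i => he i ▸ (hX i).mul hb hw hinj (hY i)
  refine linearIndependent_of_isLeading hinj ?_ fun m =>
    (isLeading_commMonomial hb hw hinj h1 hE m.1).mul hb hw hinj
      (isLeading_commMonomial hb hw hinj h1 hY m.2)
  have hval : ∀ (m : Fin n →₀ ℕ) (x : ℕ × ℕ) (j : Fin n),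
      (m.sum fun i k => k • (Pi.single i x : Fin n → ℕ × ℕ)) j = m j • x := fun m x j => by
    rw [Finsupp.sum, Finset.sum_apply, Finset.sum_eq_single j]
    · simp
    · intro i _ hij
      simp [hij.symm]
    · intro hj
      simp [Finsupp.notMem_support_iff.1 hj]
  intro m m' hmm'
  have h1 : ∀ j, m.1 j = m'.1 j ∧ m.1 j + m.2 j = m'.1 j + m'.2 j := fun j => by
    have := congrFun hmm' j
    simp only [← Pi.single_add, Pi.add_apply, hval] at this
    simpa using this
  ext j
  · exact (h1 j).1
  · have := h1 j; omega

namespace QuantumWeylPower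

variable {K : Type*} [Field K] {q : K} {n : ℕ}

theorem algHom_mem {R : Type*} [Ring R] [Algebra K R] (g : QuantumWeylPower K q n →ₐ[K] R)
    {S : Subalgebra K R} (hX : ∀ i, g (genX K q i) ∈ S) (hY : ∀ i, g (genY K q i) ∈ S)
    (a : QuantumWeylPower K q n) : g a ∈ S := by
  let f : Fin n → QuantumWeyl K q →ₐ[K] S := fun i =>
    (g.comp (single K q i)).codRestrict S (QuantumWeyl.algHom_mem _ (hX i) (hY i))
  have hf : ∀ i j, i ≠ j → ∀ a b, Commute (f i a) (f j b) := fun i j hij a b =>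
    Subtype.ext ((commute_single hij a b).map g).eq
  have hg : S.val.comp (tensorPowerLift f hf) = g := algHom_ext
    (fun i => congrArg Subtype.val (tensorPowerLift_single f hf i _))
    (fun i => congrArg Subtype.val (tensorPowerLift_single f hf i _))
  rw [← hg]
  exact (tensorPowerLift f hf a).2

theorem permTensorPower_single (σ : Equiv.Perm (Fin n)) (i : Fin n) (a : QuantumWeyl K q) :
    permTensorPower K (QuantumWeyl K q) n σ
      (single K q i a) =
      single K q (σ i) a := by
  refine (permTensorPower_tprod K (QuantumWeyl K q) n σ
    (Pi.mulSingle (M := fun _ => QuantumWeyl K q) i a)).trans ?_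
  change PiTensorProduct.tprod K _ =
    PiTensorProduct.tprod K (Pi.mulSingle (M := fun _ => QuantumWeyl K q) (σ i) a)
  congr 1
  ext j
  simp only [Pi.mulSingle_apply, Equiv.symm_apply_eq]

/-- The element `x * y` of the `i`-th tensor factor. -/
noncomputable def euler (K : Type*) [Field K] (q : K) (i : Fin n) : QuantumWeylPower K q n :=
  genX K q i * genY K q i

theorem commute_genY_genY (i j : Fin n) : Commute (genY K q i) (genY K q j) := by
  rcases eq_or_ne i j with rfl | hij
  exacts [Commute.refl _, commute_single hij _ _]

theorem commute_euler_genY {i j : Fin n} (hij : i ≠ j) : Commute (euler K q i) (genY K q j) :=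
  (commute_single hij _ _).mul_left (commute_genY_genY i j)

theorem commute_euler_euler (i j : Fin n) : Commute (euler K q i) (euler K q j) := by
  rcases eq_or_ne i j with rfl | hij
  · exact Commute.refl _
  · exact Commute.mul_right (Commute.mul_left (commute_single hij _ _) (commute_single hij _ _))
      (commute_euler_genY hij)

end QuantumWeylPower

namespace QuantumWeylPower

variable {K : Type*} [Field K] {q : K} {n : ℕ} {D : Type*} [DivisionRing D] [Algebra K D]
  {f : QuantumWeylPower K q n →ₐ[K] D}

theorem linearIndependent_map (hq : q ≠ 0) (hf : Function.Injective f)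
    (hc : ∀ i j, Commute (f (euler K q i)) (f (euler K q j)))
    (hc' : ∀ i j, Commute (f (genY K q i)) (f (genY K q j))) :
    LinearIndependent K fun m : (Fin n →₀ ℕ) × (Fin n →₀ ℕ) =>
      commMonomial K (fun i => f (euler K q i)) hc m.1 *
        commMonomial K (fun i => f (genY K q i)) hc' m.2 :=
  linearIndependent_commMonomial_mul (isMonomialBasis (n := n) hq) one_eq.symm genX_eq genY_eq
    (fun _ => rfl) hf hc hc'

/-- The elements `x i * y i`, `y i` of the tensor power form a Weyl family. -/
theorem isWeylFamily (hq : q ≠ 0) (hf : Function.Injective f) :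
    IsWeylFamily q (fun i => f (euler K q i)) (fun i => f (genY K q i)) := by
  have hl : ∀ i j, Commute (f (euler K q i)) (f (euler K q j)) := fun i j =>
    (commute_euler_euler i j).map f
  have hr : ∀ i j, Commute (f (genY K q i)) (f (genY K q j)) := fun i j =>
    (commute_genY_genY i j).map f
  have hi := linearIndependent_map hq hf hl hr
  refine ⟨fun i => ?_, fun i h0 => ?_, fun i => ?_, hl, hr,
    fun i j hij => (commute_euler_genY hij).map f⟩
  · have := hi.ne_zero (0, Finsupp.single i 1)
    simpa only [commMonomial_zero, commMonomial_single, one_mul, pow_one] using this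
  · have h1 := linearIndependent_iff'.1 hi {(0, 0), (Finsupp.single i 1, 0)}
      (fun m => if m.1 = 0 then 1 else q - 1) (by
        rw [Finset.sum_pair (by simp [eq_comm])]
        simpa [commMonomial_zero, commMonomial_single] using h0) (0, 0) (by simp)
    simp at h1
  · rw [← map_mul, ← map_mul, euler, ← mul_assoc, genY_mul_genX, add_mul, one_mul, map_add,
      mul_assoc,
      map_mul f (algebraMap K _ q), AlgHom.commutes, Algebra.smul_def]

theorem isWeylFamily_independent (hq : q ≠ 0) (hf : Function.Injective f) :
    (isWeylFamily hq hf).Independent :=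
  linearIndependent_map hq hf _ _

end QuantumWeylPower

/-! ### The isomorphism -/

namespace QuantumWeylPower

variable {K : Type*} [Field K] {q : K} {n : ℕ} [IsOreDomain (QuantumWeylPower K q n)]

theorem map_coe_euler (σ : Equiv.Perm (Fin n)) (i : Fin n) :
    SkewFrac.map (permTensorPower K (QuantumWeyl K q) n σ)
        (SkewFrac.coeAlgHom K (QuantumWeylPower K q n) (euler K q i)) =
      SkewFrac.coeAlgHom K (QuantumWeylPower K q n) (euler K q (σ i)) := by
  refine (SkewFrac.map_coeHom _ _).trans ?_
  rw [euler, map_mul, genX, genY, permTensorPower_single, permTensorPower_single]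
  rfl

theorem map_coe_genY (σ : Equiv.Perm (Fin n)) (i : Fin n) :
    SkewFrac.map (permTensorPower K (QuantumWeyl K q) n σ)
        (SkewFrac.coeAlgHom K (QuantumWeylPower K q n) (genY K q i)) =
      SkewFrac.coeAlgHom K (QuantumWeylPower K q n) (genY K q (σ i)) := by
  refine (SkewFrac.map_coeHom _ _).trans ?_
  rw [genY, permTensorPower_single]
  rfl

theorem eq_top_of_coe_mem (hq : q ≠ 0)
    {S : Subalgebra K (SkewFrac (QuantumWeylPower K q n))} (hS : ∀ a ∈ S, a⁻¹ ∈ S)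
    (he : ∀ i, SkewFrac.coeAlgHom K (QuantumWeylPower K q n) (euler K q i) ∈ S)
    (hY : ∀ i, SkewFrac.coeAlgHom K (QuantumWeylPower K q n) (genY K q i) ∈ S) : S = ⊤ := by
  refine SkewFrac.eq_top_of_coe_mem hS (algHom_mem _ (fun i => ?_) hY)
  have h0 := (isWeylFamily hq
    (SkewFrac.coeAlgHom_injective (K := K) (A := QuantumWeylPower K q n))).ne_zero i
  have := S.mul_mem (he i) (hS _ (hY i))
  rwa [euler, map_mul, mul_inv_cancel_right₀ h0] at this

/-- The Weyl family obtained from the Toda pair of the `x i * y i`, `y i` is invariant and defines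
an isomorphism from the skew field of fractions onto the algebra of invariants. -/
theorem nonempty_invariants_algEquiv [CharZero K] (hq : q ≠ 0) :
    Nonempty (SkewFrac.invariants (permTensorPower K (QuantumWeyl K q) n) ≃ₐ[K]
      SkewFrac (QuantumWeylPower K q n)) := by
  have hinj := SkewFrac.coeAlgHom_injective (K := K) (A := QuantumWeylPower K q n)
  set ι := SkewFrac.coeAlgHom K (QuantumWeylPower K q n) with hι
  set I := SkewFrac.invariants (permTensorPower K (QuantumWeyl K q) n) with hI
  have hW := isWeylFamily hq hinj
  have hi : hW.Independent := isWeylFamily_independent hq hinj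
  have hT := (IsWeylFamily.isShiftSystem hi hq).isTodaPair
  have hinv : ∀ a ∈ I, a⁻¹ ∈ I := fun a ha => SkewFrac.inv_mem_invariants ha
  have hφ := fun σ => IsWeylFamily.map_ratFuncHom hi
    (ρ := SkewFrac.map (permTensorPower K (QuantumWeyl K q) n σ)) (map_coe_euler σ)
  -- Permuting the indices fixes both polynomials, so their coefficients are invariant.
  have hPI : nodalPoly (IsWeylFamily.ratFuncHom hi) (IsWeylFamily.ratVar K) ∈ coeffSubring I :=
    fun k σ => mem_of_map_eq (map_nodalPoly (hφ σ) (IsWeylFamily.renameEquiv_ratVar σ)) k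
  have hQI : interpolant (IsWeylFamily.ratFuncHom hi) (IsWeylFamily.ratVar K)
      (fun i => ι (genY K q i)) ∈ coeffSubring I :=
    fun k σ => mem_of_map_eq
      (map_interpolant (hφ σ) (IsWeylFamily.renameEquiv_ratVar σ) (map_coe_genY σ)) k
  obtain ⟨p, Y, hpY, hmem, hP, hQ, -⟩ := hT.exists_weylFamily hq
  have hpYI := hmem I hinv hPI hQI
  have hφ0 : Function.Injective hpY.quantumWeylHom :=
    hpY.quantumWeylHom_injective hq hW.commute_esymm
      (IsWeylFamily.commute_interpolant_coeff hi hq)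
      (fun i => IsWeylFamily.commAeval_esymm_mem hi hP i.2) (fun i => hQ i)
      (IsWeylFamily.linearIndependent_esymm_mul_coeff hi hq)
  let Φ := SkewFrac.lift (K := K) (A := QuantumWeylPower K q n) hpY.quantumWeylHom hφ0
  have hΦI : ∀ w, Φ w ∈ I := SkewFrac.lift_mem _ _ hinv <| algHom_mem _
    (fun i => by
      rw [hpY.quantumWeylHom_genX]
      exact I.mul_mem (hpYI i).1 (hinv _ (hpYI i).2))
    (fun i => by
      rw [hpY.quantumWeylHom_genY]
      exact (hpYI i).2)
  have hrange : ∀ a ∈ Φ.range, a⁻¹ ∈ Φ.range := by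
    rintro _ ⟨w, rfl⟩
    exact ⟨w⁻¹, map_inv₀ Φ w⟩
  have hYr : ∀ i, Y i ∈ Φ.range := fun i =>
    ⟨ι (genY K q i), (SkewFrac.lift_coe _ _ _).trans (hpY.quantumWeylHom_genY i)⟩
  have hpr : ∀ i, p i ∈ Φ.range := fun i =>
    ⟨ι (genX K q i) * ι (genY K q i), by
      change Φ _ = _
      rw [map_mul, SkewFrac.lift_coe, SkewFrac.lift_coe, hpY.quantumWeylHom_genX,
        hpY.quantumWeylHom_genY, inv_mul_cancel_right₀ (hpY.ne_zero i)]⟩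
  -- The image is closed under inverses and contains the `p i` and `Y i`, in which the coefficients
  -- of the Toda pair are rational.
  have hle : weylAdjoin q p Y ≤ Φ.range := by
    rw [weylAdjoin, Algebra.adjoin_le_iff, Set.iUnion_subset_iff]
    rintro i _ (rfl | rfl | rfl | rfl)
    · exact hpr i
    · exact hYr i
    · exact hrange _ (hYr i)
    · exact hrange _ (add_mem (one_mem _) (Φ.range.smul_mem (hpr i) _))
  have hsurj : ∀ w ∈ I, w ∈ Φ.range := fun w hw =>
    IsWeylFamily.mem_range_of_forall_eq hi hq Φ (fun k => hle (hP k)) (fun k => hle (hQ k))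
      (fun S hS he hY => eq_top_of_coe_mem hq hS he hY)
      (fun σ => SkewFrac.map (permTensorPower K (QuantumWeyl K q) n σ)) map_coe_euler
      (fun σ e => hΦI e σ) hw
  refine ⟨(AlgEquiv.ofBijective (Φ.codRestrict I hΦI) ⟨?_, ?_⟩).symm⟩
  · intro a b hab
    exact Φ.toRingHom.injective (congrArg Subtype.val hab)
  · rintro ⟨w, hw⟩
    obtain ⟨e, he⟩ := hsurj w hw
    exact ⟨e, Subtype.ext he⟩

end QuantumWeylPower

theorem mainTheorem3 (K : Type*) [Field K] [CharZero K] (q : K) (hq : q ≠ 0) (n : ℕ) (hn : 0 < n) :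
    ∃ _ : IsOreDomain (QuantumWeylPower K q n),
      Nonempty (SkewFrac.invariants (permTensorPower K (QuantumWeyl K q) n) ≃ₐ[K]
        SkewFrac (QuantumWeylPower K q n)) := by
  have := QuantumWeylPower.isOreDomain hq n
  exact ⟨this, QuantumWeylPower.nonempty_invariants_algEquiv hq⟩
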